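/- Let $f$ be a (Laurent) polynomial in two variables over the min-plus algebra, with Newton polygon $P\subset\mathbb{R}^2$, and let $C\subset\mathbb{R}^2$ be the tropical plane curve it defines (the set of points where the minimum is attained at least twice). Assume that $C$ is smooth, i.e. that the regular subdivision of $P$ dual to $C$ is a unimodular triangulation, and that $P$ is nonhyperelliptic, i.e. that the convex hull of the lattice points in the interior of $P$ is two-dimensional. Let $G$ be the skeleton of $C$: the metric graph obtained from $C$ by removing the unbounded edges and then successively all leaves, and smoothing over the two-valent vertices, with edge lengths given by lattice length. A combinatorial chain of genus $g\ge 2$ is a graph obtained as follows: take a line segment with $g-1$ nodes, double each of its edges, and attach a loop at each end node (two loops at the same node if $g=2$); then split every (now $4$-valent) node into two vertices joined by a new edge, so that either the two half-edges coming from the left go to one vertex and the two coming from the right go to the other, or each of the two vertices receives one half-edge from the left and one from the right. No condition is imposed on the edge lengths. If $G$ is, as a graph without lengths, a chain of some genus $g\ge2$, then the metric graph $G$ is not hyperelliptic, i.e. it has no isometric involution $i$ such that $G/i$ is a tree. Moreover, $G$ has a two-cut (two edges whose deletion together disconnects $G$, while the deletion of either one alone does not) whose two edges have different lattice lengths. 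-/

import Mathlib

/-!  Tropical plane curves, their skeleta, chains and hyperelliptic metric graphs. -/

noncomputable section

/-! ### Multigraphs and metric graphs -/

/-- A graph with loops and multiple edges allowed. Each edge is given by its two orientations
(darts), exchanged by the fixed-point-free involution `rev`; `src d` is the initial vertex of `d`,
so that `src (rev d)` is its terminal vertex. -/
structure Multigraph where
  Vert : Type
  Dart : Type
  src : Dart → Vert
  rev : Dart → Dart
  rev_rev : ∀ d, rev (rev d) = d
  rev_ne : ∀ d, rev d ≠ d

namespace Multigraph

/-- Isomorphisms of multigraphs. -/
structure Iso (G H : Multigraph) where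
  vert : G.Vert ≃ H.Vert
  dart : G.Dart ≃ H.Dart
  src_dart : ∀ d, H.src (dart d) = vert (G.src d)
  rev_dart : ∀ d, H.rev (dart d) = dart (G.rev d)

/-- `φ` is an involution (the identity is allowed). -/
def Iso.IsInvolution {G : Multigraph} (φ : Iso G G) : Prop :=
  (∀ v, φ.vert (φ.vert v) = v) ∧ ∀ d, φ.dart (φ.dart d) = d

/-- Every two vertices are joined by a path that uses no dart in `S` (nor the reverse of one). -/
def ConnectedAvoiding (G : Multigraph) (S : Set G.Dart) : Prop :=
  ∀ u v, Relation.ReflTransGen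
    (fun x y => ∃ d, d ∉ S ∧ G.rev d ∉ S ∧ G.src d = x ∧ G.src (G.rev d) = y) u v

/-- The edges underlying `d` and `e` form a two-cut: deleting both disconnects the graph, deleting
only one of them does not. -/
def IsTwoCut (G : Multigraph) (d e : G.Dart) : Prop :=
  G.ConnectedAvoiding {d} ∧ G.ConnectedAvoiding {e} ∧ ¬ G.ConnectedAvoiding {d, e}

/-- Orbits of vertices under `φ`. -/
def VertOrbit {G : Multigraph} (φ : Iso G G) : Type :=
  Quot fun v w : G.Vert => w = φ.vert v

/-- Orbits of darts (that is, of half-edges) under `φ`. -/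
def DartOrbit {G : Multigraph} (φ : Iso G G) : Type :=
  Quot fun d e : G.Dart => e = φ.dart d

/-- Orbits of (unoriented) edges under `φ`. -/
def EdgeOrbit {G : Multigraph} (φ : Iso G G) : Type :=
  Quot fun d e : G.Dart => e = G.rev d ∨ e = φ.dart d

/-- The topological quotient `G/φ`, subdivided so that it is a simple graph. Cut every edge of `G`
at its midpoint and at the midpoints of its two halves; the points obtained are the vertices, one
point for every dart `d` (the middle of the half-edge that starts at `src d`), and one for every
edge. The resulting simple graph is acted on by `φ`, no segment is inverted, and below is its
quotient: the dart point `d` is joined to the vertex `src d` and to the midpoint of the edge of `d`.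
An edge that `φ` reverses gives a segment that ends in (the image of) its midpoint. -/
def quotientGraph {G : Multigraph} (φ : Iso G G) :
    SimpleGraph (VertOrbit φ ⊕ DartOrbit φ ⊕ EdgeOrbit φ) :=
  SimpleGraph.fromRel fun x y => ∃ d : G.Dart, y = Sum.inr (Sum.inl (Quot.mk _ d)) ∧
    (x = Sum.inl (Quot.mk _ (G.src d)) ∨ x = Sum.inr (Sum.inr (Quot.mk _ d)))

/-- The reverse of a dart in the chain on `n` nodes, see `chain`. -/
def chainRev (n : ℕ) : Fin n × (Bool ⊕ Bool × Bool) → Fin n × (Bool ⊕ Bool × Bool)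
  | (i, Sum.inl b) => (i, Sum.inl !b)
  | (i, Sum.inr (true, b)) =>
      if h : i.val + 1 < n then (⟨i.val + 1, h⟩, Sum.inr (false, b)) else (i, Sum.inr (true, !b))
  | (i, Sum.inr (false, b)) =>
      if i.val = 0 then (i, Sum.inr (false, !b))
      else (⟨i.val - 1, by omega⟩, Sum.inr (true, b))

/-- The combinatorial chain of genus `n + 1` given by the binary string `s`.

Take a line segment on the nodes `0, …, n - 1`, double each of its edges, and attach a loop at each
of the two end nodes. Every node `i` is then `4`-valent: the half-edges on its right are
`(i, inr (true, b))` and those on its left are `(i, inr (false, b))`, with `b : Bool`; the `b`-th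
half-edge on the right of `i` is glued to the `b`-th half-edge on the left of `i + 1`, and the outer
half-edges of the end nodes are glued to loops. Now split each node `i` into two vertices `(i, false)`
and `(i, true)` joined by a new edge, whose two orientations are the darts `(i, inl b)`.
If `s i = true` the half-edges on the left go to `(i, false)` and those on the right to `(i, true)`
(the new edge is then a bridge), otherwise both half-edges with index `b` go to `(i, b)`
(the new edge is then shared by the two adjacent cycles). -/
def chain (n : ℕ) (s : Fin n → Bool) : Multigraph where
  Vert := Fin n × Bool
  Dart := Fin n × (Bool ⊕ Bool × Bool)
  src
    | (i, Sum.inl b) => (i, b)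
    | (i, Sum.inr (side, b)) => if s i then (i, side) else (i, b)
  rev := chainRev n
  rev_rev := by
    rintro ⟨⟨i, hi⟩, b | ⟨_ | _, b⟩⟩
    · simp [chainRev]
    · by_cases h : i = 0
      · simp [chainRev, h]
      · have h1 : i - 1 + 1 = i := by omega
        simp [chainRev, h, h1, hi]
    · by_cases h : i + 1 < n <;> simp [chainRev, h]
  rev_ne := by
    rintro ⟨⟨i, hi⟩, b | ⟨_ | _, b⟩⟩
    · simp [chainRev]
    · by_cases h : i = 0 <;> simp [chainRev, h]
    · by_cases h : i + 1 < n <;> simp [chainRev, h]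

/-- `G` is combinatorially a chain of some genus `n + 1 ≥ 2`. -/
def IsChain (G : Multigraph) : Prop :=
  ∃ n : ℕ, 1 ≤ n ∧ ∃ s : Fin n → Bool, Nonempty (Iso G (chain n s))

end Multigraph

/-- A multigraph with a positive length on each edge. -/
structure MetricGraph extends Multigraph where
  length : Dart → ℝ
  length_pos : ∀ d, 0 < length d
  length_rev : ∀ d, length (rev d) = length d

/-- A metric graph is hyperelliptic if it has an isometric involution whose quotient is a tree.
(If all vertices have valence at least three, as in all graphs considered below, the isometries of
the metric graph are exactly its length-preserving graph automorphisms.) -/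
def MetricGraph.IsHyperelliptic (G : MetricGraph) : Prop :=
  ∃ φ : Multigraph.Iso G.toMultigraph G.toMultigraph,
    φ.IsInvolution ∧ (∀ d, G.length (φ.dart d) = G.length d) ∧
      (Multigraph.quotientGraph φ).IsTree

/-! ### Removing leaves and smoothing two-valent vertices -/

section Smoothing

variable {W : Type}

/-- The vertices of the largest subgraph of `K` without vertices of valence `0` or `1`; for finite
connected `K` that is not a tree this subgraph is what remains when leaves are removed successively
(together with their edges), and it is the smallest subgraph onto which `K` retracts by
deformation. -/
def coreVertices (K : SimpleGraph W) : Set W :=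
  ⋃₀ {S : Set W | ∀ v ∈ S, 2 ≤ (K.neighborSet v ∩ S).encard}

/-- Vertices of valence at least three. -/
def IsBranch (K : SimpleGraph W) (v : W) : Prop :=
  3 ≤ (K.neighborSet v).encard

/-- A maximal arc of `K`, with an orientation: it starts and ends in a vertex of valence at least
three (possibly the same one), never repeats an edge, and passes through no other such vertex. -/
@[ext] structure OrientedArc (K : SimpleGraph W) where
  fst : W
  snd : W
  walk : K.Walk fst snd
  not_nil : ¬ walk.Nil
  isTrail : walk.IsTrail
  branch_fst : IsBranch K fst
  branch_snd : IsBranch K snd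
  interior : ∀ x ∈ walk.support.tail.dropLast, ¬ IsBranch K x

/-- The arc with the opposite orientation. -/
def OrientedArc.reverse {K : SimpleGraph W} (p : OrientedArc K) : OrientedArc K where
  fst := p.snd
  snd := p.fst
  walk := p.walk.reverse
  not_nil := by
    have h := p.not_nil
    rw [← SimpleGraph.Walk.length_eq_zero_iff] at h ⊢
    simpa using h
  isTrail := p.isTrail.reverse
  branch_fst := p.branch_snd
  branch_snd := p.branch_fst
  interior := by
    intro x hx
    apply p.interior x
    rw [SimpleGraph.Walk.support_reverse, List.tail_reverse, List.dropLast_reverse,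
      List.mem_reverse, List.tail_dropLast] at hx
    exact hx

/-- The total length of a walk, for given lengths of the edges. -/
def walkLength {K : SimpleGraph W} (len : W → W → ℝ) {u v : W} (p : K.Walk u v) : ℝ :=
  (p.darts.map fun d => len d.fst d.snd).sum

theorem nil_of_edges_reverse {K : SimpleGraph W} {u v : W} (w : K.Walk u v) (huv : u = v)
    (hn : w.edges.Nodup) (he : w.edges.reverse = w.edges) : w.Nil := by
  cases w with
  | nil => exact SimpleGraph.Walk.Nil.nil
  | cons hadj q =>
    exfalso
    cases q with
    | nil => exact hadj.ne huv
    | cons hadj2 q2 =>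
      rw [SimpleGraph.Walk.edges_cons] at he hn
      rw [List.nodup_cons] at hn
      have h3 := congrArg List.head? he
      rw [List.reverse_cons, List.head?_append_of_ne_nil _ (by simp), List.head?_cons] at h3
      exact hn.1 (List.mem_reverse.1 (List.mem_of_mem_head? h3))

theorem OrientedArc.reverse_ne {K : SimpleGraph W} (p : OrientedArc K) : p.reverse ≠ p := by
  intro h
  have he : p.walk.edges.reverse = p.walk.edges := by
    have h2 := congrArg (fun q : OrientedArc K => q.walk.edges) h
    simpa [OrientedArc.reverse] using h2
  have hfs : p.snd = p.fst := congrArg OrientedArc.fst h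
  exact p.not_nil (nil_of_edges_reverse p.walk hfs.symm p.isTrail.edges_nodup he)

theorem walkLength_reverse {K : SimpleGraph W} (len : W → W → ℝ)
    (symm : ∀ u v, len u v = len v u) {u v : W} (p : K.Walk u v) :
    walkLength len p.reverse = walkLength len p := by
  unfold walkLength
  rw [SimpleGraph.Walk.darts_reverse, List.map_reverse, List.sum_reverse, List.map_map]
  congr 1
  apply List.map_congr_left
  intro d _
  exact symm _ _

/-- The metric graph obtained from `K`, with edge lengths `len`, by smoothing over the vertices of
valence two: its vertices are those of valence at least three, its edges are the maximal arcs between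
them, and lengths are added along arcs. -/
def smoothing (K : SimpleGraph W) (len : W → W → ℝ) (symm : ∀ u v, len u v = len v u)
    (pos : ∀ u v, K.Adj u v → 0 < len u v) : MetricGraph where
  Vert := {v : W // IsBranch K v}
  Dart := OrientedArc K
  src p := ⟨p.fst, p.branch_fst⟩
  rev := OrientedArc.reverse
  rev_rev p := by
    obtain ⟨u, v, w, _, _, _, _, _⟩ := p
    simp [OrientedArc.reverse]
  rev_ne := OrientedArc.reverse_ne
  length p := walkLength len p.walk
  length_pos p := by
    have h0 := p.not_nil
    unfold walkLength
    apply List.sum_pos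
    · intro x hx
      obtain ⟨d, -, rfl⟩ := List.mem_map.1 hx
      exact pos _ _ d.adj
    · intro h
      apply h0
      rw [List.map_eq_nil_iff] at h
      rw [← SimpleGraph.Walk.length_eq_zero_iff, ← SimpleGraph.Walk.length_darts, h]
      rfl
  length_rev p := walkLength_reverse len symm p.walk

end Smoothing

/-! ### Lattice length -/

/-- The lattice point `a` as a point of the plane. -/
def latticePoint (a : ℤ × ℤ) : ℝ × ℝ := ((a.1 : ℝ), (a.2 : ℝ))

/-- The lattice length of a vector of rational direction: the number `t ≥ 0` such that the vector is
`t` times a primitive integer vector (see `latticeLength_smul`). -/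
def latticeLength (u : ℝ × ℝ) : ℝ :=
  sSup {t : ℝ | 0 ≤ t ∧ ∃ p : ℤ × ℤ, IsCoprime p.1 p.2 ∧ u = t • latticePoint p}

theorem latticeLength_smul {t : ℝ} (ht : 0 ≤ t) {p : ℤ × ℤ} (hp : IsCoprime p.1 p.2) :
    latticeLength (t • latticePoint p) = t := by
  have key : ∀ (s t : ℝ) (p q : ℤ × ℤ), 0 ≤ s → 0 ≤ t → IsCoprime p.1 p.2 → IsCoprime q.1 q.2 →
      t • latticePoint p = s • latticePoint q → s ≤ t := by
    rintro s t ⟨a, b⟩ ⟨c, d⟩ hs ht ⟨x, y, hxy⟩ ⟨z, w, hzw⟩ h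
    simp only [latticePoint, Prod.smul_mk, smul_eq_mul, Prod.mk.injEq] at h hxy hzw
    obtain ⟨h1, h2⟩ := h
    have hxy' : (x : ℝ) * a + y * b = 1 := by exact_mod_cast hxy
    have hzw' : (z : ℝ) * c + w * d = 1 := by exact_mod_cast hzw
    -- `s = t * m` and `t = s * k` with integers `m`, `k`
    have e1 : s = t * ((z * a + w * b : ℤ) : ℝ) := by
      push_cast
      linear_combination (-s) * hzw' - z * h1 - w * h2
    have e2 : t = s * ((x * c + y * d : ℤ) : ℝ) := by
      push_cast
      linear_combination (-t) * hxy' + x * h1 + y * h2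
    rcases ht.eq_or_lt with rfl | ht'
    · simp [e1]
    · have hs' : 0 < s := by
        rcases hs.eq_or_lt with rfl | h'
        · simp at e2; linarith
        · exact h'
      set k : ℤ := x * c + y * d
      have hk : (0 : ℝ) < k := by
        by_contra hcon
        push Not at hcon
        nlinarith
      have hk1 : (1 : ℝ) ≤ k := by
        have : 0 < k := by exact_mod_cast hk
        exact_mod_cast this
      nlinarith
  have : {r : ℝ | 0 ≤ r ∧ ∃ q : ℤ × ℤ, IsCoprime q.1 q.2 ∧ t • latticePoint p = r • latticePoint q}
      = {t} := by
    ext r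
    constructor
    · rintro ⟨hr, q, hq, h⟩
      exact le_antisymm (key r t p q hr ht hp hq h) (key t r q p ht hr hq hp h.symm)
    · rintro rfl
      exact ⟨ht, p, hp, rfl⟩
  rw [latticeLength, this, csSup_singleton]

theorem latticeLength_neg (u : ℝ × ℝ) : latticeLength (-u) = latticeLength u := by
  unfold latticeLength
  congr 1
  ext t
  simp only [Set.mem_ofPred_eq]
  constructor <;>
  · rintro ⟨h0, p, hp, h⟩
    refine ⟨h0, -p, by simpa using (IsCoprime.neg_neg_iff _ _).2 hp, ?_⟩
    rw [← neg_neg u, h]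
    ext <;> simp [latticePoint]

theorem latticeLength_pos {u : ℝ × ℝ} (hu : u ≠ 0) {a b : ℤ × ℤ} (hab : a ≠ b)
    (h : ((a.1 : ℝ) - b.1) * u.1 + ((a.2 : ℝ) - b.2) * u.2 = 0) : 0 < latticeLength u := by
  obtain ⟨c, d, g, hg, hcd, hc, hd⟩ : ∃ c d g : ℤ, g ≠ 0 ∧ IsCoprime c d ∧ a.1 - b.1 = g * c ∧
      a.2 - b.2 = g * d := by
    have hne : a.1 - b.1 ≠ 0 ∨ a.2 - b.2 ≠ 0 := by
      by_contra hcon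
      push Not at hcon
      exact hab (Prod.ext (sub_eq_zero.1 hcon.1) (sub_eq_zero.1 hcon.2))
    have hg : Int.gcd (a.1 - b.1) (a.2 - b.2) ≠ 0 := by
      rw [Ne, Int.gcd_eq_zero_iff]
      tauto
    have hpos : 0 < Int.gcd (a.1 - b.1) (a.2 - b.2) := Nat.pos_of_ne_zero hg
    refine ⟨(a.1 - b.1) / Int.gcd (a.1 - b.1) (a.2 - b.2),
      (a.2 - b.2) / Int.gcd (a.1 - b.1) (a.2 - b.2), Int.gcd (a.1 - b.1) (a.2 - b.2),
      by exact_mod_cast hg, ?_, ?_, ?_⟩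
    · rw [Int.isCoprime_iff_gcd_eq_one]
      exact Int.gcd_ediv_gcd_ediv_gcd hpos
    · exact (Int.mul_ediv_cancel' (Int.gcd_dvd_left _ _)).symm
    · exact (Int.mul_ediv_cancel' (Int.gcd_dvd_right _ _)).symm
  have hg' : (g : ℝ) ≠ 0 := by exact_mod_cast hg
  have hc' : (a.1 : ℝ) - b.1 = g * c := by exact_mod_cast hc
  have hd' : (a.2 : ℝ) - b.2 = g * d := by exact_mod_cast hd
  have horth : (c : ℝ) * u.1 + d * u.2 = 0 := by
    rw [hc', hd'] at h
    have : (g : ℝ) * (c * u.1 + d * u.2) = 0 := by linear_combination h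
    exact (mul_eq_zero.1 this).resolve_left hg'
  obtain ⟨x, y, hxy⟩ := hcd
  have hxy' : (x : ℝ) * c + y * d = 1 := by exact_mod_cast hxy
  have hcd' : IsCoprime c d := ⟨x, y, hxy⟩
  set t : ℝ := y * u.1 - x * u.2 with ht
  have hu1 : u.1 = t * d := by rw [ht]; linear_combination (-u.1) * hxy' + x * horth
  have hu2 : u.2 = t * (-c) := by rw [ht]; linear_combination (-u.2) * hxy' + y * horth
  have ht0 : t ≠ 0 := by
    intro h0
    rw [h0] at hu1 hu2
    exact hu (Prod.ext (by simpa using hu1) (by simpa using hu2))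
  rcases lt_or_gt_of_ne ht0 with hneg | hpos
  · have : u = (-t) • latticePoint (-d, c) := by
      ext <;> simp [latticePoint, hu1, hu2]
    rw [this, latticeLength_smul (by linarith) (p := (-d, c)) hcd'.symm.neg_left]
    linarith
  · have : u = t • latticePoint (d, -c) := by
      ext <;> simp [latticePoint, hu1, hu2]
    rwa [this, latticeLength_smul hpos.le (p := (d, -c)) hcd'.symm.neg_right]

/-! ### Tropical plane curves -/

/-- A polynomial (in general a Laurent polynomial) in two variables over the min-plus algebra, with
finite nonempty support; only the coefficients of the support matter. -/
structure TropicalPolynomial where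
  support : Finset (ℤ × ℤ)
  nonempty : support.Nonempty
  coeff : ℤ × ℤ → ℝ

namespace TropicalPolynomial

variable (f : TropicalPolynomial)

/-- The value of the tropical monomial with exponent `a`. -/
def term (a : ℤ × ℤ) (w : ℝ × ℝ) : ℝ := f.coeff a + a.1 * w.1 + a.2 * w.2

/-- The piecewise linear function `w ↦ min_a (c_a + a ⬝ w)`. -/
def eval (w : ℝ × ℝ) : ℝ := f.support.inf' f.nonempty fun a => f.term a w

open Classical in
/-- The exponents at which the minimum is attained at `w`. The convex hulls of these sets are the
cells of the regular subdivision of the Newton polygon; the cell at `w` is dual to the cell of the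
tropical curve (or of its complement) that has `w` in its relative interior. -/
def active (w : ℝ × ℝ) : Finset (ℤ × ℤ) := f.support.filter fun a => f.term a w = f.eval w

/-- The tropical curve: the points where the minimum is attained at least twice. -/
def curve : Set (ℝ × ℝ) := {w | 2 ≤ (f.active w).card}

/-- The Newton polygon. -/
def newtonPolygon : Set (ℝ × ℝ) := convexHull ℝ (latticePoint '' (f.support : Set (ℤ × ℤ)))

/-- `w` is a vertex of the tropical curve: its dual cell is two-dimensional. -/
def IsVertex (w : ℝ × ℝ) : Prop :=
  affineSpan ℝ (latticePoint '' (f.active w : Set (ℤ × ℤ))) = ⊤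

/-- The tropical curve is smooth: the dual subdivision of the (two-dimensional) Newton polygon is a
unimodular triangulation, that is, all its two-dimensional cells are triangles of area `1/2`. -/
def IsSmooth : Prop :=
  affineSpan ℝ f.newtonPolygon = ⊤ ∧
  ∀ w, f.IsVertex w → ∃ a b c : ℤ × ℤ, (f.active w : Set (ℤ × ℤ)) = {a, b, c} ∧
    |(b.1 - a.1) * (c.2 - a.2) - (b.2 - a.2) * (c.1 - a.1)| = 1

/-- The vertices and the bounded edges of the tropical curve, as a graph: two vertices are joined by
an edge of the curve if their dual triangles have a common side. (The unbounded edges are left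
out.) -/
def boundedGraph : SimpleGraph {w : ℝ × ℝ // f.IsVertex w} where
  Adj v w := v ≠ w ∧ 2 ≤ (f.active v ∩ f.active w).card
  symm := ⟨fun v w h => ⟨h.1.symm, by rw [Finset.inter_comm]; exact h.2⟩⟩
  loopless := ⟨fun v h => h.1 rfl⟩

/-- The skeleton of the tropical curve: remove the unbounded edges and then successively all
leaves, smooth over the vertices of valence two, and take the metric given by lattice length. -/
def skeleton : MetricGraph :=
  smoothing (f.boundedGraph.induce (coreVertices f.boundedGraph))
    (fun v w => latticeLength (v.1.1 - w.1.1))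
    (fun v w => by rw [← latticeLength_neg, neg_sub])
    (fun v w h => by
      obtain ⟨hne, hcard⟩ : v.1 ≠ w.1 ∧ 2 ≤ (f.active v.1 ∩ f.active w.1).card := h
      obtain ⟨a, ha, b, hb, hab⟩ := Finset.one_lt_card.1 hcard
      simp only [Finset.mem_inter, active, Finset.mem_filter] at ha hb
      apply latticeLength_pos (sub_ne_zero.2 fun h' => hne (Subtype.ext h')) hab
      have e1 := ha.1.2.trans hb.1.2.symm
      have e2 := ha.2.2.trans hb.2.2.symm
      simp only [term] at e1 e2
      simp only [Prod.fst_sub, Prod.snd_sub]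
      linear_combination e1 - e2)

end TropicalPolynomial

/-- The convex hull of the lattice points in the interior of `P`. -/
def interiorPolygon (P : Set (ℝ × ℝ)) : Set (ℝ × ℝ) :=
  convexHull ℝ (interior P ∩ Set.range latticePoint)

/-- A lattice polygon is nonhyperelliptic if the convex hull of its interior lattice points is
two-dimensional. -/
def IsNonhyperelliptic (P : Set (ℝ × ℝ)) : Prop :=
  affineSpan ℝ (interiorPolygon P) = ⊤

end

/-! Each interior lattice point of P is surrounded by a ring of triangles, dual to a cycle of the
skeleton. The edges along this cycle form an even set, and in a chain an even set contains both or
neither of two parallel edges. Hence each pair of parallel edges runs along exactly one interior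
lattice point, and the interior lattice points form a row m₀, m₁, …: the triangles at node i have
the interior corners mᵢ and mᵢ₊₁, which span a common side if the new edge is shared and are
opposite corners of a parallelogram if it is a bridge (`exists_node`).

The heart is a local statement about a point p of the row with its neighbours m and m': if the two
parallel edges along p have equal length, then m' - p = -(m - p) (`IsPair.eq_of_len_eq`). Suppose
that the determinant of m' - p and m - p is positive. From p, every other interior lattice point is
seen through a triangle at an end of the two arcs (`IsPair.exists_inCone`). This forces the
determinant to be 1 (`cr_eq_one`), and the arc inside the angle is a single edge, dual to p and m +
m' - p (`single_edge`). Now follow the slack of the monomial m' away from the m'-end. On the short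
arc it grows exactly by the lattice length. On the other arc it grows at most by the lattice length,
because no exponent next to p lies more than one row below the line through p and m'
(`neg_one_le_cr`), and either this arc has more to climb or one of its edges contributes nothing. So
it is strictly longer (`len_ne_of_pos`).

If all parallel pairs had equal lengths, the row would be straight; since every interior lattice
point belongs to it (`exists_isBranch`), P would be hyperelliptic. So some pair has different
lengths, and it is a two-cut. A hyperelliptic involution acts as -1 on integral flows
(`IsFlow.involution`), hence swaps the two edges of each pair (`chain_involution`), which would make
their lengths equal. -/

namespace Multigraph

/-! ### Combinatorics of chains: even edge sets, bridges and two-cuts. -/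

section Chain

variable {n : ℕ} {s : Fin n → Bool}

/-- A vertex of a chain. -/
def node (s : Fin n → Bool) (i : Fin n) (b : Bool) : (chain n s).Vert := (i, b)

/-- The new edge at the node `i`, oriented away from the vertex `b`. -/
def bar (s : Fin n → Bool) (i : Fin n) (b : Bool) : (chain n s).Dart := (i, Sum.inl b)

/-- A half-edge on the left of the node `i`. -/
def left (s : Fin n → Bool) (i : Fin n) (b : Bool) : (chain n s).Dart := (i, Sum.inr (false, b))

/-- A half-edge on the right of the node `i`. -/
def right (s : Fin n → Bool) (i : Fin n) (b : Bool) : (chain n s).Dart := (i, Sum.inr (true, b))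

theorem chain_vert_cases (v : (chain n s).Vert) : ∃ i b, v = node s i b := ⟨v.1, v.2, rfl⟩

theorem chain_dart_cases (d : (chain n s).Dart) :
    (∃ i b, d = bar s i b) ∨ (∃ i b, d = left s i b) ∨ ∃ i b, d = right s i b := by
  obtain ⟨i, b | ⟨_ | _, b⟩⟩ := d
  · exact Or.inl ⟨i, b, rfl⟩
  · exact Or.inr (Or.inl ⟨i, b, rfl⟩)
  · exact Or.inr (Or.inr ⟨i, b, rfl⟩)

@[simp] theorem node_inj {i j : Fin n} {b c : Bool} : node s i b = node s j c ↔ i = j ∧ b = c :=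
  Prod.mk_inj

@[simp] theorem bar_inj {i j : Fin n} {b c : Bool} : bar s i b = bar s j c ↔ i = j ∧ b = c :=
  Prod.mk_inj.trans (and_congr_right fun _ => Sum.inl_injective.eq_iff)

@[simp] theorem left_inj {i j : Fin n} {b c : Bool} : left s i b = left s j c ↔ i = j ∧ b = c := by
  refine Prod.mk_inj.trans (and_congr_right fun _ => ?_)
  simp

@[simp] theorem right_inj {i j : Fin n} {b c : Bool} :
    right s i b = right s j c ↔ i = j ∧ b = c := by
  refine Prod.mk_inj.trans (and_congr_right fun _ => ?_)
  simp

@[simp] theorem bar_ne_left {i j : Fin n} {b c : Bool} : bar s i b ≠ left s j c :=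
  fun h => Sum.inl_ne_inr
    (congrArg Prod.snd h : (Sum.inl b : Bool ⊕ Bool × Bool) = Sum.inr (false, c))

@[simp] theorem bar_ne_right {i j : Fin n} {b c : Bool} : bar s i b ≠ right s j c :=
  fun h => Sum.inl_ne_inr
    (congrArg Prod.snd h : (Sum.inl b : Bool ⊕ Bool × Bool) = Sum.inr (true, c))

@[simp] theorem left_ne_right {i j : Fin n} {b c : Bool} : left s i b ≠ right s j c :=
  fun h => by
  have h2 : (Sum.inr (false, b) : Bool ⊕ Bool × Bool) = Sum.inr (true, c) := congrArg Prod.snd h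
  simp at h2

@[simp] theorem left_ne_bar {i j : Fin n} {b c : Bool} : left s i b ≠ bar s j c :=
  bar_ne_left.symm

@[simp] theorem right_ne_bar {i j : Fin n} {b c : Bool} : right s i b ≠ bar s j c :=
  bar_ne_right.symm

@[simp] theorem right_ne_left {i j : Fin n} {b c : Bool} : right s i b ≠ left s j c :=
  left_ne_right.symm

@[simp] theorem src_bar (i : Fin n) (b : Bool) : (chain n s).src (bar s i b) = node s i b := rfl

@[simp] theorem src_left (i : Fin n) (b : Bool) :
    (chain n s).src (left s i b) = node s i (if s i then false else b) := by
  change (if s i then ((i, false) : Fin n × Bool) else (i, b)) = (i, _)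
  split_ifs <;> rfl

@[simp] theorem src_right (i : Fin n) (b : Bool) :
    (chain n s).src (right s i b) = node s i (if s i then true else b) := by
  change (if s i then ((i, true) : Fin n × Bool) else (i, b)) = (i, _)
  split_ifs <;> rfl

@[simp] theorem rev_bar (i : Fin n) (b : Bool) : (chain n s).rev (bar s i b) = bar s i !b := rfl

theorem rev_right {i : Fin n} (h : i.val + 1 < n) (b : Bool) :
    (chain n s).rev (right s i b) = left s ⟨i.val + 1, h⟩ b := by
  have : chainRev n (i, Sum.inr (true, b)) = (⟨i.val + 1, h⟩, Sum.inr (false, b)) := by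
    simp [chainRev, h]
  exact this

theorem rev_right_last {i : Fin n} (h : ¬ i.val + 1 < n) (b : Bool) :
    (chain n s).rev (right s i b) = right s i !b := by
  have : chainRev n (i, Sum.inr (true, b)) = (i, Sum.inr (true, !b)) := by
    simp [chainRev, h]
  exact this

theorem rev_left_succ {i : ℕ} (h : i + 1 < n) (b : Bool) :
    (chain n s).rev (left s ⟨i + 1, h⟩ b) = right s ⟨i, Nat.lt_of_succ_lt h⟩ b := by
  have : chainRev n (⟨i + 1, h⟩, Sum.inr (false, b)) =
      (⟨i, Nat.lt_of_succ_lt h⟩, Sum.inr (true, b)) := by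
    simp [chainRev]
  exact this

theorem rev_left_zero {i : Fin n} (h : i.val = 0) (b : Bool) :
    (chain n s).rev (left s i b) = left s i !b := by
  have : chainRev n (i, Sum.inr (false, b)) = (i, Sum.inr (false, !b)) := by
    simp [chainRev, h]
  exact this

theorem rev_left_eq (i : Fin n) (b : Bool) : (chain n s).rev (left s i b) = left s i (!b) ∨
    ∃ j : Fin n, j.val + 1 = i.val ∧ (chain n s).rev (left s i b) = right s j b := by
  obtain ⟨i, hi⟩ := i
  cases i with
  | zero => exact Or.inl (rev_left_zero rfl b)
  | succ i => exact Or.inr ⟨⟨i, _⟩, rfl, rev_left_succ hi b⟩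

theorem rev_right_eq (i : Fin n) (b : Bool) : (chain n s).rev (right s i b) = right s i (!b) ∨
    ∃ j : Fin n, j.val = i.val + 1 ∧ (chain n s).rev (right s i b) = left s j b := by
  by_cases h : i.val + 1 < n
  · exact Or.inr ⟨⟨_, h⟩, rfl, rev_right h b⟩
  · exact Or.inl (rev_right_last h b)

/-- Among three propositions an even number holds. -/
def EvenOfThree (a b c : Prop) : Prop := (a ↔ b) ↔ ¬ c

/-- `c` is the indicator of a set of edges with an even number of half-edges at every trivalent
vertex. -/
structure IsEven (G : Multigraph) (c : G.Dart → Prop) : Prop where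
  rev : ∀ d, c (G.rev d) ↔ c d
  even : ∀ d₁ d₂ d₃, d₁ ≠ d₂ → d₁ ≠ d₃ → d₂ ≠ d₃ → G.src d₁ = G.src d₂ → G.src d₁ = G.src d₃ →
    EvenOfThree (c d₁) (c d₂) (c d₃)

/-- Eliminating the new edge from the parity conditions at the two halves of a node leaves the
parity condition at the unsplit 4-valent node. At a bridge the half `(i, false)` carries the bridge
and both left half-edges, so agreement of the latter excludes the bridge. -/
theorem IsEven.chain_node {c : (chain n s).Dart → Prop} (hc : IsEven (chain n s) c) (i : Fin n) :
    ((c (left s i false) ↔ c (left s i true)) ↔ (c (right s i false) ↔ c (right s i true))) ∧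
    (s i = true → (c (left s i false) ↔ c (left s i true)) → ∀ b, ¬ c (bar s i b)) := by
  have hb := hc.rev (bar s i false)
  rw [rev_bar] at hb
  cases hs : s i
  · have h1 := hc.even (bar s i false) (left s i false) (right s i false)
      (by simp) (by simp) (by simp) (by simp [hs]) (by simp [hs])
    have h2 := hc.even (bar s i true) (left s i true) (right s i true)
      (by simp) (by simp) (by simp) (by simp [hs]) (by simp [hs])
    simp only [EvenOfThree, Bool.not_false] at h1 h2 hb
    refine ⟨by tauto, by simp⟩
  · have h1 := hc.even (bar s i false) (left s i false) (left s i true)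
      (by simp) (by simp) (by simp) (by simp [hs]) (by simp [hs])
    have h2 := hc.even (bar s i true) (right s i false) (right s i true)
      (by simp) (by simp) (by simp) (by simp [hs]) (by simp [hs])
    simp only [EvenOfThree, Bool.not_false] at h1 h2 hb
    refine ⟨by tauto, fun _ h b => ?_⟩
    cases b <;> tauto

/-- The left half-edges of node 0 belong to one loop, and `chain_node` carries the agreement from
the left of a node to its right. -/
theorem IsEven.chain_left {c : (chain n s).Dart → Prop} (hc : IsEven (chain n s) c) (i : Fin n) :
    c (left s i false) ↔ c (left s i true) := by
  obtain ⟨i, hi⟩ := i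
  induction i with
  | zero =>
    have h := hc.rev (left s ⟨0, hi⟩ false)
    rw [rev_left_zero rfl] at h
    exact h.symm
  | succ i ih =>
    have h1 := hc.rev (left s ⟨i + 1, hi⟩ false)
    have h2 := hc.rev (left s ⟨i + 1, hi⟩ true)
    rw [rev_left_succ] at h1 h2
    have h3 := (hc.chain_node _).1.1 (ih (Nat.lt_of_succ_lt hi))
    tauto

theorem IsEven.chain_right {c : (chain n s).Dart → Prop} (hc : IsEven (chain n s) c) (i : Fin n) :
    c (right s i false) ↔ c (right s i true) :=
  (hc.chain_node i).1.1 (hc.chain_left i)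

theorem IsEven.chain_bridge {c : (chain n s).Dart → Prop} (hc : IsEven (chain n s) c) {i : Fin n}
    (hs : s i = true) (b : Bool) : ¬ c (bar s i b) :=
  (hc.chain_node i).2 hs (hc.chain_left i) b

theorem node_iff {σ : (chain n s).Vert → Prop} {i : Fin n}
    (h : σ (node s i false) ↔ σ (node s i true)) (x y : Bool) :
    σ (node s i x) ↔ σ (node s i y) := by
  cases x <;> cases y <;> tauto

/-- A vertex coloring of a chain that changes along at most one edge, not a bridge, does not change
along that edge either. -/
theorem chain_not_bridge {σ : (chain n s).Vert → Prop} {T : (chain n s).Dart}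
    (hσ : ∀ d, d ≠ T → d ≠ (chain n s).rev T →
      (σ ((chain n s).src d) ↔ σ ((chain n s).src ((chain n s).rev d))))
    (hT : ∀ i b, T = bar s i b → s i = false) :
    σ ((chain n s).src T) ↔ σ ((chain n s).src ((chain n s).rev T)) := by
  rcases chain_dart_cases T with ⟨i, b, rfl⟩ | ⟨i, b, rfl⟩ | ⟨i, b, rfl⟩
  · have hs := hT i b rfl
    rw [rev_bar] at hσ
    suffices key : σ (node s i false) ↔ σ (node s i true) by
      rw [rev_bar, src_bar, src_bar]
      exact node_iff key _ _
    -- A detour around the new edge: along the two right edges and across the next node, or along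
    -- the loop at the last node.
    have h1f := hσ (right s i false) (by simp) (by simp)
    have h1t := hσ (right s i true) (by simp) (by simp)
    by_cases h : i.val + 1 < n
    · have h3 := hσ (bar s ⟨i.val + 1, h⟩ false) (by simp [Fin.ext_iff]) (by simp [Fin.ext_iff])
      rw [rev_bar, src_bar, src_bar, Bool.not_false] at h3
      rw [rev_right h, src_right, src_left, hs] at h1f h1t
      have h4 := node_iff h3
      exact h1f.trans ((h4 _ _).trans h1t.symm)
    · rw [rev_right_last h, src_right, src_right, hs] at h1f
      exact h1f
  · have hb : ∀ j x y, σ (node s j x) ↔ σ (node s j y) := by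
      intro j
      refine node_iff ?_
      have := hσ (bar s j false) (by simp) (by
        rcases rev_left_eq (s := s) i b with h | ⟨k, -, h⟩ <;> rw [h] <;> simp)
      simpa using this
    rcases rev_left_eq (s := s) i b with h | ⟨k, hk, h⟩
    · rw [h, src_left, src_left]
      exact hb _ _ _
    · obtain ⟨i, hi⟩ := i
      obtain rfl : k.val + 1 = i := hk
      have h1 := hσ (left s ⟨k.val + 1, hi⟩ !b) (by simp) (by rw [h]; simp)
      rw [rev_left_succ hi, src_left, src_right] at h1
      rw [h, src_left, src_right]
      exact (hb _ _ _).trans (h1.trans (hb _ _ _))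
  · have hb : ∀ j x y, σ (node s j x) ↔ σ (node s j y) := by
      intro j
      refine node_iff ?_
      have := hσ (bar s j false) (by simp) (by
        rcases rev_right_eq (s := s) i b with h | ⟨k, -, h⟩ <;> rw [h] <;> simp)
      simpa using this
    by_cases h : i.val + 1 < n
    · have h1 := hσ (right s i !b) (by simp) (by rw [rev_right h]; simp)
      rw [rev_right h, src_right, src_left] at h1
      rw [rev_right h, src_right, src_left]
      exact (hb _ _ _).trans (h1.trans (hb _ _ _))
    · rw [rev_right_last h, src_right, src_right]
      exact hb _ _ _

theorem chain_const {σ : (chain n s).Vert → Prop}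
    (hσ : ∀ d, σ ((chain n s).src d) ↔ σ ((chain n s).src ((chain n s).rev d)))
    (u v : (chain n s).Vert) : σ u ↔ σ v := by
  have hb : ∀ j x y, σ (node s j x) ↔ σ (node s j y) :=
    fun j => node_iff (by simpa using hσ (bar s j false))
  obtain ⟨i, x, rfl⟩ := chain_vert_cases u
  obtain ⟨j, y, rfl⟩ := chain_vert_cases v
  have hn : 0 < n := i.pos
  have zero : ∀ (i : ℕ) (hi : i < n), σ (node s ⟨i, hi⟩ true) ↔ σ (node s ⟨0, hn⟩ true) := by
    intro i
    induction i with
    | zero => exact fun _ => Iff.rfl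
    | succ i ih =>
      intro hi
      refine Iff.trans ?_ (ih (Nat.lt_of_succ_lt hi))
      have h1 := hσ (left s ⟨i + 1, hi⟩ true)
      rw [rev_left_succ hi, src_left, src_right] at h1
      exact (hb _ _ _).trans (h1.trans (hb _ _ _))
  exact (hb _ _ _).trans ((zero i i.2).trans ((zero j j.2).symm.trans (hb _ _ _)))

/-- Reachability from `u` is a coloring that can change only along `T`, so `chain_not_bridge` and
`chain_const` make it constant. -/
theorem chain_connectedAvoiding {T : (chain n s).Dart} (hT : ∀ i b, T = bar s i b → s i = false) :
    (chain n s).ConnectedAvoiding {T} := by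
  intro u v
  let G := chain n s
  let R := (fun x y : G.Vert => ∃ d, d ∉ ({T} : Set G.Dart) ∧ G.rev d ∉ ({T} : Set G.Dart) ∧
    G.src d = x ∧ G.src (G.rev d) = y)
  have h1 : ∀ d, d ≠ T → d ≠ G.rev T → R (G.src d) (G.src (G.rev d)) := by
    intro d hd hd'
    refine ⟨d, hd, fun h => hd' ?_, rfl, rfl⟩
    rw [← Set.mem_singleton_iff.1 h, G.rev_rev]
  have h2 : ∀ d, d ≠ T → d ≠ G.rev T →
      (Relation.ReflTransGen R u (G.src d) ↔ Relation.ReflTransGen R u (G.src (G.rev d))) := by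
    intro d hd hd'
    refine ⟨fun h => h.tail (h1 d hd hd'), fun h => h.tail ?_⟩
    have := h1 (G.rev d) (fun h => hd' (by rw [← h, G.rev_rev]))
      (fun h => hd (by rw [← G.rev_rev d, h, G.rev_rev]))
    rwa [G.rev_rev] at this
  have h3 := chain_not_bridge h2 hT
  refine (chain_const (σ := Relation.ReflTransGen R u) (fun d => ?_) u v).1 .refl
  by_cases hd : d = T
  · rw [hd]; exact h3
  by_cases hd' : d = G.rev T
  · rw [hd', G.rev_rev]; exact h3.symm
  exact h2 d hd hd'

/-- The two edges between consecutive nodes of a chain form a two-cut. -/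
theorem chain_isTwoCut {j : Fin n} (hj : j.val + 1 < n) :
    (chain n s).IsTwoCut (right s j false) (right s j true) := by
  refine ⟨chain_connectedAvoiding (by simp), chain_connectedAvoiding (by simp), fun h => ?_⟩
  -- Without the two edges to the right of `j`, no step leaves the nodes up to `j`.
  have inv : ∀ u v, Relation.ReflTransGen (fun x y : (chain n s).Vert => ∃ d,
      d ∉ ({right s j false, right s j true} : Set (chain n s).Dart) ∧
      (chain n s).rev d ∉ ({right s j false, right s j true} : Set (chain n s).Dart) ∧
      (chain n s).src d = x ∧ (chain n s).src ((chain n s).rev d) = y) u v →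
      (∃ i b, u = node s i b ∧ i ≤ j) → (∃ i b, v = node s i b ∧ i ≤ j) := by
    intro u v huv hu
    induction huv with
    | refl => exact hu
    | tail _ hstep ih =>
      obtain ⟨d, hd, hd', rfl, rfl⟩ := hstep
      obtain ⟨k, x, hk, hkj⟩ := ih
      rcases chain_dart_cases d with ⟨i, b, rfl⟩ | ⟨i, b, rfl⟩ | ⟨i, b, rfl⟩
      · rw [src_bar, node_inj] at hk
        rw [rev_bar, src_bar]
        exact ⟨_, _, rfl, hk.1 ▸ hkj⟩
      · rw [src_left, node_inj] at hk
        rcases rev_left_eq (s := s) i b with h | ⟨l, hl, h⟩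
        · rw [h, src_left]
          exact ⟨_, _, rfl, hk.1 ▸ hkj⟩
        · rw [h, src_right]
          refine ⟨_, _, rfl, ?_⟩
          rw [Fin.le_def] at hkj ⊢
          rw [← hk.1] at hkj
          omega
      · rw [src_right, node_inj] at hk
        rcases rev_right_eq (s := s) i b with h | ⟨l, hl, h⟩
        · rw [h, src_right]
          exact ⟨_, _, rfl, hk.1 ▸ hkj⟩
        · rw [h, src_left]
          refine ⟨_, _, rfl, ?_⟩
          have : i ≠ j := by
            rintro rfl
            cases b <;> simp at hd
          have : i.val ≠ j.val := fun h => this (Fin.ext h)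
          rw [Fin.le_def] at hkj ⊢
          rw [← hk.1] at hkj
          omega
  obtain ⟨i, b, hi, hij⟩ := inv (node s j false) (node s ⟨j.val + 1, hj⟩ false) (h _ _)
    ⟨_, _, rfl, le_rfl⟩
  rw [node_inj] at hi
  rw [← hi.1, Fin.le_def] at hij
  simp at hij

end Chain

/-! ### Transport along isomorphisms. -/

theorem Iso.src_symm {G H : Multigraph} (φ : Iso G H) (d : H.Dart) :
    G.src (φ.dart.symm d) = φ.vert.symm (H.src d) := by
  rw [Equiv.eq_symm_apply, ← φ.src_dart, Equiv.apply_symm_apply]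

theorem Iso.rev_symm {G H : Multigraph} (φ : Iso G H) (d : H.Dart) :
    G.rev (φ.dart.symm d) = φ.dart.symm (H.rev d) := by
  rw [Equiv.eq_symm_apply, ← φ.rev_dart, Equiv.apply_symm_apply]

/-- The inverse isomorphism. -/
def Iso.symm {G H : Multigraph} (φ : Iso G H) : Iso H G where
  vert := φ.vert.symm
  dart := φ.dart.symm
  src_dart := φ.src_symm
  rev_dart := φ.rev_symm

theorem Iso.connectedAvoiding {G H : Multigraph} (φ : Iso G H) {S : Set G.Dart} {S' : Set H.Dart}
    (hS : ∀ d, φ.dart d ∈ S' → d ∈ S) (h : G.ConnectedAvoiding S) : H.ConnectedAvoiding S' := by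
  intro u v
  have key : ∀ x y, Relation.ReflTransGen
      (fun x y => ∃ d, d ∉ S ∧ G.rev d ∉ S ∧ G.src d = x ∧ G.src (G.rev d) = y) x y →
      Relation.ReflTransGen
      (fun x y => ∃ d, d ∉ S' ∧ H.rev d ∉ S' ∧ H.src d = x ∧ H.src (H.rev d) = y)
      (φ.vert x) (φ.vert y) := by
    intro x y hxy
    refine hxy.lift φ.vert ?_
    rintro x y ⟨d, hd, hd', rfl, rfl⟩
    refine ⟨φ.dart d, fun h => hd (hS _ h), fun h => hd' (hS _ ?_), φ.src_dart d, ?_⟩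
    · rwa [← φ.rev_dart]
    · rw [φ.rev_dart, φ.src_dart]
  simpa using key _ _ (h (φ.vert.symm u) (φ.vert.symm v))

theorem Iso.isTwoCut {G H : Multigraph} (φ : Iso G H) {d e : G.Dart} (h : G.IsTwoCut d e) :
    H.IsTwoCut (φ.dart d) (φ.dart e) := by
  refine ⟨φ.connectedAvoiding ?_ h.1, φ.connectedAvoiding ?_ h.2.1,
    fun h' => h.2.2 (φ.symm.connectedAvoiding ?_ h')⟩
  · intro x hx; simpa using hx
  · intro x hx; simpa using hx
  · intro x hx
    simp only [Iso.symm, Set.mem_insert_iff, Set.mem_singleton_iff, Equiv.symm_apply_eq] at hx ⊢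
    exact hx

theorem Iso.isEven {G H : Multigraph} (φ : Iso G H) {c : H.Dart → Prop} (hc : IsEven H c) :
    IsEven G (fun d => c (φ.dart d)) where
  rev d := by rw [← φ.rev_dart]; exact hc.rev _
  even d₁ d₂ d₃ h12 h13 h23 h h' := by
    refine hc.even _ _ _ (φ.dart.injective.ne h12) (φ.dart.injective.ne h13)
      (φ.dart.injective.ne h23) ?_ ?_
    · rw [φ.src_dart, φ.src_dart, h]
    · rw [φ.src_dart, φ.src_dart, h']

end Multigraph

/-! ### Integral flows and hyperelliptic involutions. -/

namespace Multigraph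

/-- An integral flow: antisymmetric under reversal of edges, with total outflow zero at every
vertex. -/
structure IsFlow (G : Multigraph) [Fintype G.Dart] (c : G.Dart → ℤ) : Prop where
  rev : ∀ d, c (G.rev d) = -c d
  sum : ∀ g : G.Vert → ℤ, ∑ d, c d * g (G.src d) = 0

theorem Iso.isFlow {G H : Multigraph} [Fintype G.Dart] [Fintype H.Dart] (φ : Iso G H)
    {c : H.Dart → ℤ} (hc : IsFlow H c) : IsFlow G (fun d => c (φ.dart d)) where
  rev d := by rw [← φ.rev_dart]; exact hc.rev _
  sum g := by
    rw [← hc.sum fun v => g (φ.vert.symm v)]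
    refine Fintype.sum_equiv φ.dart _ _ fun d => ?_
    rw [φ.src_dart, Equiv.symm_apply_apply]

/-- If the quotient by an automorphism is a tree, then there are no nonzero invariant flows. -/
theorem IsFlow.eq_zero_of_invariant {G : Multigraph} [Fintype G.Dart] {φ : Iso G G}
    (hφ : (quotientGraph φ).IsTree) {c : G.Dart → ℤ} (hc : IsFlow G c)
    (hinv : ∀ d, c (φ.dart d) = c d) (d₀ : G.Dart) : c d₀ = 0 := by
  classical
  have adj_src : ∀ d : G.Dart, (quotientGraph φ).Adj (Sum.inl (Quot.mk _ (G.src d)))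
      (Sum.inr (Sum.inl (Quot.mk _ d))) := fun d =>
    (SimpleGraph.fromRel_adj _ _ _).2 ⟨by simp, Or.inl ⟨d, rfl, Or.inl rfl⟩⟩
  have adj_mid : ∀ d : G.Dart, (quotientGraph φ).Adj (Sum.inr (Sum.inr (Quot.mk _ d)))
      (Sum.inr (Sum.inl (Quot.mk _ d))) := fun d =>
    (SimpleGraph.fromRel_adj _ _ _).2 ⟨by simp, Or.inl ⟨d, rfl, Or.inr rfl⟩⟩
  set x : VertOrbit φ ⊕ DartOrbit φ ⊕ EdgeOrbit φ := Sum.inl (Quot.mk _ (G.src d₀)) with hx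
  set y : VertOrbit φ ⊕ DartOrbit φ ⊕ EdgeOrbit φ := Sum.inr (Sum.inl (Quot.mk _ d₀)) with hy
  -- In the tree, cutting the segment between `src d₀` and the dart point of `d₀` separates its
  -- ends. Below, `χ` is the indicator of the component of the dart point.
  have hbr := (SimpleGraph.isAcyclic_iff_forall_adj_isBridge.1 hφ.isAcyclic) (adj_src d₀)
  rw [SimpleGraph.isBridge_iff] at hbr
  set T := (quotientGraph φ).deleteEdges {s(x, y)} with hT
  let χ : VertOrbit φ ⊕ DartOrbit φ ⊕ EdgeOrbit φ → ℤ := fun z => if T.Reachable z y then 1 else 0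
  have χ_adj : ∀ z w, T.Adj z w → χ z = χ w := by
    intro z w h
    have : T.Reachable z y ↔ T.Reachable w y :=
      ⟨fun h' => h.reachable.symm.trans h', fun h' => h.reachable.trans h'⟩
    simp only [χ, this]
  have χ_mid : ∀ d : G.Dart, χ (Sum.inr (Sum.inr (Quot.mk _ d))) =
      χ (Sum.inr (Sum.inl (Quot.mk _ d))) := by
    intro d
    apply χ_adj
    rw [hT, SimpleGraph.deleteEdges_adj]
    refine ⟨adj_mid d, ?_⟩
    rw [Set.mem_singleton_iff, Sym2.eq_iff, hx, hy]
    simp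
  have χ_src : ∀ d : G.Dart, (Quot.mk _ d : DartOrbit φ) ≠ Quot.mk _ d₀ →
      χ (Sum.inl (Quot.mk _ (G.src d))) = χ (Sum.inr (Sum.inl (Quot.mk _ d))) := by
    intro d hd
    apply χ_adj
    rw [hT, SimpleGraph.deleteEdges_adj]
    refine ⟨adj_src d, ?_⟩
    rw [Set.mem_singleton_iff, Sym2.eq_iff, hx, hy]
    rintro (⟨-, h⟩ | ⟨h, -⟩)
    · exact hd (Sum.inl_injective (Sum.inr_injective h))
    · simp at h
  have χ_x : χ x = 0 := if_neg hbr
  have χ_y : χ y = 1 := if_pos SimpleGraph.Reachable.rfl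
  have src_orbit : ∀ d : G.Dart, (Quot.mk _ d : DartOrbit φ) = Quot.mk _ d₀ →
      (Quot.mk _ (G.src d) : VertOrbit φ) = Quot.mk _ (G.src d₀) := by
    intro d hd
    have h := congrArg (Quot.lift (fun d : G.Dart => (Quot.mk _ (G.src d) : VertOrbit φ)) ?_) hd
    · exact h
    · rintro a b rfl
      exact Quot.sound (φ.src_dart a)
  have c_orbit : ∀ d : G.Dart, (Quot.mk _ d : DartOrbit φ) = Quot.mk _ d₀ → c d = c d₀ := by
    intro d hd
    have h := congrArg (Quot.lift c ?_) hd
    · exact h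
    · rintro a b rfl
      exact (hinv a).symm
  -- A midpoint does not see the orientation of its edge, whereas `c` changes sign under reversal.
  have sum_mid : ∑ d, c d * χ (Sum.inr (Sum.inr (Quot.mk _ d))) = 0 := by
    have : ∑ d, c d * χ (Sum.inr (Sum.inr (Quot.mk _ d))) =
        -∑ d, c d * χ (Sum.inr (Sum.inr (Quot.mk _ d))) := by
      rw [← Finset.sum_neg_distrib]
      refine Fintype.sum_equiv ⟨G.rev, G.rev, G.rev_rev, G.rev_rev⟩ _ _ fun d => ?_
      simp only [Equiv.coe_fn_mk, hc.rev]
      have h : (Quot.mk _ d : EdgeOrbit φ) = Quot.mk _ (G.rev d) := Quot.sound (Or.inl rfl)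
      rw [← h]
      ring
    linarith
  -- Conservation of the flow is tested against `χ` on the vertices. Only the darts in the orbit of
  -- `d₀` cross the cut, and each of them contributes `-c d₀`.
  have key : ∑ d, (c d * χ (Sum.inl (Quot.mk _ (G.src d))) -
      c d * χ (Sum.inr (Sum.inr (Quot.mk _ d)))) = 0 := by
    rw [Finset.sum_sub_distrib, sum_mid, sub_zero]
    exact hc.sum fun v => χ (Sum.inl (Quot.mk _ v))
  have key2 : ∑ d, (c d * χ (Sum.inl (Quot.mk _ (G.src d))) -
      c d * χ (Sum.inr (Sum.inr (Quot.mk _ d)))) =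
      ∑ d, if (Quot.mk _ d : DartOrbit φ) = Quot.mk _ d₀ then -c d₀ else 0 := by
    refine Finset.sum_congr rfl fun d _ => ?_
    split_ifs with h
    · rw [χ_mid, h, src_orbit d h, c_orbit d h, ← hx, ← hy, χ_x, χ_y]
      ring
    · rw [χ_mid, χ_src d h, sub_self]
  rw [key2, ← Finset.sum_filter, Finset.sum_const, smul_eq_zero] at key
  rcases key with h | h
  · rw [Finset.card_eq_zero] at h
    exact absurd (Finset.mem_filter.2 ⟨Finset.mem_univ d₀, rfl⟩ : d₀ ∈ Finset.univ.filter
      fun d => (Quot.mk _ d : DartOrbit φ) = Quot.mk _ d₀)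
      (Finset.eq_empty_iff_forall_notMem.1 h d₀)
  · simpa using h

/-- An involution with a tree as quotient acts on flows as `-1`. -/
theorem IsFlow.involution {G : Multigraph} [Fintype G.Dart] {φ : Iso G G}
    (hφ : (quotientGraph φ).IsTree) (hinv : φ.IsInvolution) {c : G.Dart → ℤ} (hc : IsFlow G c)
    (d : G.Dart) : c (φ.dart d) = -c d := by
  have h2 := φ.isFlow hc
  -- The symmetrization of the flow is invariant, hence zero.
  have h3 : IsFlow G fun d => c d + c (φ.dart d) := by
    refine ⟨fun d => ?_, fun g => ?_⟩
    · rw [hc.rev, h2.rev]; ring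
    · simp only [add_mul, Finset.sum_add_distrib]
      rw [hc.sum, h2.sum, add_zero]
  have := h3.eq_zero_of_invariant hφ (fun d => by rw [hinv.2, add_comm]) d
  linarith

section ChainFlow

variable {n : ℕ} {s : Fin n → Bool}

instance : Fintype (chain n s).Dart := inferInstanceAs (Fintype (Fin n × (Bool ⊕ Bool × Bool)))

/-- The sign that distinguishes the two half-edges on a side. -/
def sign (b : Bool) : ℤ := if b then -1 else 1

/-- The flow around the `k`-th cycle of the chain, which lies to the left of the node `k`. -/
def cycleFlow (s : Fin n → Bool) (k : ℕ) : (chain n s).Dart → ℤ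
  | (i, Sum.inl b) => if s i then 0 else
      (if i.val = k then sign b else 0) - (if i.val + 1 = k then sign b else 0)
  | (i, Sum.inr (false, b)) => if i.val = k then -sign b else 0
  | (i, Sum.inr (true, b)) => if i.val + 1 = k then sign b else 0

theorem cycleFlow_bar (k : ℕ) (i : Fin n) (b : Bool) : cycleFlow s k (bar s i b) =
    if s i then 0 else (if i.val = k then sign b else 0) - (if i.val + 1 = k then sign b else 0) :=
  rfl

theorem cycleFlow_left (k : ℕ) (i : Fin n) (b : Bool) :
    cycleFlow s k (left s i b) = if i.val = k then -sign b else 0 :=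
  rfl

theorem cycleFlow_right (k : ℕ) (i : Fin n) (b : Bool) :
    cycleFlow s k (right s i b) = if i.val + 1 = k then sign b else 0 :=
  rfl

theorem sign_not (b : Bool) : sign (!b) = -sign b := by cases b <;> simp [sign]

theorem sum_chain (F : (chain n s).Dart → ℤ) : ∑ d, F d = ∑ i, ((F (bar s i false) + F (bar s i true)) +
    (F (left s i false) + F (left s i true)) + (F (right s i false) + F (right s i true))) := by
  have : ∀ F : Fin n × (Bool ⊕ Bool × Bool) → ℤ, ∑ d, F d =
      ∑ i, ((F (i, Sum.inl false) + F (i, Sum.inl true)) +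
      (F (i, Sum.inr (false, false)) + F (i, Sum.inr (false, true))) +
      (F (i, Sum.inr (true, false)) + F (i, Sum.inr (true, true)))) := by
    intro F
    simp only [Fintype.sum_prod_type, Fintype.sum_sum_type, Fintype.sum_bool]
    refine Finset.sum_congr rfl fun i _ => ?_
    ring
  exact this F

theorem isFlow_cycleFlow (s : Fin n → Bool) (k : ℕ) : IsFlow (chain n s) (cycleFlow s k) where
  rev d := by
    rcases chain_dart_cases d with ⟨i, b, rfl⟩ | ⟨i, b, rfl⟩ | ⟨i, b, rfl⟩
    · rw [rev_bar, cycleFlow_bar, cycleFlow_bar, sign_not]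
      split_ifs <;> ring
    · rcases rev_left_eq (s := s) i b with h | ⟨j, hj, h⟩
      · rw [h, cycleFlow_left, cycleFlow_left, sign_not]
        split_ifs <;> ring
      · rw [h, cycleFlow_left, cycleFlow_right, hj]
        split_ifs <;> ring
    · rcases rev_right_eq (s := s) i b with h | ⟨j, hj, h⟩
      · rw [h, cycleFlow_right, cycleFlow_right, sign_not]
        split_ifs <;> ring
      · rw [h, cycleFlow_left, cycleFlow_right, hj]
        split_ifs <;> ring
  sum g := by
    rw [sum_chain]
    refine Finset.sum_eq_zero fun i _ => ?_
    simp only [cycleFlow_bar, cycleFlow_left, cycleFlow_right, src_bar, src_left, src_right]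
    cases hs : s i <;> simp only [sign, Bool.false_eq_true, if_false, if_true] <;>
      split_ifs <;> ring

/-- An involution of a chain that maps every cycle to itself with the orientation reversed swaps
the two edges between consecutive nodes. -/
theorem chain_involution {φ : Iso (chain n s) (chain n s)}
    (hinv : ∀ d, φ.dart (φ.dart d) = d)
    (hφ : ∀ k d, cycleFlow s k (φ.dart d) = -cycleFlow s k d) {j : Fin n} (hj : j.val + 1 < n) :
    φ.dart (right s j false) = right s j true := by
  -- The dart `right s j b` lies on the cycle `j + 1` and on no other, and its image has the
  -- opposite flow values. New edges lie on two cycles or on none, so only the parallel dart and the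
  -- reverse of the dart itself remain.
  have image : ∀ b, φ.dart (right s j b) = right s j (!b) ∨
      φ.dart (right s j b) = left s ⟨j.val + 1, hj⟩ b := by
    intro b
    have h1 : ∀ k, cycleFlow s k (φ.dart (right s j b)) = if j.val + 1 = k then -sign b else 0 := by
      intro k
      rw [hφ, cycleFlow_right]
      split_ifs <;> ring
    have hne : sign b ≠ 0 := by cases b <;> simp [sign]
    have hinj : ∀ x, sign x = -sign b → x = !b := by
      intro x; cases x <;> cases b <;> simp [sign]
    rcases chain_dart_cases (φ.dart (right s j b)) with ⟨i, x, h⟩ | ⟨i, x, h⟩ | ⟨i, x, h⟩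
    · exfalso
      rw [h] at h1
      simp only [cycleFlow_bar] at h1
      have h2 := h1 (j.val + 1)
      cases hs : s i
      · simp only [hs, Bool.false_eq_true, if_false, if_true] at h1 h2
        have hx : sign x ≠ 0 := by cases x <;> simp [sign]
        by_cases h3 : i.val = j.val + 1
        · have h4 := h1 (i.val + 1)
          simp [h3] at h4
          exact hx h4
        · have h4 := h1 i.val
          have h5 : ¬ (j.val + 1 = i.val) := fun h => h3 h.symm
          simp [h5] at h4
          exact hx h4
      · simp only [hs, if_true] at h2
        exact hne (by linarith)
    · right
      simp only [h, cycleFlow_left] at h1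
      have h2 := h1 (j.val + 1)
      rw [if_pos rfl] at h2
      split_ifs at h2 with h3
      · have : x = b := by revert h2; cases x <;> cases b <;> simp [sign]
        rw [h, left_inj, Fin.ext_iff]
        exact ⟨h3, this⟩
      · exact absurd h2.symm (neg_ne_zero.2 hne)
    · left
      simp only [h, cycleFlow_right] at h1
      have h2 := h1 (j.val + 1)
      rw [if_pos rfl] at h2
      split_ifs at h2 with h3
      · rw [h, right_inj, Fin.ext_iff]
        exact ⟨by omega, hinj x h2⟩
      · exact absurd h2.symm (neg_ne_zero.2 hne)
  rcases image false with h | hf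
  · exact h
  -- If one of the parallel edges were reversed in place, then so would be the other, and their ends
  -- at node `j` would move to node `j + 1`. The cycle `j` passes through node `j` but not through
  -- node `j + 1`, although the involution preserves it.
  exfalso
  have ht : φ.dart (right s j true) = left s ⟨j.val + 1, hj⟩ true := by
    rcases image true with h | h
    · have h2 := hinv (right s j true)
      rw [h, Bool.not_true, hf] at h2
      exact absurd h2 left_ne_right
    · exact h
  have vf := φ.src_dart (right s j false)
  have vt := φ.src_dart (right s j true)
  rw [hf, src_left, src_right] at vf
  rw [ht, src_left, src_right] at vt
  have val : ∀ d x, (chain n s).src d = node s ⟨j.val + 1, hj⟩ x → cycleFlow s j.val d = 0 := by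
    intro d x hd
    rcases chain_dart_cases d with ⟨i, b, rfl⟩ | ⟨i, b, rfl⟩ | ⟨i, b, rfl⟩
    · rw [src_bar, node_inj] at hd
      rw [cycleFlow_bar, hd.1]
      simp
      omega
    · rw [src_left, node_inj] at hd
      rw [cycleFlow_left, hd.1]
      simp
    · rw [src_right, node_inj] at hd
      rw [cycleFlow_right, hd.1]
      simp
      omega
  have no : ∀ d x, cycleFlow s j.val d ≠ 0 →
      φ.vert ((chain n s).src d) ≠ node s ⟨j.val + 1, hj⟩ x := by
    intro d x hd h
    rw [← φ.src_dart] at h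
    have h2 := val _ _ h
    rw [hφ] at h2
    exact hd (neg_eq_zero.1 h2)
  cases hs : s j
  · refine no (bar s j false) false ?_ ?_
    · simp [cycleFlow_bar, hs, sign]
    · rw [src_bar]
      simpa [hs] using vf.symm
  -- At a bridge, the vertex known to move is not on the cycle `j`. The bridge is mapped to the
  -- bridge at `j + 1`, so its other end, which is on the cycle, moves to node `j + 1` as well.
  · simp only [hs, if_true, ite_self] at vf vt
    have hs' : s ⟨j.val + 1, hj⟩ = true := by
      rw [← vf, node_inj] at vt
      simpa using vt.2
    have hb : φ.dart (bar s j true) = bar s ⟨j.val + 1, hj⟩ false := by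
      have hsrc := φ.src_dart (bar s j true)
      rw [src_bar, ← vf] at hsrc
      rcases chain_dart_cases (φ.dart (bar s j true)) with ⟨i, b, h⟩ | ⟨i, b, h⟩ | ⟨i, b, h⟩
      · rw [h, src_bar, node_inj] at hsrc
        rw [h, hsrc.1, hsrc.2]
      · exfalso
        rw [h, src_left, node_inj] at hsrc
        rw [hsrc.1] at h
        cases b
        · exact right_ne_bar (φ.dart.injective (hf.trans h.symm))
        · exact right_ne_bar (φ.dart.injective (ht.trans h.symm))
      · exfalso
        rw [h, src_right, node_inj] at hsrc
        rw [hsrc.1, hs'] at hsrc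
        simp at hsrc
    have hb2 := φ.rev_dart (bar s j true)
    rw [hb, rev_bar, rev_bar] at hb2
    have hb3 := φ.src_dart (bar s j (!true))
    rw [← hb2, src_bar, src_bar] at hb3
    refine no (left s j false) true ?_ ?_
    · simp [cycleFlow_left, sign]
    · rw [src_left, hs]
      exact hb3.symm

end ChainFlow

/-- In a hyperelliptic metric graph that is combinatorially a chain, the two edges between
consecutive nodes have the same length. -/
theorem _root_.MetricGraph.IsHyperelliptic.length_eq {G : MetricGraph} (hG : G.IsHyperelliptic)
    {n : ℕ} {s : Fin n → Bool} (ψ : Iso (chain n s) G.toMultigraph) {j : Fin n}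
    (hj : j.val + 1 < n) :
    G.length (ψ.dart (right s j false)) = G.length (ψ.dart (right s j true)) := by
  obtain ⟨φ, hinv, hlen, htree⟩ := hG
  have : Fintype G.toMultigraph.Dart := Fintype.ofEquiv _ ψ.dart
  let φ' : Iso (chain n s) (chain n s) :=
    { vert := (ψ.vert.trans φ.vert).trans ψ.vert.symm
      dart := (ψ.dart.trans φ.dart).trans ψ.dart.symm
      src_dart := fun d => by
        simp only [Equiv.trans_apply, ψ.src_symm, φ.src_dart, ψ.src_dart]
      rev_dart := fun d => by
        simp only [Equiv.trans_apply, ψ.rev_symm, φ.rev_dart, ψ.rev_dart] }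
  have h := chain_involution (φ := φ') (fun d => by simp [φ', hinv.2]) (fun k d => by
    have := ((ψ.symm.isFlow (isFlow_cycleFlow s k))).involution htree hinv (ψ.dart d)
    simpa [Iso.symm, φ'] using this) hj
  have h2 : φ.dart (ψ.dart (right s j false)) = ψ.dart (right s j true) := by
    rw [← h]
    simp [φ']
  rw [← h2, hlen]

end Multigraph

/-! ### Slack of monomials, maximizers and vertices of the curve. -/

/-- The determinant of two integer vectors. -/
def cr (u v : ℤ × ℤ) : ℤ := u.1 * v.2 - u.2 * v.1

/-- The pairing of an exponent with a vector. -/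
def pair (a : ℤ × ℤ) (d : ℝ × ℝ) : ℝ := a.1 * d.1 + a.2 * d.2

namespace TropicalPolynomial

variable (f : TropicalPolynomial)

/-- The lattice point `p` lies in the interior of the Newton polygon. -/
def IsInt (p : ℤ × ℤ) : Prop := latticePoint p ∈ interior f.newtonPolygon

/-- By how much the tropical monomial `a` exceeds the minimum. -/
def slack (a : ℤ × ℤ) (w : ℝ × ℝ) : ℝ := f.term a w - f.eval w

variable {f}

theorem slack_nonneg {a : ℤ × ℤ} (ha : a ∈ f.support) (w : ℝ × ℝ) : 0 ≤ f.slack a w :=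
  sub_nonneg.2 (Finset.inf'_le (fun a => f.term a w) ha)

theorem mem_active {a : ℤ × ℤ} {w : ℝ × ℝ} : a ∈ f.active w ↔ a ∈ f.support ∧ f.slack a w = 0 := by
  rw [active, Finset.mem_filter, slack, sub_eq_zero]

theorem active_nonempty (w : ℝ × ℝ) : (f.active w).Nonempty := by
  obtain ⟨a, ha, h⟩ := Finset.exists_mem_eq_inf' f.nonempty fun a => f.term a w
  exact ⟨a, mem_active.2 ⟨ha, sub_eq_zero.2 h.symm⟩⟩

theorem slack_pos {a : ℤ × ℤ} {w : ℝ × ℝ} (ha : a ∈ f.support) (hw : a ∉ f.active w) :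
    0 < f.slack a w :=
  (slack_nonneg ha w).lt_of_ne fun h => hw (mem_active.2 ⟨ha, h.symm⟩)

theorem slack_sub (a b : ℤ × ℤ) (w w' : ℝ × ℝ) :
    f.slack a w' - f.slack a w - (f.slack b w' - f.slack b w) =
      (a.1 - b.1) * (w'.1 - w.1) + (a.2 - b.2) * (w'.2 - w.2) := by
  simp only [slack, term]
  ring

theorem active_subset {w : ℝ × ℝ} {a : ℤ × ℤ} (ha : a ∈ f.active w) : a ∈ f.support :=
  (mem_active.1 ha).1

theorem mem_newtonPolygon {a : ℤ × ℤ} (ha : a ∈ f.support) : latticePoint a ∈ f.newtonPolygon :=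
  subset_convexHull ℝ _ ⟨a, ha, rfl⟩

theorem convex_newtonPolygon : Convex ℝ f.newtonPolygon := convex_convexHull ℝ _

/-- A linear inequality on the support holds on the Newton polygon. -/
theorem le_of_mem_newtonPolygon {d : ℝ × ℝ} {k : ℝ} (h : ∀ a ∈ f.support, k ≤ pair a d)
    {x : ℝ × ℝ} (hx : x ∈ f.newtonPolygon) : k ≤ x.1 * d.1 + x.2 * d.2 := by
  have : f.newtonPolygon ⊆ {x | k ≤ x.1 * d.1 + x.2 * d.2} := by
    refine convexHull_min ?_ ?_
    · rintro _ ⟨a, ha, rfl⟩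
      exact h a ha
    · intro x hx y hy s t hs ht hst
      simp only [Set.mem_ofPred_eq, Prod.fst_add, Prod.snd_add, Prod.smul_fst, Prod.smul_snd,
        smul_eq_mul] at hx hy ⊢
      have hk : k = s * k + t * k := by rw [← add_mul, hst, one_mul]
      rw [hk]
      linarith [mul_le_mul_of_nonneg_left hx hs, mul_le_mul_of_nonneg_left hy ht]
  exact this hx

theorem exists_ball {x : ℝ × ℝ} (hx : x ∈ interior f.newtonPolygon) :
    ∃ δ : ℝ, 0 < δ ∧ ∀ s t : ℝ, |s| ≤ δ → |t| ≤ δ → (x.1 + s, x.2 + t) ∈ f.newtonPolygon := by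
  obtain ⟨ε, hε, h⟩ := Metric.isOpen_iff.1 isOpen_interior x hx
  refine ⟨ε / 2, by positivity, fun s t hs ht => interior_subset (h ?_)⟩
  rw [Metric.mem_ball, Prod.dist_eq, max_lt_iff, Real.dist_eq, Real.dist_eq]
  simp only [add_sub_cancel_left]
  constructor <;> linarith

/-- Otherwise `d` would be minimal on the polygon at `x`, although `x` can be moved against `d`
inside the polygon. -/
theorem exists_pair_lt {x d : ℝ × ℝ} (hx : x ∈ interior f.newtonPolygon) (hd : d ≠ 0) :
    ∃ b ∈ f.support, pair b d < x.1 * d.1 + x.2 * d.2 := by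
  by_contra hcon
  push Not at hcon
  obtain ⟨δ, hδ, h⟩ := exists_ball hx
  have h0 : 0 < |d.1| + |d.2| := by
    by_contra h0
    have h1 := abs_nonneg d.1
    have h2 := abs_nonneg d.2
    exact hd (Prod.ext (abs_eq_zero.1 (by linarith)) (abs_eq_zero.1 (by linarith)))
  have hs : ∀ r : ℝ, ∃ s, |s| ≤ δ ∧ s * r = - δ * |r| := by
    intro r
    rcases le_total 0 r with hr | hr
    · exact ⟨-δ, by rw [abs_neg, abs_of_pos hδ], by rw [abs_of_nonneg hr]⟩
    · exact ⟨δ, by rw [abs_of_pos hδ], by rw [abs_of_nonpos hr]; ring⟩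
  obtain ⟨s, hs1, hs2⟩ := hs d.1
  obtain ⟨t, ht1, ht2⟩ := hs d.2
  have := le_of_mem_newtonPolygon hcon (h s t hs1 ht1)
  simp only at this
  nlinarith

/-- Shooting a ray from `w` in the direction `d` until a new monomial becomes minimal. -/
theorem exists_slide {w d : ℝ × ℝ} {a : ℤ × ℤ} (ha : a ∈ f.active w)
    (hmin : ∀ b ∈ f.active w, pair a d ≤ pair b d) (hb : ∃ b ∈ f.support, pair b d < pair a d) :
    ∃ t : ℝ, 0 < t ∧ f.eval (w + t • d) = f.eval w + t * pair a d ∧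
      (∀ b ∈ f.active w, pair b d = pair a d → b ∈ f.active (w + t • d)) ∧
      ∃ b ∈ f.active (w + t • d), pair b d < pair a d := by
  classical
  obtain ⟨b₀, hb₀, hlt⟩ := hb
  -- Ratio test: among the monomials that decrease relative to `a`, the one that catches up with `a`
  -- first.
  obtain ⟨b, hb, hbmin⟩ := Finset.exists_min_image (f.support.filter fun b => pair b d < pair a d)
    (fun b => f.slack b w / (pair a d - pair b d)) ⟨b₀, Finset.mem_filter.2 ⟨hb₀, hlt⟩⟩
  rw [Finset.mem_filter] at hb
  set t := f.slack b w / (pair a d - pair b d) with ht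
  have hdb : 0 < pair a d - pair b d := by linarith [hb.2]
  have hbact : b ∉ f.active w := fun h => absurd hb.2 (not_lt.2 (hmin b h))
  have htpos : 0 < t := div_pos (slack_pos hb.1 hbact) hdb
  have term_eq : ∀ c, f.term c (w + t • d) = f.slack c w + f.eval w + t * pair c d := by
    intro c
    simp only [term, slack, pair, Prod.fst_add, Prod.snd_add, Prod.smul_fst, Prod.smul_snd,
      smul_eq_mul]
    ring
  have htb : f.slack b w = t * (pair a d - pair b d) := by
    rw [ht]
    field_simp
  have heval : f.eval (w + t • d) = f.eval w + t * pair a d := by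
    apply le_antisymm
    · refine (Finset.inf'_le (fun c => f.term c (w + t • d)) (active_subset ha)).trans_eq ?_
      rw [term_eq, (mem_active.1 ha).2]
      ring
    · refine Finset.le_inf' _ _ fun c hc => ?_
      rw [term_eq]
      by_cases hcd : pair c d < pair a d
      · have := hbmin c (Finset.mem_filter.2 ⟨hc, hcd⟩)
        rw [le_div_iff₀ (by linarith)] at this
        nlinarith
      · have := slack_nonneg hc w
        nlinarith
  refine ⟨t, htpos, heval, fun c hc hcd => ?_, b, ?_, hb.2⟩
  · refine mem_active.2 ⟨active_subset hc, ?_⟩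
    rw [slack, term_eq, heval, (mem_active.1 hc).2, hcd]
    ring
  · refine mem_active.2 ⟨hb.1, ?_⟩
    rw [slack, term_eq, heval, htb]
    ring

theorem continuous_eval : Continuous f.eval := by
  refine Continuous.finset_inf'_apply f.nonempty fun a _ => ?_
  unfold term
  fun_prop

/-- `w` maximizes the concave function `eval - x`. -/
def IsMaximizer (f : TropicalPolynomial) (x w : ℝ × ℝ) : Prop :=
  ∀ w', f.eval w' - (x.1 * w'.1 + x.2 * w'.2) ≤ f.eval w - (x.1 * w.1 + x.2 * w.2)

/-- Since a square of radius `δ` around `x` lies in the polygon, the objective is at most a constant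
minus `δ * ‖w‖`, so it tends to minus infinity and attains its maximum. -/
theorem exists_isMaximizer {x : ℝ × ℝ} (hx : x ∈ interior f.newtonPolygon) :
    ∃ w, IsMaximizer f x w := by
  obtain ⟨δ, hδ, h⟩ := exists_ball hx
  obtain ⟨m, -, hm⟩ := Finset.exists_max_image f.support f.coeff f.nonempty
  have bound : ∀ w : ℝ × ℝ, f.eval w - (x.1 * w.1 + x.2 * w.2) ≤ f.coeff m - δ * ‖w‖ := by
    intro w
    have h1 : ∀ a ∈ f.support, f.eval w - f.coeff m ≤ pair a w := by
      intro a ha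
      have h2 : f.eval w ≤ f.term a w := Finset.inf'_le (fun a => f.term a w) ha
      have h3 := hm a ha
      simp only [term] at h2
      simp only [pair]
      linarith
    have hs : ∀ r : ℝ, ∃ s, |s| ≤ δ ∧ s * r = - δ * |r| := by
      intro r
      rcases le_total 0 r with hr | hr
      · exact ⟨-δ, by rw [abs_neg, abs_of_pos hδ], by rw [abs_of_nonneg hr]⟩
      · exact ⟨δ, by rw [abs_of_pos hδ], by rw [abs_of_nonpos hr]; ring⟩
    obtain ⟨s, hs1, hs2⟩ := hs w.1
    obtain ⟨t, ht1, ht2⟩ := hs w.2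
    have e1 := le_of_mem_newtonPolygon h1 (h s 0 hs1 (by simpa using hδ.le))
    have e2 := le_of_mem_newtonPolygon h1 (h 0 t (by simpa using hδ.le) ht1)
    simp only [add_zero] at e1 e2
    rw [Prod.norm_def, Real.norm_eq_abs, Real.norm_eq_abs]
    rcases max_cases |w.1| |w.2| with ⟨h, -⟩ | ⟨h, -⟩ <;> rw [h] <;> nlinarith
  refine Continuous.exists_forall_ge (f := fun w : ℝ × ℝ => f.eval w - (x.1 * w.1 + x.2 * w.2))
    (by have := f.continuous_eval; fun_prop) ?_
  refine Filter.tendsto_atBot_mono bound ?_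
  have := (tendsto_norm_cocompact_atTop (E := ℝ × ℝ)).const_mul_atTop hδ
  exact Filter.tendsto_atBot_add_const_left _ (f.coeff m) (Filter.tendsto_neg_atTop_atBot.comp this)

/-- Otherwise a short move in the direction `d` would increase the objective. Over all `d`, this
says that `x` is in the convex hull of the active exponents. -/
theorem IsMaximizer.exists_le {x w : ℝ × ℝ} (hw : IsMaximizer f x w)
    (hx : x ∈ interior f.newtonPolygon) (d : ℝ × ℝ) :
    ∃ a ∈ f.active w, pair a d ≤ x.1 * d.1 + x.2 * d.2 := by
  by_cases hd : d = 0
  · obtain ⟨a, ha⟩ := f.active_nonempty w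
    exact ⟨a, ha, by simp [pair, hd]⟩
  obtain ⟨a, ha, hmin⟩ := Finset.exists_min_image (f.active w) (fun a => pair a d)
    (f.active_nonempty w)
  refine ⟨a, ha, ?_⟩
  by_contra! hcon
  obtain ⟨b, hb, hbx⟩ := exists_pair_lt hx hd
  obtain ⟨t, ht, heval, -⟩ := exists_slide ha hmin ⟨b, hb, hbx.trans hcon⟩
  have := hw (w + t • d)
  rw [heval] at this
  simp only [Prod.fst_add, Prod.snd_add, Prod.smul_fst, Prod.smul_snd, smul_eq_mul] at this
  nlinarith

/-- Three noncollinear active exponents make a vertex. -/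
theorem isVertex_of_cr_ne_zero {w : ℝ × ℝ} {a b c : ℤ × ℤ} (ha : a ∈ f.active w)
    (hb : b ∈ f.active w) (hc : c ∈ f.active w) (h : cr (b - a) (c - a) ≠ 0) : f.IsVertex w := by
  rw [IsVertex, eq_top_iff]
  have hA : ∀ a ∈ f.active w,
      latticePoint a ∈ affineSpan ℝ (latticePoint '' (f.active w : Set (ℤ × ℤ))) :=
    fun a ha => subset_affineSpan ℝ _ ⟨a, ha, rfl⟩
  rintro x -
  obtain ⟨D, hD0, hD⟩ : ∃ D : ℝ, D ≠ 0 ∧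
      D = (b.1 - a.1 : ℝ) * (c.2 - a.2) - (b.2 - a.2) * (c.1 - a.1) := by
    refine ⟨_, ?_, rfl⟩
    simp only [cr, Prod.fst_sub, Prod.snd_sub] at h
    exact_mod_cast h
  have key : x = ((((x.1 - a.1) * (c.2 - a.2) - (x.2 - a.2) * (c.1 - a.1)) / D : ℝ) •
      (latticePoint b - latticePoint a)) +
      (((((b.1 - a.1) * (x.2 - a.2) - (b.2 - a.2) * (x.1 - a.1)) / D : ℝ) •
      (latticePoint c - latticePoint a)) + latticePoint a) := by
    ext
    · simp only [latticePoint, Prod.fst_add, Prod.smul_fst, Prod.fst_sub, smul_eq_mul]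
      field_simp
      rw [hD]
      ring
    · simp only [latticePoint, Prod.snd_add, Prod.smul_snd, Prod.snd_sub, smul_eq_mul]
      field_simp
      rw [hD]
      ring
  rw [key]
  exact AffineSubspace.smul_vsub_vadd_mem _ _ (hA b hb) (hA a ha)
    (AffineSubspace.smul_vsub_vadd_mem _ _ (hA c hc) (hA a ha) (hA a ha))

/-- A maximizer that is not a vertex can be slid, in a direction on which all active exponents
agree, to a maximizer with more active exponents. -/
theorem exists_isVertex_isMaximizer {x : ℝ × ℝ} (hx : x ∈ interior f.newtonPolygon) :
    ∃ w, f.IsVertex w ∧ IsMaximizer f x w := by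
  obtain ⟨w, hw⟩ := exists_isMaximizer hx
  induction hk : f.support.card - (f.active w).card using Nat.strong_induction_on generalizing w with
  | _ k ih =>
  by_cases hv : f.IsVertex w
  · exact ⟨w, hv, hw⟩
  obtain ⟨a, ha⟩ := f.active_nonempty w
  obtain ⟨d, hd, hconst⟩ : ∃ d : ℝ × ℝ, d ≠ 0 ∧ ∀ b ∈ f.active w, pair b d = pair a d := by
    by_cases hone : ∃ b ∈ f.active w, b ≠ a
    · obtain ⟨b, hb, hba⟩ := hone
      refine ⟨(-((b.2 : ℝ) - a.2), (b.1 : ℝ) - a.1), fun h => hba ?_, fun c hc => ?_⟩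
      · simp only [Prod.mk_eq_zero, neg_eq_zero, sub_eq_zero, Int.cast_inj] at h
        exact Prod.ext h.2 h.1
      · have : cr (b - a) (c - a) = 0 := by
          by_contra hne
          exact hv (isVertex_of_cr_ne_zero ha hb hc hne)
        have : ((b.1 : ℝ) - a.1) * (c.2 - a.2) - (b.2 - a.2) * (c.1 - a.1) = 0 := by
          simp only [cr, Prod.fst_sub, Prod.snd_sub] at this
          exact_mod_cast this
        simp only [pair]
        linarith
    · push Not at hone
      exact ⟨(1, 0), by simp, fun b hb => by rw [hone b hb]⟩
  -- One of the two orientations of `d` does not decrease the objective.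
  obtain ⟨d, hd, hconst, hle⟩ : ∃ d : ℝ × ℝ, d ≠ 0 ∧ (∀ b ∈ f.active w, pair b d = pair a d) ∧
      x.1 * d.1 + x.2 * d.2 ≤ pair a d := by
    by_cases hle : x.1 * d.1 + x.2 * d.2 ≤ pair a d
    · exact ⟨d, hd, hconst, hle⟩
    · have hneg : ∀ b : ℤ × ℤ, pair b (-d) = - pair b d := by
        intro b; simp only [pair, Prod.fst_neg, Prod.snd_neg]; ring
      refine ⟨-d, neg_ne_zero.2 hd, fun b hb => by rw [hneg, hneg, hconst b hb], ?_⟩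
      rw [hneg]
      simp only [Prod.fst_neg, Prod.snd_neg]
      linarith
  obtain ⟨b, hb, hbx⟩ := exists_pair_lt hx hd
  obtain ⟨t, ht, heval, hact, c, hc, hcd⟩ := exists_slide ha (fun b hb => (hconst b hb).ge)
    ⟨b, hb, hbx.trans_le hle⟩
  have hcw : c ∉ f.active w := fun h => hcd.ne (hconst c h)
  have hlt : (f.active w).card < (f.active (w + t • d)).card :=
    Finset.card_lt_card ⟨fun b hb => hact b hb (hconst b hb), fun h => hcw (h hc)⟩
  have hle' : (f.active (w + t • d)).card ≤ f.support.card :=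
    Finset.card_le_card fun b => active_subset
  refine ih _ ?_ (w + t • d) (fun w' => (hw w').trans ?_) rfl
  · omega
  · rw [heval]
    simp only [Prod.fst_add, Prod.snd_add, Prod.smul_fst, Prod.smul_snd, smul_eq_mul]
    nlinarith

end TropicalPolynomial

/-! ### The dual triangulation: its triangles cover the polygon and meet in common faces. -/

theorem cr_sub_rotate (a b c : ℤ × ℤ) : cr (c - b) (a - b) = cr (b - a) (c - a) := by
  simp only [cr, Prod.fst_sub, Prod.snd_sub]
  ring

theorem cr_swap (u v : ℤ × ℤ) : cr v u = -cr u v := by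
  simp only [cr]
  ring

/-- Up to the sign of the area, the barycentric coordinate of `x` at the vertex `a` of a unimodular
triangle `a, b, c`. -/
def bary (a b c : ℤ × ℤ) (x : ℝ × ℝ) : ℝ :=
  cr (b - a) (c - a) * ((b.1 - x.1) * (c.2 - x.2) - (b.2 - x.2) * (c.1 - x.1))

namespace TropicalPolynomial

variable {f : TropicalPolynomial}

/-- The cell dual to `w` is the unimodular triangle `a, b, c`. -/
structure IsTri (f : TropicalPolynomial) (w : ℝ × ℝ) (a b c : ℤ × ℤ) : Prop where
  mem : ∀ x, x ∈ f.active w ↔ x = a ∨ x = b ∨ x = c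
  cr : cr (b - a) (c - a) = 1 ∨ cr (b - a) (c - a) = -1

namespace IsTri

variable {w : ℝ × ℝ} {a b c : ℤ × ℤ}

theorem rotate (h : IsTri f w a b c) : IsTri f w b c a where
  mem x := by rw [h.mem]; tauto
  cr := by rw [cr_sub_rotate]; exact h.cr

theorem swap (h : IsTri f w a b c) : IsTri f w a c b where
  mem x := by rw [h.mem]; tauto
  cr := by rw [cr_swap]; have := h.cr; omega

theorem mem₁ (h : IsTri f w a b c) : a ∈ f.active w := (h.mem a).2 (by simp)

theorem mem₂ (h : IsTri f w a b c) : b ∈ f.active w := (h.mem b).2 (by simp)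

theorem mem₃ (h : IsTri f w a b c) : c ∈ f.active w := (h.mem c).2 (by simp)

theorem cr_ne_zero (h : IsTri f w a b c) : _root_.cr (b - a) (c - a) ≠ 0 := by
  have := h.cr
  omega

theorem ne₁₂ (h : IsTri f w a b c) : a ≠ b := by
  rintro rfl
  exact h.cr_ne_zero (by simp [_root_.cr])

theorem ne₂₃ (h : IsTri f w a b c) : b ≠ c := h.rotate.ne₁₂

theorem ne₁₃ (h : IsTri f w a b c) : a ≠ c := h.swap.ne₁₂

theorem isVertex (h : IsTri f w a b c) : f.IsVertex w :=
  isVertex_of_cr_ne_zero h.mem₁ h.mem₂ h.mem₃ h.cr_ne_zero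

theorem cr_sq (h : IsTri f w a b c) : (_root_.cr (b - a) (c - a) : ℝ) * _root_.cr (b - a) (c - a) = 1 := by
  rcases h.cr with h | h <;> rw [h] <;> norm_num

theorem bary_add (h : IsTri f w a b c) (x : ℝ × ℝ) :
    bary a b c x + bary b c a x + bary c a b x = 1 := by
  rw [← h.cr_sq]
  simp only [bary, cr_sub_rotate]
  simp only [_root_.cr, Prod.fst_sub, Prod.snd_sub]
  push_cast
  ring

theorem eq_bary (h : IsTri f w a b c) (x : ℝ × ℝ) :
    x.1 = bary a b c x * a.1 + bary b c a x * b.1 + bary c a b x * c.1 ∧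
    x.2 = bary a b c x * a.2 + bary b c a x * b.2 + bary c a b x * c.2 := by
  have h1 := h.cr_sq
  simp only [bary]
  rw [cr_sub_rotate b c a, cr_sub_rotate a b c]
  set D : ℝ := (_root_.cr (b - a) (c - a) : ℝ) with hD
  have h2 : D = (b.1 - a.1 : ℝ) * (c.2 - a.2) - (b.2 - a.2) * (c.1 - a.1) := by
    rw [hD]
    simp [_root_.cr]
  constructor
  · linear_combination (-x.1) * h1 + D * x.1 * h2
  · linear_combination (-x.2) * h1 + D * x.2 * h2

end IsTri

theorem IsSmooth.exists_isTri (hs : f.IsSmooth) {w : ℝ × ℝ} (hw : f.IsVertex w) :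
    ∃ a b c, IsTri f w a b c := by
  obtain ⟨a, b, c, h, hcr⟩ := hs.2 w hw
  refine ⟨a, b, c, fun x => ?_, ?_⟩
  · rw [← Finset.mem_coe, h]
    simp
  · exact (abs_eq (by norm_num)).1 hcr

theorem IsSmooth.exists_isTri_of_mem (hs : f.IsSmooth) {w : ℝ × ℝ} (hw : f.IsVertex w)
    {a : ℤ × ℤ} (ha : a ∈ f.active w) : ∃ b c, IsTri f w a b c := by
  obtain ⟨x, y, z, h⟩ := hs.exists_isTri hw
  rcases (h.mem a).1 ha with rfl | rfl | rfl
  · exact ⟨_, _, h⟩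
  · exact ⟨_, _, h.rotate⟩
  · exact ⟨_, _, h.rotate.rotate⟩

theorem IsSmooth.exists_isTri_of_mem_of_mem (hs : f.IsSmooth) {w : ℝ × ℝ} (hw : f.IsVertex w)
    {a b : ℤ × ℤ} (ha : a ∈ f.active w) (hb : b ∈ f.active w) (hab : a ≠ b) :
    ∃ c, IsTri f w a b c := by
  obtain ⟨y, z, h⟩ := hs.exists_isTri_of_mem hw ha
  rcases (h.mem b).1 hb with rfl | rfl | rfl
  · exact absurd rfl hab
  · exact ⟨_, h⟩
  · exact ⟨_, h.swap⟩

theorem IsSmooth.isTri_of_mem (hs : f.IsSmooth) {w : ℝ × ℝ} (hw : f.IsVertex w)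
    {a b c : ℤ × ℤ} (ha : a ∈ f.active w) (hb : b ∈ f.active w) (hc : c ∈ f.active w)
    (hab : a ≠ b) (hac : a ≠ c) (hbc : b ≠ c) : IsTri f w a b c := by
  obtain ⟨z, h⟩ := hs.exists_isTri_of_mem_of_mem hw ha hb hab
  rcases (h.mem c).1 hc with rfl | rfl | rfl
  · exact absurd rfl hac
  · exact absurd rfl hbc
  · exact h

/-- A vertex is determined by three noncollinear active exponents. -/
theorem IsTri.eq_of_mem {w w' : ℝ × ℝ} {a b c : ℤ × ℤ} (h : IsTri f w a b c)
    (ha : a ∈ f.active w') (hb : b ∈ f.active w') (hc : c ∈ f.active w') : w = w' := by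
  have h1 := slack_sub (f := f) b a w w'
  have h2 := slack_sub (f := f) c a w w'
  rw [(mem_active.1 h.mem₁).2, (mem_active.1 h.mem₂).2, (mem_active.1 ha).2,
    (mem_active.1 hb).2] at h1
  rw [(mem_active.1 h.mem₁).2, (mem_active.1 h.mem₃).2, (mem_active.1 ha).2,
    (mem_active.1 hc).2] at h2
  have hD : (b.1 - a.1 : ℝ) * (c.2 - a.2) - (b.2 - a.2) * (c.1 - a.1) ≠ 0 := by
    have := h.cr_ne_zero
    simp only [_root_.cr, Prod.fst_sub, Prod.snd_sub] at this
    exact_mod_cast this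
  ext
  · have : ((b.1 - a.1 : ℝ) * (c.2 - a.2) - (b.2 - a.2) * (c.1 - a.1)) * (w'.1 - w.1) = 0 := by
      linear_combination (-(c.2 - a.2 : ℝ)) * h1 + (b.2 - a.2 : ℝ) * h2
    have := (mul_eq_zero.1 this).resolve_left hD
    linarith
  · have : ((b.1 - a.1 : ℝ) * (c.2 - a.2) - (b.2 - a.2) * (c.1 - a.1)) * (w'.2 - w.2) = 0 := by
      linear_combination (c.1 - a.1 : ℝ) * h1 - (b.1 - a.1 : ℝ) * h2
    have := (mul_eq_zero.1 this).resolve_left hD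
    linarith

theorem IsSmooth.finite_vertices (hs : f.IsSmooth) : {w | f.IsVertex w}.Finite := by
  refine Set.Finite.of_finite_image (f := f.active) ?_ ?_
  · refine Set.Finite.subset (f.support.powerset.finite_toSet) ?_
    rintro _ ⟨w, -, rfl⟩
    rw [Finset.mem_coe, Finset.mem_powerset]
    exact fun a => active_subset
  · intro w hw w' _ h
    obtain ⟨a, b, c, ht⟩ := hs.exists_isTri hw
    exact ht.eq_of_mem (h ▸ ht.mem₁) (h ▸ ht.mem₂) (h ▸ ht.mem₃)

variable (f) in
/-- The triangle dual to the vertex `w`. -/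
def cell (w : ℝ × ℝ) : Set (ℝ × ℝ) := {x | ∀ a b c, IsTri f w a b c → 0 ≤ bary a b c x}

theorem isClosed_cell (w : ℝ × ℝ) : IsClosed (cell f w) := by
  simp only [cell, Set.ofPred_forall]
  refine isClosed_iInter fun a => isClosed_iInter fun b => isClosed_iInter fun c =>
    isClosed_iInter fun _ => isClosed_le continuous_const ?_
  unfold bary
  fun_prop

/-- The triangles cover the Newton polygon. -/
theorem exists_mem_cell {x : ℝ × ℝ}
    (hx : x ∈ interior f.newtonPolygon) : ∃ w, f.IsVertex w ∧ x ∈ cell f w := by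
  obtain ⟨w, hw, hmax⟩ := exists_isVertex_isMaximizer hx
  refine ⟨w, hw, fun a b c h => ?_⟩
  set D : ℝ := (cr (b - a) (c - a) : ℝ) with hD
  have h2 : D = (b.1 - a.1 : ℝ) * (c.2 - a.2) - (b.2 - a.2) * (c.1 - a.1) := by
    rw [hD]
    simp [_root_.cr]
  have h1 : D * D = 1 := h.cr_sq
  -- The chosen direction is the normal of the side `b, c` on which `a` has value 1 more than that
  -- side; relative to the side its value at `x` is `bary a b c x`.
  obtain ⟨e, he, hle⟩ := hmax.exists_le hx (D * (b.2 - c.2), D * (c.1 - b.1))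
  simp only [pair] at hle
  have hb : bary a b c x = (x.1 * (D * (b.2 - c.2)) + x.2 * (D * (c.1 - b.1))) -
      (b.1 * (D * (b.2 - c.2)) + b.2 * (D * (c.1 - b.1))) := by
    simp only [bary, ← hD]
    ring
  rw [hb]
  rcases (h.mem e).1 he with rfl | rfl | rfl
  · have : (e.1 * (D * (b.2 - c.2)) + e.2 * (D * (c.1 - b.1))) -
      (b.1 * (D * (b.2 - c.2)) + b.2 * (D * (c.1 - b.1))) = 1 := by
      rw [← h1]
      linear_combination (-D) * h2
    linarith
  · linarith
  · have : (e.1 * (D * (b.2 - e.2)) + e.2 * (D * (e.1 - b.1))) =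
      (b.1 * (D * (b.2 - e.2)) + b.2 * (D * (e.1 - b.1))) := by ring
    linarith

/-- Every germ of a segment at an interior point of the Newton polygon lies in a triangle. -/
theorem IsSmooth.exists_germ (hs : f.IsSmooth) {x : ℝ × ℝ} (hx : x ∈ interior f.newtonPolygon)
    (n : ℝ × ℝ) : ∃ w, f.IsVertex w ∧ x ∈ cell f w ∧ ∃ ε : ℝ, 0 < ε ∧ x + ε • n ∈ cell f w := by
  -- The cells that miss `x` are closed and finite in number, so a neighbourhood of `x` avoids all
  -- of them.
  have hfin : {w | f.IsVertex w ∧ x ∉ cell f w}.Finite :=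
    hs.finite_vertices.subset fun w hw => hw.1
  have hclosed : IsClosed (⋃ w ∈ {w | f.IsVertex w ∧ x ∉ cell f w}, cell f w) :=
    hfin.isClosed_biUnion fun w _ => isClosed_cell w
  have hopen : IsOpen (interior f.newtonPolygon ∩
      (⋃ w ∈ {w | f.IsVertex w ∧ x ∉ cell f w}, cell f w)ᶜ) :=
    isOpen_interior.inter hclosed.isOpen_compl
  have hxmem : x + (0 : ℝ) • n ∈ interior f.newtonPolygon ∩
      (⋃ w ∈ {w | f.IsVertex w ∧ x ∉ cell f w}, cell f w)ᶜ := by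
    rw [zero_smul, add_zero]
    refine ⟨hx, fun h => ?_⟩
    simp only [Set.mem_iUnion] at h
    obtain ⟨w, hw, hxw⟩ := h
    exact hw.2 hxw
  have hcont : Continuous fun ε : ℝ => x + ε • n := by fun_prop
  have hev := (hcont.tendsto 0).eventually (hopen.mem_nhds hxmem)
  obtain ⟨ε, ⟨hε1, hε2⟩, hε⟩ :=
    ((hev.filter_mono nhdsWithin_le_nhds).and (self_mem_nhdsWithin (s := Set.Ioi (0 : ℝ)))).exists
  obtain ⟨w, hw, hmem⟩ := exists_mem_cell hε1
  refine ⟨w, hw, ?_, ε, hε, hmem⟩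
  by_contra hxw
  refine hε2 ?_
  simp only [Set.mem_iUnion]
  exact ⟨w, ⟨hw, hxw⟩, hmem⟩

/-- Slacks at two points of the plane differ by an affine function of the exponent. Together with
nonnegativity of slacks on the support, this is the reason why the cells fit together along faces.
-/
theorem exists_slack_affine (w w' : ℝ × ℝ) :
    ∃ m n k : ℝ, ∀ z : ℤ × ℤ, f.slack z w' = f.slack z w + (m * z.1 + n * z.2 + k) := by
  refine ⟨w'.1 - w.1, w'.2 - w.2, f.eval w - f.eval w', fun z => ?_⟩
  simp only [slack, term]
  ring

/-- Cells intersect in common faces. -/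
theorem IsSmooth.mem_active_of_combo (hs : f.IsSmooth) {w w' x : ℝ × ℝ} (hw' : f.IsVertex w')
    (hx : x ∈ cell f w') {a b c : ℤ × ℤ} (ha : a ∈ f.active w) (hb : b ∈ f.active w)
    (hc : c ∈ f.active w) {r s t : ℝ} (hr : 0 < r) (hs0 : 0 ≤ s) (ht : 0 ≤ t) (hrst : r + s + t = 1)
    (hx1 : x.1 = r * a.1 + s * b.1 + t * c.1) (hx2 : x.2 = r * a.2 + s * b.2 + t * c.2) :
    a ∈ f.active w' := by
  obtain ⟨a', b', c', h⟩ := hs.exists_isTri hw'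
  obtain ⟨m, n, k, hA⟩ := exists_slack_affine (f := f) w w'
  obtain ⟨e1, e2⟩ := h.eq_bary x
  have e3 := h.bary_add x
  have p1 := hx _ _ _ h
  have p2 := hx _ _ _ h.rotate
  have p3 := hx _ _ _ h.rotate.rotate
  set α := bary a' b' c' x
  set β := bary b' c' a' x
  set γ := bary c' a' b' x
  have s1 := hA a
  have s2 := hA b
  have s3 := hA c
  have s1' := hA a'
  have s2' := hA b'
  have s3' := hA c'
  rw [(mem_active.1 ha).2] at s1
  rw [(mem_active.1 hb).2] at s2
  rw [(mem_active.1 hc).2] at s3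
  rw [(mem_active.1 h.mem₁).2] at s1'
  rw [(mem_active.1 h.mem₂).2] at s2'
  rw [(mem_active.1 h.mem₃).2] at s3'
  -- The affine difference of the two slacks is evaluated at `x` through both barycentric
  -- expressions. The left side is nonnegative and the right side nonpositive, so every summand
  -- vanishes.
  have key : r * f.slack a w' + s * f.slack b w' + t * f.slack c w' =
      -(α * f.slack a' w + β * f.slack b' w + γ * f.slack c' w) := by
    rw [s1, s2, s3]
    linear_combination (k : ℝ) * hrst - k * e3 - m * hx1 - n * hx2 + m * e1 + n * e2 +
      (-α) * s1' - β * s2' - γ * s3'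
  have q1 := mul_nonneg p1 (slack_nonneg (active_subset h.mem₁) w)
  have q2 := mul_nonneg p2 (slack_nonneg (active_subset h.mem₂) w)
  have q3 := mul_nonneg p3 (slack_nonneg (active_subset h.mem₃) w)
  have q4 := mul_nonneg hs0 (slack_nonneg (active_subset hb) w')
  have q5 := mul_nonneg ht (slack_nonneg (active_subset hc) w')
  have q6 := slack_nonneg (active_subset ha) w'
  refine mem_active.2 ⟨active_subset ha, le_antisymm ?_ q6⟩
  by_contra! hpos
  have := mul_pos hr hpos
  linarith

/-- Cones of cells at a common exponent intersect in common faces. -/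
theorem mem_active_of_cone {w w' : ℝ × ℝ} {p a b a' b' : ℤ × ℤ} (hp : p ∈ f.active w)
    (ha : a ∈ f.active w) (hb : b ∈ f.active w) (hp' : p ∈ f.active w') (ha' : a' ∈ f.active w')
    (hb' : b' ∈ f.active w') {r s r' s' : ℝ} (hr : 0 < r) (hs : 0 ≤ s) (hr' : 0 ≤ r')
    (hs' : 0 ≤ s')
    (h1 : r * (a.1 - p.1) + s * (b.1 - p.1) = r' * (a'.1 - p.1) + s' * (b'.1 - p.1))
    (h2 : r * (a.2 - p.2) + s * (b.2 - p.2) = r' * (a'.2 - p.2) + s' * (b'.2 - p.2)) :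
    a ∈ f.active w' := by
  obtain ⟨m, n, k, hA⟩ := exists_slack_affine (f := f) w w'
  have s0 := hA p
  have s1 := hA a
  have s2 := hA b
  have s1' := hA a'
  have s2' := hA b'
  rw [(mem_active.1 hp).2, (mem_active.1 hp').2] at s0
  rw [(mem_active.1 ha).2] at s1
  rw [(mem_active.1 hb).2] at s2
  rw [(mem_active.1 ha').2] at s1'
  rw [(mem_active.1 hb').2] at s2'
  have key : r * f.slack a w' + s * f.slack b w' = -(r' * f.slack a' w + s' * f.slack b' w) := by
    linear_combination r * s1 + s * s2 - r' * s1' - s' * s2' + m * h1 + n * h2 +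
      (r' + s' - r - s) * s0
  have q1 := mul_nonneg hr' (slack_nonneg (active_subset ha') w)
  have q2 := mul_nonneg hs' (slack_nonneg (active_subset hb') w)
  have q4 := mul_nonneg hs (slack_nonneg (active_subset hb) w')
  have q6 := slack_nonneg (active_subset ha) w'
  refine mem_active.2 ⟨active_subset ha, le_antisymm ?_ q6⟩
  by_contra! hpos
  have := mul_pos hr hpos
  linarith

/-- A lattice point in a cell is one of its corners. -/
theorem IsSmooth.mem_active_of_mem_cell (hs : f.IsSmooth) {w : ℝ × ℝ} (hw : f.IsVertex w)
    {p : ℤ × ℤ} (hp : latticePoint p ∈ cell f w) : p ∈ f.active w := by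
  obtain ⟨a, b, c, h⟩ := hs.exists_isTri hw
  -- By unimodularity the barycentric coordinates of a lattice point are integers; being nonnegative
  -- with sum 1, they are those of a corner.
  have hint : ∀ a b c : ℤ × ℤ, ∃ k : ℤ, bary a b c (latticePoint p) = k := by
    intro a b c
    refine ⟨cr (b - a) (c - a) * ((b.1 - p.1) * (c.2 - p.2) - (b.2 - p.2) * (c.1 - p.1)), ?_⟩
    simp [bary, latticePoint]
  obtain ⟨e1, e2⟩ := h.eq_bary (latticePoint p)
  have e3 := h.bary_add (latticePoint p)
  have p1 := hp _ _ _ h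
  have p2 := hp _ _ _ h.rotate
  have p3 := hp _ _ _ h.rotate.rotate
  obtain ⟨α, hα⟩ := hint a b c
  obtain ⟨β, hβ⟩ := hint b c a
  obtain ⟨γ, hγ⟩ := hint c a b
  rw [hα, hβ, hγ] at e1 e2 e3
  rw [hα] at p1
  rw [hβ] at p2
  rw [hγ] at p3
  simp only [latticePoint] at e1 e2
  norm_cast at e1 e2 e3 p1 p2 p3
  have : (α = 1 ∧ β = 0 ∧ γ = 0) ∨ (α = 0 ∧ β = 1 ∧ γ = 0) ∨ (α = 0 ∧ β = 0 ∧ γ = 1) := by omega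
  rw [h.mem]
  rcases this with ⟨rfl, rfl, rfl⟩ | ⟨rfl, rfl, rfl⟩ | ⟨rfl, rfl, rfl⟩
  · exact Or.inl (Prod.ext (by simpa using e1) (by simpa using e2))
  · exact Or.inr (Or.inl (Prod.ext (by simpa using e1) (by simpa using e2)))
  · exact Or.inr (Or.inr (Prod.ext (by simpa using e1) (by simpa using e2)))

/-- Two triangles on the same side of a common edge coincide. -/
theorem IsTri.eq_of_cr_eq {w w' : ℝ × ℝ} {p q c c' : ℤ × ℤ} (h : IsTri f w p q c)
    (h' : IsTri f w' p q c') (hcr : _root_.cr (q - p) (c - p) = _root_.cr (q - p) (c' - p)) :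
    w = w' := by
  -- `c' - p = (c - p) + k (q - p)`
  obtain ⟨k, hk1, hk2⟩ : ∃ k : ℤ, c'.1 - p.1 = (c.1 - p.1) + k * (q.1 - p.1) ∧
      c'.2 - p.2 = (c.2 - p.2) + k * (q.2 - p.2) := by
    refine ⟨_root_.cr (q - p) (c - p) * _root_.cr (c' - c) (c - p), ?_⟩
    have h2 := h.cr
    simp only [_root_.cr, Prod.fst_sub, Prod.snd_sub] at hcr h2 ⊢
    obtain ⟨D, hD⟩ : ∃ D, D = (q.1 - p.1) * (c.2 - p.2) - (q.2 - p.2) * (c.1 - p.1) := ⟨_, rfl⟩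
    rw [← hD] at h2 hcr ⊢
    have h3 : D * D = 1 := by rcases h2 with h | h <;> rw [h] <;> norm_num
    have hZ : (q.1 - p.1) * (c'.2 - c.2) - (q.2 - p.2) * (c'.1 - c.1) = 0 := by
      linear_combination hD - hcr
    constructor
    · linear_combination (-(c'.1 - c.1)) * h3 + D * (c'.1 - c.1) * hD + D * (c.1 - p.1) * hZ
    · linear_combination (-(c'.2 - c.2)) * h3 + D * (c'.2 - c.2) * hD + D * (c.2 - p.2) * hZ
  have r1 : (c'.1 - p.1 : ℝ) = (c.1 - p.1) + k * (q.1 - p.1) := by exact_mod_cast hk1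
  have r2 : (c'.2 - p.2 : ℝ) = (c.2 - p.2) + k * (q.2 - p.2) := by exact_mod_cast hk2
  -- According to the sign of `k`, the third corner of one triangle lies in the cone of the other
  -- triangle at `p`.
  rcases le_total 0 k with hk | hk
  · have hk' : (0 : ℝ) ≤ k := by exact_mod_cast hk
    refine h.eq_of_mem h'.mem₁ h'.mem₂ ?_
    exact mem_active_of_cone h.mem₁ h.mem₃ h.mem₂ h'.mem₁ h'.mem₃ h'.mem₂ (r := 1) (s := k)
      (r' := 1) (s' := 0) one_pos hk' zero_le_one le_rfl (by linarith) (by linarith)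
  · have hk' : (0 : ℝ) ≤ -k := by exact_mod_cast neg_nonneg.2 hk
    refine (h'.eq_of_mem h.mem₁ h.mem₂ ?_).symm
    exact mem_active_of_cone h'.mem₁ h'.mem₃ h'.mem₂ h.mem₁ h.mem₃ h.mem₂ (r := 1) (s := -k)
      (r' := 1) (s' := 0) one_pos hk' zero_le_one le_rfl (by linarith) (by linarith)

theorem IsTri.cr_eq_neg {w w' : ℝ × ℝ} {p q c c' : ℤ × ℤ} (h : IsTri f w p q c)
    (h' : IsTri f w' p q c') (hne : w ≠ w') :
    _root_.cr (q - p) (c' - p) = -_root_.cr (q - p) (c - p) := by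
  have h1 := h.cr
  have h2 := h'.cr
  have h3 : _root_.cr (q - p) (c - p) ≠ _root_.cr (q - p) (c' - p) :=
    fun e => hne (h.eq_of_cr_eq h' e)
  omega

/-- At most two triangles share an edge. -/
theorem IsSmooth.eq_of_edge (hs : f.IsSmooth) {w w₁ w₂ : ℝ × ℝ} {p q : ℤ × ℤ} (hpq : p ≠ q)
    (hw : f.IsVertex w) (hw₁ : f.IsVertex w₁) (hw₂ : f.IsVertex w₂)
    (hp : p ∈ f.active w) (hq : q ∈ f.active w) (hp₁ : p ∈ f.active w₁) (hq₁ : q ∈ f.active w₁)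
    (hp₂ : p ∈ f.active w₂) (hq₂ : q ∈ f.active w₂) (h₁ : w₁ ≠ w) (h₂ : w₂ ≠ w) : w₁ = w₂ := by
  obtain ⟨c, h⟩ := hs.exists_isTri_of_mem_of_mem hw hp hq hpq
  obtain ⟨c₁, h1⟩ := hs.exists_isTri_of_mem_of_mem hw₁ hp₁ hq₁ hpq
  obtain ⟨c₂, h2⟩ := hs.exists_isTri_of_mem_of_mem hw₂ hp₂ hq₂ hpq
  exact h1.eq_of_cr_eq h2 (by rw [h.cr_eq_neg h1 h₁.symm, h.cr_eq_neg h2 h₂.symm])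

end TropicalPolynomial

/-! ### Lattice points on the boundary: supporting lines, flips and chords. -/

namespace TropicalPolynomial

variable {f : TropicalPolynomial}

theorem IsSmooth.interior_nonempty (hs : f.IsSmooth) : (interior f.newtonPolygon).Nonempty := by
  rw [newtonPolygon, interior_convexHull_nonempty_iff_affineSpan_eq_top, ← affineSpan_convexHull]
  exact hs.1

/-- A supporting line at a lattice point that is not in the interior of the Newton polygon. -/
theorem IsSmooth.exists_support (hs : f.IsSmooth) {q : ℤ × ℤ} (hq : ¬ f.IsInt q) :
    ∃ d : ℝ × ℝ, (∀ a ∈ f.support, pair a d ≤ pair q d) ∧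
      ∀ x ∈ interior f.newtonPolygon, x.1 * d.1 + x.2 * d.2 < pair q d := by
  obtain ⟨φ, hφ⟩ := geometric_hahn_banach_open_point f.convex_newtonPolygon.interior
    isOpen_interior hq
  have hφ' : ∀ x : ℝ × ℝ, φ x = x.1 * φ (1, 0) + x.2 * φ (0, 1) := by
    intro x
    have : x = x.1 • ((1, 0) : ℝ × ℝ) + x.2 • ((0, 1) : ℝ × ℝ) := by ext <;> simp
    conv_lhs => rw [this]
    rw [map_add, map_smul, map_smul, smul_eq_mul, smul_eq_mul]
  have hint : ∀ x ∈ interior f.newtonPolygon, x.1 * φ (1, 0) + x.2 * φ (0, 1) <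
      pair q (φ (1, 0), φ (0, 1)) := by
    intro x hx
    have := hφ x hx
    rwa [hφ', hφ' (latticePoint q)] at this
  refine ⟨(φ (1, 0), φ (0, 1)), fun a ha => ?_, hint⟩
  obtain ⟨x, hx⟩ := hs.interior_nonempty
  by_contra! hlt
  set A := pair a (φ (1, 0), φ (0, 1)) with hA
  set Q := pair q (φ (1, 0), φ (0, 1)) with hQ
  set X := x.1 * φ (1, 0) + x.2 * φ (0, 1) with hX
  have hXQ : X < Q := hint x hx
  have hden : 0 < A - X := by linarith
  -- If `a` were beyond the supporting line, the segment from the interior point `x` to `a` would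
  -- meet that line in an interior point.
  have h := hint _ (f.convex_newtonPolygon.combo_interior_self_mem_interior hx
    (mem_newtonPolygon ha) (a := (A - Q) / (A - X)) (b := (Q - X) / (A - X))
    (div_pos (by linarith) hden) (div_nonneg (by linarith) hden.le) (by field_simp; ring))
  simp only [Prod.fst_add, Prod.snd_add, Prod.smul_fst, Prod.smul_snd, smul_eq_mul,
    latticePoint] at h
  have h2 : (A - Q) / (A - X) * X + (Q - X) / (A - X) * A < Q := by
    refine lt_of_eq_of_lt ?_ h
    rw [hA, hX, pair]
    ring
  have h3 : (A - Q) / (A - X) * X + (Q - X) / (A - X) * A = Q := by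
    field_simp
    ring
  linarith

theorem IsInt.pair_lt {p : ℤ × ℤ} (hp : f.IsInt p) {d : ℝ × ℝ} {k : ℝ}
    (h : ∀ x ∈ interior f.newtonPolygon, x.1 * d.1 + x.2 * d.2 < k) : pair p d < k :=
  h _ hp

theorem IsInt.midpoint {p q : ℤ × ℤ} (hp : f.IsInt p) (hq : q ∈ f.support) :
    (((p.1 : ℝ) + q.1) / 2, ((p.2 : ℝ) + q.2) / 2) ∈ interior f.newtonPolygon := by
  have := f.convex_newtonPolygon.combo_interior_self_mem_interior hp (mem_newtonPolygon hq)
    (a := 1 / 2) (b := 1 / 2) (by norm_num) (by norm_num) (by norm_num)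
  convert this using 1
  ext <;> simp [latticePoint] <;> ring

/-- An edge of the subdivision with midpoint in the interior of the Newton polygon lies in a second
triangle. -/
theorem IsSmooth.exists_neighbor (hs : f.IsSmooth) {w : ℝ × ℝ} {p q c : ℤ × ℤ}
    (h : IsTri f w p q c)
    (hm : (((p.1 : ℝ) + q.1) / 2, ((p.2 : ℝ) + q.2) / 2) ∈ interior f.newtonPolygon) :
    ∃ w' c', IsTri f w' p q c' ∧ w' ≠ w := by
  -- A short segment from the midpoint of `p, q`, pointing away from `c`.
  obtain ⟨w', hw', hmem, ε, hε, hmem'⟩ := exists_germ hs hm (-((c.1 : ℝ) - p.1), -((c.2 : ℝ) - p.2))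
  have hp : p ∈ f.active w' := hs.mem_active_of_combo hw' hmem h.mem₁ h.mem₂ h.mem₂
    (r := 1 / 2) (s := 1 / 2) (t := 0) (by norm_num) (by norm_num) le_rfl (by norm_num)
    (by ring) (by ring)
  have hq : q ∈ f.active w' := hs.mem_active_of_combo hw' hmem h.mem₂ h.mem₁ h.mem₁
    (r := 1 / 2) (s := 1 / 2) (t := 0) (by norm_num) (by norm_num) le_rfl (by norm_num)
    (by ring) (by ring)
  obtain ⟨c', h'⟩ := hs.exists_isTri_of_mem_of_mem hw' hp hq h.ne₁₂
  refine ⟨w', c', h', ?_⟩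
  rintro rfl
  have h1 := hmem' _ _ _ h.rotate.rotate
  have h2 : (cr (q - p) (c - p) : ℝ) * cr (q - p) (c - p) = 1 := h.cr_sq
  have h3 : (cr (q - p) (c - p) : ℝ) = (q.1 - p.1 : ℝ) * (c.2 - p.2) - (q.2 - p.2) * (c.1 - p.1) := by
    simp [cr]
  rw [bary, cr_sub_rotate q c p, cr_sub_rotate p q c] at h1
  simp only [Prod.fst_add, Prod.snd_add, Prod.smul_fst, Prod.smul_snd, smul_eq_mul] at h1
  set D := (cr (q - p) (c - p) : ℝ)
  have : D * ((p.1 - ((p.1 + q.1) / 2 + ε * -(c.1 - p.1))) * (q.2 - ((p.2 + q.2) / 2 + ε * -(c.2 - p.2)))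
    - (p.2 - ((p.2 + q.2) / 2 + ε * -(c.2 - p.2))) * (q.1 - ((p.1 + q.1) / 2 + ε * -(c.1 - p.1))))
      = -ε := by
    linear_combination (-ε) * h2 + ε * D * h3
  linarith

theorem exists_combo {u v x : ℤ × ℤ} (h : cr u v = 1 ∨ cr u v = -1) :
    x.1 = cr u v * cr x v * u.1 + cr u v * cr u x * v.1 ∧
    x.2 = cr u v * cr x v * u.2 + cr u v * cr u x * v.2 := by
  have h2 : cr u v * cr u v = 1 := by rcases h with h | h <;> rw [h] <;> norm_num
  have h3 : cr u v = u.1 * v.2 - u.2 * v.1 := rfl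
  generalize cr u v = D at *
  simp only [cr]
  constructor
  · linear_combination (-x.1) * h2 + D * x.1 * h3
  · linear_combination (-x.2) * h2 + D * x.2 * h3

/-- The triangle opposite to an interior lattice point across an edge with no interior lattice
points completes a parallelogram. -/
theorem IsSmooth.eq_of_flip (hs : f.IsSmooth) {w w' : ℝ × ℝ} {p q q' c : ℤ × ℤ}
    (h : IsTri f w p q q') (h' : IsTri f w' q q' c) (hne : w ≠ w') (hp : f.IsInt p)
    (hq : ¬ f.IsInt q) (hq' : ¬ f.IsInt q') : c = q + q' - p := by
  obtain ⟨e1, e2⟩ := exists_combo (x := c - p) h.cr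
  have hopp := h.rotate.cr_eq_neg h' hne
  set α := cr (q - p) (q' - p) * cr (c - p) (q' - p) with hα
  set β := cr (q - p) (q' - p) * cr (q - p) (c - p) with hβ
  -- Both triangles have area 1/2, on opposite sides of `q, q'`: `c` is on the parallel to that edge
  -- at the same distance as `p`.
  have hsum : α + β = 2 := by
    have h2 : cr (q - p) (q' - p) * cr (q - p) (q' - p) = 1 := by
      rcases h.cr with h | h <;> rw [h] <;> norm_num
    rw [cr_sub_rotate p q q'] at hopp
    have h3 : cr (q' - q) (c - q) = cr (q - p) (q' - p) - cr (c - p) (q' - p) - cr (q - p) (c - p) := by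
      simp only [cr, Prod.fst_sub, Prod.snd_sub]; ring
    rw [h3] at hopp
    generalize cr (q - p) (q' - p) = D at *
    rw [hα, hβ]
    linear_combination 2 * h2 - D * hopp
  have e1' : (c.1 - p.1 : ℝ) = α * (q.1 - p.1) + β * (q'.1 - p.1) := by
    simp only [Prod.fst_sub] at e1; exact_mod_cast e1
  have e2' : (c.2 - p.2 : ℝ) = α * (q.2 - p.2) + β * (q'.2 - p.2) := by
    simp only [Prod.snd_sub] at e2; exact_mod_cast e2
  have hpair : ∀ d : ℝ × ℝ, pair c d - pair p d =
      α * (pair q d - pair p d) + β * (pair q' d - pair p d) := by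
    intro d
    simp only [pair]
    linear_combination d.1 * e1' + d.2 * e2'
  have hsum' : (α + β : ℝ) = 2 := by exact_mod_cast hsum
  have hcs := active_subset h'.mem₃
  -- With `β ≤ 0`, hence `α ≥ 2`, the exponent `c` would be beyond the supporting line at `q`.
  have hβ1 : 1 ≤ β := by
    by_contra! hlt
    have hle : (β : ℝ) ≤ 0 := by exact_mod_cast Int.lt_add_one_iff.1 hlt
    obtain ⟨d, hd, hint⟩ := hs.exists_support hq
    have h1 := hp.pair_lt hint
    have h2 := hd _ (active_subset h.mem₃)
    have h3 := hd _ hcs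
    have h4 := hpair d
    nlinarith
  have hα1 : 1 ≤ α := by
    by_contra! hlt
    have hle : (α : ℝ) ≤ 0 := by exact_mod_cast Int.lt_add_one_iff.1 hlt
    obtain ⟨d, hd, hint⟩ := hs.exists_support hq'
    have h1 := hp.pair_lt hint
    have h2 := hd _ (active_subset h.mem₂)
    have h3 := hd _ hcs
    have h4 := hpair d
    nlinarith
  have hα' : α = 1 := by omega
  have hβ' : β = 1 := by omega
  rw [hα', hβ'] at e1 e2
  simp only [Prod.fst_sub, Prod.snd_sub] at e1 e2
  ext
  · simp only [Prod.fst_add, Prod.fst_sub]; linarith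
  · simp only [Prod.snd_add, Prod.snd_sub]; linarith

/-- If the cone over an edge without interior lattice points contains an interior lattice point,
then the parallelogram over the edge does. -/
theorem IsSmooth.isInt_of_cone (hs : f.IsSmooth) {w : ℝ × ℝ} {p q q' a : ℤ × ℤ}
    (h : IsTri f w p q q') (hp : f.IsInt p) (hq : ¬ f.IsInt q) (hq' : ¬ f.IsInt q')
    (ha : f.IsInt a) (hap : a ≠ p) {α β : ℤ} (hα : 0 ≤ α) (hβ : 0 ≤ β)
    (e1 : a.1 - p.1 = α * (q.1 - p.1) + β * (q'.1 - p.1))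
    (e2 : a.2 - p.2 = α * (q.2 - p.2) + β * (q'.2 - p.2)) : f.IsInt (q + q' - p) := by
  have e1' : (a.1 - p.1 : ℝ) = α * (q.1 - p.1) + β * (q'.1 - p.1) := by exact_mod_cast e1
  have e2' : (a.2 - p.2 : ℝ) = α * (q.2 - p.2) + β * (q'.2 - p.2) := by exact_mod_cast e2
  have hpair : ∀ d : ℝ × ℝ, pair a d - pair p d =
      α * (pair q d - pair p d) + β * (pair q' d - pair p d) := by
    intro d
    simp only [pair]
    linear_combination d.1 * e1' + d.2 * e2'
  have h0 : α ≠ 0 ∨ β ≠ 0 := by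
    by_contra! h0
    rw [h0.1, h0.2] at e1 e2
    exact hap (Prod.ext (by linarith) (by linarith))
  -- With `β = 0`, the interior point `a` would be on the ray from `p` through the boundary point
  -- `q`, at `q` or beyond.
  have hβ1 : 1 ≤ β := by
    by_contra! hlt
    have hβ0 : β = 0 := by omega
    have hα1 : (1 : ℝ) ≤ α := by exact_mod_cast (show (1 : ℤ) ≤ α by omega)
    obtain ⟨d, hd, hint⟩ := hs.exists_support hq
    have h1 := hp.pair_lt hint
    have h2 := ha.pair_lt hint
    have h4 := hpair d
    rw [hβ0, Int.cast_zero] at h4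
    nlinarith
  have hα1 : 1 ≤ α := by
    by_contra! hlt
    have hα0 : α = 0 := by omega
    have hβ1 : (1 : ℝ) ≤ β := by exact_mod_cast (show (1 : ℤ) ≤ β by omega)
    obtain ⟨d, hd, hint⟩ := hs.exists_support hq'
    have h1 := hp.pair_lt hint
    have h2 := ha.pair_lt hint
    have h4 := hpair d
    rw [hα0, Int.cast_zero] at h4
    nlinarith
  -- A functional supporting the polygon at the fourth corner of the parallelogram does not decrease
  -- along `q - p` or `q' - p`. As `α` and `β` are at least 1, its value at `a` would reach the
  -- maximum.
  by_contra hcon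
  obtain ⟨d, hd, hint⟩ := hs.exists_support hcon
  have h1 := hp.pair_lt hint
  have h2 := ha.pair_lt hint
  have h3 := hd _ (active_subset h.mem₂)
  have h4 := hd _ (active_subset h.mem₃)
  have h5 := hpair d
  have h6 : pair (q + q' - p) d = pair q d + pair q' d - pair p d := by
    simp only [pair, Prod.fst_add, Prod.snd_add, Prod.fst_sub, Prod.snd_sub]
    push_cast
    ring
  have hα1' : (1 : ℝ) ≤ α := by exact_mod_cast hα1
  have hβ1' : (1 : ℝ) ≤ β := by exact_mod_cast hβ1
  nlinarith

/-- A chord of the Newton polygon between two boundary points that has points of the polygon on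
both sides contains all points of the polygon on its line. -/
theorem IsSmooth.exists_mem_segment (hs : f.IsSmooth) {q q' c c' : ℤ × ℤ} (hqs : q ∈ f.support)
    (hqs' : q' ∈ f.support) (hq : ¬ f.IsInt q) (hq' : ¬ f.IsInt q')
    (hc : c ∈ f.support) (hc' : c' ∈ f.support) (hpos : 0 < cr (q' - q) (c - q))
    (hneg : cr (q' - q) (c' - q) < 0) {y : ℝ × ℝ} (hy : y ∈ f.newtonPolygon)
    (hline : ((q'.1 : ℝ) - q.1) * (y.2 - q.2) - (q'.2 - q.2) * (y.1 - q.1) = 0) :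
    ∃ t : ℝ, 0 ≤ t ∧ t ≤ 1 ∧ y.1 = q.1 + t * (q'.1 - q.1) ∧ y.2 = q.2 + t * (q'.2 - q.2) := by
  have hpos' : 0 < ((q'.1 : ℝ) - q.1) * (c.2 - q.2) - (q'.2 - q.2) * (c.1 - q.1) := by
    simp only [cr, Prod.fst_sub, Prod.snd_sub] at hpos; exact_mod_cast hpos
  have hneg' : ((q'.1 : ℝ) - q.1) * (c'.2 - q.2) - (q'.2 - q.2) * (c'.1 - q.1) < 0 := by
    simp only [cr, Prod.fst_sub, Prod.snd_sub] at hneg; exact_mod_cast hneg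
  obtain ⟨x₀, hx₀⟩ := hs.interior_nonempty
  -- a functional that is maximal at a point of the line and constant along it vanishes
  have key : ∀ (d : ℝ × ℝ) (k : ℝ), (∀ a ∈ f.support, pair a d ≤ k) →
      (∀ x ∈ interior f.newtonPolygon, x.1 * d.1 + x.2 * d.2 < k) →
      pair q d = k → pair q' d = k → False := by
    intro d k hle hlt h1 h2
    have h3 := hle c hc
    have h4 := hle c' hc'
    have h5 := hlt x₀ hx₀
    simp only [pair] at h1 h2 h3 h4
    set u1 : ℝ := q'.1 - q.1
    set u2 : ℝ := q'.2 - q.2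
    have hu : u1 * d.1 + u2 * d.2 = 0 := by simp only [u1, u2]; linarith
    set Cp := u1 * (c.2 - q.2) - u2 * (c.1 - q.1) with hCp
    set Cn := u1 * (c'.2 - q.2) - u2 * (c'.1 - q.1) with hCn
    have g1 : (c.1 - q.1) * d.1 + (c.2 - q.2) * d.2 ≤ 0 := by linarith
    have g2 : (c'.1 - q.1) * d.1 + (c'.2 - q.2) * d.2 ≤ 0 := by linarith
    -- multiply by the opposite areas
    have i1 : u1 * ((c.1 - q.1) * d.1 + (c.2 - q.2) * d.2) = d.2 * Cp := by
      rw [hCp]; linear_combination (c.1 - q.1 : ℝ) * hu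
    have i2 : u1 * ((c'.1 - q.1) * d.1 + (c'.2 - q.2) * d.2) = d.2 * Cn := by
      rw [hCn]; linear_combination (c'.1 - q.1 : ℝ) * hu
    have j1 : u2 * ((c.1 - q.1) * d.1 + (c.2 - q.2) * d.2) = -d.1 * Cp := by
      rw [hCp]; linear_combination (c.2 - q.2 : ℝ) * hu
    have j2 : u2 * ((c'.1 - q.1) * d.1 + (c'.2 - q.2) * d.2) = -d.1 * Cn := by
      rw [hCn]; linear_combination (c'.2 - q.2 : ℝ) * hu
    set G1 := (c.1 - q.1) * d.1 + (c.2 - q.2) * d.2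
    set G2 := (c'.1 - q.1) * d.1 + (c'.2 - q.2) * d.2
    have hune : u1 ≠ 0 ∨ u2 ≠ 0 := by
      by_contra! h0
      rw [hCp, h0.1, h0.2] at hpos'
      simp at hpos'
    have hG : G1 * Cn = G2 * Cp := by
      rcases hune with h | h
      · refine mul_left_cancel₀ h ?_
        linear_combination Cn * i1 - Cp * i2
      · refine mul_left_cancel₀ h ?_
        linear_combination Cn * j1 - Cp * j2
    have hG1 : G1 = 0 := by
      by_contra hne
      have h1 : G1 < 0 := lt_of_le_of_ne g1 hne
      have h2 := mul_pos_of_neg_of_neg h1 hneg'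
      have h3 := mul_nonneg_of_nonpos_of_nonpos g2 (neg_nonpos.2 hpos'.le)
      nlinarith
    rw [hG1, mul_zero] at i1 j1
    have d2 : d.2 = 0 := (mul_eq_zero.1 i1.symm).resolve_right hpos'.ne'
    have d1 : d.1 = 0 := neg_eq_zero.1 ((mul_eq_zero.1 j1.symm).resolve_right hpos'.ne')
    rw [d1, d2] at h5 h1
    linarith
  have hu : 0 < ((q'.1 : ℝ) - q.1) ^ 2 + ((q'.2 : ℝ) - q.2) ^ 2 := by
    by_contra! hle
    have h1 : ((q'.1 : ℝ) - q.1) = 0 := by nlinarith [sq_nonneg ((q'.1 : ℝ) - q.1), sq_nonneg ((q'.2 : ℝ) - q.2)]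
    have h2 : ((q'.2 : ℝ) - q.2) = 0 := by nlinarith [sq_nonneg ((q'.1 : ℝ) - q.1), sq_nonneg ((q'.2 : ℝ) - q.2)]
    rw [h1, h2] at hpos'
    simp at hpos'
  obtain ⟨t, ht1, ht2⟩ : ∃ t : ℝ, y.1 = q.1 + t * (q'.1 - q.1) ∧ y.2 = q.2 + t * (q'.2 - q.2) := by
    refine ⟨((y.1 - q.1) * (q'.1 - q.1) + (y.2 - q.2) * (q'.2 - q.2)) /
      (((q'.1 : ℝ) - q.1) ^ 2 + ((q'.2 : ℝ) - q.2) ^ 2), ?_, ?_⟩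
    · field_simp
      linear_combination (-((q'.2 : ℝ) - q.2)) * hline
    · field_simp
      linear_combination ((q'.1 : ℝ) - q.1) * hline
  have hyle : ∀ (d : ℝ × ℝ) (k : ℝ), (∀ a ∈ f.support, pair a d ≤ k) →
      y.1 * d.1 + y.2 * d.2 ≤ k := by
    intro d k hle
    have := le_of_mem_newtonPolygon (d := -d) (k := -k) (fun a ha => by
      have := hle a ha
      simp only [pair, Prod.fst_neg, Prod.snd_neg] at this ⊢
      linarith) hy
    simp only [Prod.fst_neg, Prod.snd_neg] at this
    linarith
  have hyd : ∀ d : ℝ × ℝ, y.1 * d.1 + y.2 * d.2 = pair q d + t * (pair q' d - pair q d) := by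
    intro d
    rw [ht1, ht2, pair, pair]
    ring
  refine ⟨t, ?_, ?_, ht1, ht2⟩
  -- If `t < 0`, then `q` lies between `y` and `q'`, so a functional that is maximal at `q` is
  -- constant along the chord, contrary to `key`.
  · by_contra! hlt
    obtain ⟨d, hd, hint⟩ := hs.exists_support hq
    have h1 := hyle d _ hd
    have h2 := hd q' hqs'
    rw [hyd] at h1
    refine key d _ hd hint rfl (le_antisymm h2 ?_)
    nlinarith
  · by_contra! hlt
    obtain ⟨d, hd, hint⟩ := hs.exists_support hq'
    have h1 := hyle d _ hd
    have h2 := hd q hqs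
    rw [hyd] at h1
    refine key d _ hd hint (le_antisymm h2 ?_) rfl
    nlinarith

end TropicalPolynomial

/-! ### Edges that cut the polygon, and the ring of triangles around an interior lattice point. -/

namespace TropicalPolynomial

variable {f : TropicalPolynomial}

/-- An exponent in the support on the line of an edge without interior lattice points, with
triangles on both sides, is an end of that edge. -/
theorem IsSmooth.eq_of_mem_line (hs : f.IsSmooth) {w w' : ℝ × ℝ} {q q' c c' a : ℤ × ℤ}
    (h : IsTri f w q q' c) (h' : IsTri f w' q q' c') (hpos : 0 < cr (q' - q) (c - q))
    (hneg : cr (q' - q) (c' - q) < 0) (hq : ¬ f.IsInt q) (hq' : ¬ f.IsInt q') (ha : a ∈ f.support)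
    (hline : cr (q' - q) (a - q) = 0) : a = q ∨ a = q' := by
  obtain ⟨t, ht0, ht1, e1, e2⟩ := hs.exists_mem_segment (active_subset h.mem₁)
    (active_subset h.mem₂) hq hq' (active_subset h.mem₃) (active_subset h'.mem₃) hpos hneg
    (mem_newtonPolygon ha) (by
      simp only [cr, Prod.fst_sub, Prod.snd_sub] at hline
      simp only [latticePoint]
      exact_mod_cast hline)
  simp only [latticePoint] at e1 e2
  have hD : cr (q' - q) (c - q) = 1 := by have := h.cr; omega
  have hD' : ((q'.1 : ℝ) - q.1) * (c.2 - q.2) - (q'.2 - q.2) * (c.1 - q.1) = 1 := by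
    simp only [cr, Prod.fst_sub, Prod.snd_sub] at hD; exact_mod_cast hD
  -- Unimodularity makes the position on the segment an integer.
  have ht : t = ((cr (a - q) (c - q) : ℤ) : ℝ) := by
    simp only [cr, Prod.fst_sub, Prod.snd_sub]
    push_cast
    rw [e1, e2]
    linear_combination (-t) * hD'
  generalize cr (a - q) (c - q) = k at ht
  subst ht
  norm_cast at ht0 ht1 e1 e2
  have : k = 0 ∨ k = 1 := by omega
  rcases this with rfl | rfl
  · left; ext <;> linarith
  · right; ext <;> linarith

/-- No triangle has corners on both sides of the line through an edge without interior lattice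
points. -/
theorem IsSmooth.not_cross (hs : f.IsSmooth) {w w' v : ℝ × ℝ} {q q' c c' a b : ℤ × ℤ}
    (h : IsTri f w q q' c) (h' : IsTri f w' q q' c') (hpos : 0 < cr (q' - q) (c - q))
    (hneg : cr (q' - q) (c' - q) < 0) (hq : ¬ f.IsInt q) (hq' : ¬ f.IsInt q')
    (ha : a ∈ f.active v) (hb : b ∈ f.active v)
    (hapos : 0 < cr (q' - q) (a - q)) (hbneg : cr (q' - q) (b - q) < 0) : False := by
  -- The distances of `a` and `b` from the line, up to a common factor; they give the weights of the
  -- point where the segment between `a` and `b` meets the line.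
  set A : ℝ := (cr (q' - q) (a - q) : ℝ) with hA
  set B : ℝ := -(cr (q' - q) (b - q) : ℝ) with hB
  have hA0 : 0 < A := by rw [hA]; exact_mod_cast hapos
  have hB0 : 0 < B := by rw [hB, neg_pos]; exact_mod_cast hbneg
  have hA' : A = ((q'.1 : ℝ) - q.1) * (a.2 - q.2) - (q'.2 - q.2) * (a.1 - q.1) := by
    rw [hA]; simp [cr]
  have hB' : B = -(((q'.1 : ℝ) - q.1) * (b.2 - q.2) - (q'.2 - q.2) * (b.1 - q.1)) := by
    rw [hB]; simp [cr]
  clear_value A B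
  have hs0 : 0 < A + B := by linarith
  have hr : 0 < B / (A + B) := by positivity
  have hr' : 0 < A / (A + B) := by positivity
  have hrr : B / (A + B) + A / (A + B) = 1 := by field_simp; ring
  set r := B / (A + B)
  set r' := A / (A + B)
  have hy : (r * a.1 + r' * b.1, r * a.2 + r' * b.2) ∈ f.newtonPolygon := by
    have := f.convex_newtonPolygon (mem_newtonPolygon (active_subset ha))
      (mem_newtonPolygon (active_subset hb)) hr.le hr'.le hrr
    convert this using 1
    ext <;> simp [latticePoint]
  obtain ⟨t, ht0, ht1, e1, e2⟩ := hs.exists_mem_segment (active_subset h.mem₁)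
    (active_subset h.mem₂) hq hq' (active_subset h.mem₃) (active_subset h'.mem₃) hpos hneg hy (by
      have e : r * A = r' * B := by simp only [r, r']; ring
      rw [hA', hB'] at e
      simp only
      linear_combination e + (-(q'.1 - q.1 : ℝ) * q.2 + (q'.2 - q.2) * q.1) * (-hrr))
  simp only at e1 e2
  -- both ends of the crossing edge are corners of the triangle at `w`
  obtain ⟨m, n, k, hlin⟩ := exists_slack_affine (f := f) w v
  have s1 := hlin a
  have s2 := hlin b
  have s3 := hlin q
  have s4 := hlin q'
  rw [(mem_active.1 ha).2] at s1
  rw [(mem_active.1 hb).2] at s2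
  rw [(mem_active.1 h.mem₁).2] at s3
  rw [(mem_active.1 h.mem₂).2] at s4
  have key : r * f.slack a w + r' * f.slack b w +
      ((1 - t) * f.slack q v + t * f.slack q' v) = 0 := by
    rw [s3, s4]
    linear_combination (-r) * s1 - r' * s2 - m * e1 - n * e2 - k * hrr
  have p1 := slack_nonneg (active_subset ha) w
  have p2 := slack_nonneg (active_subset hb) w
  have p3 := mul_nonneg (sub_nonneg.2 ht1) (slack_nonneg (active_subset h.mem₁) v)
  have p4 := mul_nonneg ht0 (slack_nonneg (active_subset h.mem₂) v)
  have haw : a ∈ f.active w := by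
    refine mem_active.2 ⟨active_subset ha, ?_⟩
    have h5 := mul_nonneg hr'.le p2
    have h6 := mul_nonneg hr.le p1
    have : r * f.slack a w = 0 := by linarith
    exact (mul_eq_zero.1 this).resolve_left hr.ne'
  have hbw : b ∈ f.active w := by
    refine mem_active.2 ⟨active_subset hb, ?_⟩
    have h5 := mul_nonneg hr'.le p2
    have h6 := mul_nonneg hr.le p1
    have : r' * f.slack b w = 0 := by linarith
    exact (mul_eq_zero.1 this).resolve_left hr'.ne'
  have e3 : cr (q' - q) (q - q) = 0 := by simp [cr]
  have e4 : cr (q' - q) (q' - q) = 0 := by simp only [cr]; ring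
  rcases (h.mem b).1 hbw with rfl | rfl | rfl
  · omega
  · omega
  · omega

/-- An edge without interior lattice points separates the tropical curve: if two adjacent triangles
lie on different sides, then they share that edge. -/
theorem IsSmooth.separates (hs : f.IsSmooth) {w w' v v' : ℝ × ℝ} {q q' c c' : ℤ × ℤ}
    (h : IsTri f w q q' c) (h' : IsTri f w' q q' c') (hpos : 0 < cr (q' - q) (c - q))
    (hneg : cr (q' - q) (c' - q) < 0) (hq : ¬ f.IsInt q) (hq' : ¬ f.IsInt q')
    (hv : f.IsVertex v) (hv' : f.IsVertex v') (hadj : 2 ≤ (f.active v ∩ f.active v').card)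
    (h₁ : ∃ a ∈ f.active v, 0 < cr (q' - q) (a - q))
    (h₂ : ¬ ∃ a ∈ f.active v', 0 < cr (q' - q) (a - q)) : v = w ∧ v' = w' := by
  obtain ⟨x, hx, hxpos⟩ := h₁
  push Not at h₂
  -- A common corner is not on the left, because of `v'`. If it were off the line, the triangle at
  -- `v` would have corners on both sides.
  have hzero : ∀ a ∈ f.active v ∩ f.active v', a = q ∨ a = q' := by
    intro a ha
    rw [Finset.mem_inter] at ha
    refine hs.eq_of_mem_line h h' hpos hneg hq hq' (active_subset ha.1) ?_
    have h1 := h₂ a ha.2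
    by_contra hne
    exact hs.not_cross h h' hpos hneg hq hq' hx ha.1 hxpos (lt_of_le_of_ne h1 hne)
  have hsub : f.active v ∩ f.active v' ⊆ {q, q'} := by
    intro a ha
    simpa using hzero a ha
  have heq := Finset.eq_of_subset_of_card_le hsub (by rw [Finset.card_pair h.ne₁₂]; exact hadj)
  have hqm : q ∈ f.active v ∩ f.active v' := by rw [heq]; simp
  have hqm' : q' ∈ f.active v ∩ f.active v' := by rw [heq]; simp
  rw [Finset.mem_inter] at hqm hqm'
  obtain ⟨e, he⟩ := hs.exists_isTri_of_mem_of_mem hv hqm.1 hqm'.1 h.ne₁₂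
  obtain ⟨e', he'⟩ := hs.exists_isTri_of_mem_of_mem hv' hqm.2 hqm'.2 h.ne₁₂
  have hcr := h.cr
  have hcr' := h'.cr
  refine ⟨(h.eq_of_cr_eq he ?_).symm, (h'.eq_of_cr_eq he' ?_).symm⟩
  · rcases (he.mem x).1 hx with rfl | rfl | rfl
    · simp [cr] at hxpos
    · exfalso
      simp only [cr] at hxpos
      linarith
    · have := he.cr
      omega
  · have h1 := h₂ e' he'.mem₃
    have := he'.cr
    omega

/-- The triangles at an interior lattice point form a cycle: a nonempty set of them that is closed
under adjacency contains all of them. -/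
theorem IsSmooth.star_induction (hs : f.IsSmooth) {p : ℤ × ℤ} (hp : f.IsInt p)
    {Z : ℝ × ℝ → Prop} (hne : ∃ w, f.IsVertex w ∧ p ∈ f.active w ∧ Z w)
    (hZ : ∀ w w' q, f.IsVertex w → f.IsVertex w' → p ∈ f.active w → p ∈ f.active w' → q ≠ p →
      q ∈ f.active w → q ∈ f.active w' → Z w → Z w')
    {w : ℝ × ℝ} (hw : f.IsVertex w) (hpw : p ∈ f.active w) : Z w := by
  -- The cone over a triangle at `p`, moved to the origin. Finitely many closed cones cover the
  -- punctured plane, which is connected. So if `Z` held for some of the triangles only, a cone with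
  -- `Z` and a cone without it would share a nonzero vector, and then the two triangles would share
  -- an edge at `p`.
  let C : ℝ × ℝ → Set (ℝ × ℝ) := fun w => {x | ∀ a b, IsTri f w p a b →
    0 ≤ (cr (a - p) (b - p) : ℝ) * (x.1 * (b.2 - p.2) - x.2 * (b.1 - p.1))}
  have hC : ∀ w, IsClosed (C w) := by
    intro w
    simp only [C, Set.ofPred_forall]
    refine isClosed_iInter fun a => isClosed_iInter fun b => isClosed_iInter fun _ =>
      isClosed_le continuous_const ?_
    fun_prop
  have hfin : ∀ Y : ℝ × ℝ → Prop, {w | f.IsVertex w ∧ p ∈ f.active w ∧ Y w}.Finite :=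
    fun Y => hs.finite_vertices.subset fun w hw => hw.1
  have hself : ∀ w, f.IsVertex w → p ∈ f.active w → ∃ x ∈ C w, x ≠ 0 := by
    intro w hw hpw
    obtain ⟨a, b, h⟩ := hs.exists_isTri_of_mem hw hpw
    refine ⟨((a.1 : ℝ) - p.1 + (b.1 - p.1), (a.2 : ℝ) - p.2 + (b.2 - p.2)), fun a' b' h' => ?_, ?_⟩
    · have e1 : ∀ a b : ℤ × ℤ, (cr (a - p) (b - p) : ℝ) =
          (a.1 - p.1 : ℝ) * (b.2 - p.2) - (a.2 - p.2) * (b.1 - p.1) := by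
        intro a b; simp [cr]
      have key : (cr (a' - p) (b' - p) : ℝ) * (((a.1 : ℝ) - p.1 + (b.1 - p.1)) * (b'.2 - p.2) -
          ((a.2 : ℝ) - p.2 + (b.2 - p.2)) * (b'.1 - p.1)) =
          cr (a' - p) (b' - p) * cr (a' - p) (b' - p) := by
        rcases (h.mem a').1 h'.mem₂ with rfl | rfl | rfl
        · exact absurd rfl h'.ne₁₂
        · rcases (h.mem b').1 h'.mem₃ with rfl | rfl | rfl
          · exact absurd rfl h'.ne₁₃
          · exact absurd rfl h'.ne₂₃
          · rw [e1]; ring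
        · rcases (h.mem b').1 h'.mem₃ with rfl | rfl | rfl
          · exact absurd rfl h'.ne₁₃
          · rw [e1]; ring
          · exact absurd rfl h'.ne₂₃
      simp only
      rw [key, h'.cr_sq]
      exact zero_le_one
    · intro h0
      rw [Prod.mk_eq_zero] at h0
      have h1 : a.1 - p.1 + (b.1 - p.1) = 0 := by exact_mod_cast h0.1
      have h2 : a.2 - p.2 + (b.2 - p.2) = 0 := by exact_mod_cast h0.2
      apply h.cr_ne_zero
      simp only [cr, Prod.fst_sub, Prod.snd_sub]
      linear_combination (b.2 - p.2) * h1 - (b.1 - p.1) * h2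
  have hcombo : ∀ w x, x ∈ C w → ∀ a b, IsTri f w p a b → ∃ r s : ℝ, 0 ≤ r ∧ 0 ≤ s ∧
      x.1 = r * (a.1 - p.1) + s * (b.1 - p.1) ∧ x.2 = r * (a.2 - p.2) + s * (b.2 - p.2) := by
    intro w x hx a b h
    have h1 := hx a b h
    have h2 := hx b a h.swap
    have h3 := h.cr_sq
    have h4 : (cr (a - p) (b - p) : ℝ) =
          (a.1 - p.1 : ℝ) * (b.2 - p.2) - (a.2 - p.2) * (b.1 - p.1) := by
      simp [cr]
    rw [cr_swap (a - p), Int.cast_neg] at h2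
    refine ⟨_, _, h1, h2, ?_, ?_⟩
    · linear_combination (-x.1) * h3 + cr (a - p) (b - p) * x.1 * h4
    · linear_combination (-x.2) * h3 + cr (a - p) (b - p) * x.2 * h4
  by_contra hZw
  have hrank : 1 < Module.rank ℝ (ℝ × ℝ) := by
    rw [rank_prod', Module.rank_self, one_add_one_eq_two]
    exact Cardinal.one_lt_two
  have hconn := (isConnected_compl_singleton_of_one_lt_rank hrank (0 : ℝ × ℝ)).isPreconnected
  rw [isPreconnected_closed_iff] at hconn
  obtain ⟨x, hx0, hx1, hx2⟩ := hconn (⋃ v ∈ {v | f.IsVertex v ∧ p ∈ f.active v ∧ Z v}, C v)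
    (⋃ v ∈ {v | f.IsVertex v ∧ p ∈ f.active v ∧ ¬ Z v}, C v)
    ((hfin _).isClosed_biUnion fun v _ => hC v) ((hfin _).isClosed_biUnion fun v _ => hC v)
    (by
      intro x hx
      obtain ⟨v, hv, hpv, ε, hε, hmem⟩ := hs.exists_germ hp x
      have hpv' := hs.mem_active_of_mem_cell hv hpv
      have hxC : x ∈ C v := by
        intro a b h
        have h1 := hmem _ _ _ h.rotate
        rw [bary, cr_sub_rotate p a b] at h1
        simp only [latticePoint, Prod.fst_add, Prod.snd_add, Prod.smul_fst, Prod.smul_snd,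
          smul_eq_mul] at h1
        have h2 : 0 ≤ ε * ((cr (a - p) (b - p) : ℝ) * (x.1 * (b.2 - p.2) - x.2 * (b.1 - p.1))) := by
          refine h1.trans_eq ?_
          ring
        exact nonneg_of_mul_nonneg_right h2 hε
      by_cases hz : Z v
      · left
        simp only [Set.mem_iUnion]
        exact ⟨v, ⟨hv, hpv', hz⟩, hxC⟩
      · right
        simp only [Set.mem_iUnion]
        exact ⟨v, ⟨hv, hpv', hz⟩, hxC⟩)
    (by
      obtain ⟨v, hv, hpv, hz⟩ := hne
      obtain ⟨x, hx, hx0⟩ := hself v hv hpv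
      refine ⟨x, hx0, ?_⟩
      simp only [Set.mem_iUnion]
      exact ⟨v, ⟨hv, hpv, hz⟩, hx⟩)
    (by
      obtain ⟨x, hx, hx0⟩ := hself w hw hpw
      refine ⟨x, hx0, ?_⟩
      simp only [Set.mem_iUnion]
      exact ⟨w, ⟨hw, hpw, hZw⟩, hx⟩)
  simp only [Set.mem_iUnion] at hx1 hx2
  obtain ⟨v, ⟨hv, hpv, hz⟩, hxv⟩ := hx1
  obtain ⟨v', ⟨hv', hpv', hz'⟩, hxv'⟩ := hx2
  obtain ⟨a, b, h⟩ := hs.exists_isTri_of_mem hv hpv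
  obtain ⟨a', b', h'⟩ := hs.exists_isTri_of_mem hv' hpv'
  obtain ⟨r, s, hr, hs', e1, e2⟩ := hcombo v x hxv a b h
  obtain ⟨r', s', hr', hs'', e1', e2'⟩ := hcombo v' x hxv' a' b' h'
  by_cases hr0 : r = 0
  · by_cases hs0 : s = 0
    · apply hx0
      rw [hr0, hs0] at e1 e2
      exact Prod.ext (by simpa using e1) (by simpa using e2)
    · have hb : b ∈ f.active v' := mem_active_of_cone h.mem₁ h.mem₃ h.mem₂ h'.mem₁ h'.mem₂ h'.mem₃
        (hs'.lt_of_ne' hs0) hr hr' hs'' (by linarith) (by linarith)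
      exact hz' (hZ v v' b hv hv' hpv hpv' h.ne₁₃.symm h.mem₃ hb hz)
  · have ha : a ∈ f.active v' := mem_active_of_cone h.mem₁ h.mem₂ h.mem₃ h'.mem₁ h'.mem₂ h'.mem₃
      (hr.lt_of_ne' hr0) hs' hr' hs'' (by linarith) (by linarith)
    exact hz' (hZ v v' a hv hv' hpv hpv' h.ne₁₂.symm h.mem₂ ha hz)

/-- The cones over the triangles at an interior lattice point cover all directions. -/
theorem IsSmooth.exists_cone (hs : f.IsSmooth) {p : ℤ × ℤ} (hp : f.IsInt p) (x : ℤ × ℤ) :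
    ∃ w a b, IsTri f w p a b ∧ ∃ α β : ℤ, 0 ≤ α ∧ 0 ≤ β ∧
      x.1 = α * (a.1 - p.1) + β * (b.1 - p.1) ∧ x.2 = α * (a.2 - p.2) + β * (b.2 - p.2) := by
  -- The triangle into which `p` moves when it is shifted slightly in the direction `x`.
  obtain ⟨v, hv, hpv, ε, hε, hmem⟩ := hs.exists_germ hp (latticePoint x)
  obtain ⟨a, b, h⟩ := hs.exists_isTri_of_mem hv (hs.mem_active_of_mem_cell hv hpv)
  have hsign : ∀ a b, IsTri f v p a b → 0 ≤ cr (a - p) (b - p) * cr x (b - p) := by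
    intro a b h
    have h1 := hmem _ _ _ h.rotate
    rw [bary, cr_sub_rotate p a b] at h1
    simp only [latticePoint, Prod.fst_add, Prod.snd_add, Prod.smul_fst, Prod.smul_snd,
      smul_eq_mul] at h1
    have h2 : 0 ≤ ε * ((cr (a - p) (b - p) : ℝ) * (x.1 * (b.2 - p.2) - x.2 * (b.1 - p.1))) := by
      refine h1.trans_eq ?_
      ring
    have h3 := nonneg_of_mul_nonneg_right h2 hε
    simp only [cr, Prod.fst_sub, Prod.snd_sub] at h3 ⊢
    exact_mod_cast h3
  obtain ⟨e1, e2⟩ := exists_combo (x := x) h.cr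
  refine ⟨v, a, b, h, _, _, hsign a b h, ?_, e1, e2⟩
  have := hsign b a h.swap
  rwa [cr_swap (a - p), cr_swap (a - p) x, neg_mul_neg] at this

end TropicalPolynomial

/-! ### Arcs -/

section Arcs

variable {W : Type} {K : SimpleGraph W}

theorem isBranch_of_adj {x a b c : W} (ha : K.Adj x a) (hb : K.Adj x b) (hc : K.Adj x c)
    (hab : a ≠ b) (hac : a ≠ c) (hbc : b ≠ c) : IsBranch K x := by
  have h : ({a, b, c} : Set W).encard = 3 := Set.encard_eq_three.2 ⟨a, b, c, hab, hac, hbc, rfl⟩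
  rw [IsBranch, ← h]
  apply Set.encard_le_encard
  rintro y (rfl | rfl | rfl)
  · exact ha
  · exact hb
  · exact hc

/-- A path through a vertex that is not a branch vertex can continue in only one way; this makes
arcs rigid. -/
theorem eq_of_not_isBranch {x a b c : W} (h : ¬ IsBranch K x) (ha : K.Adj x a) (hb : K.Adj x b)
    (hc : K.Adj x c) (hab : a ≠ b) (hac : a ≠ c) : b = c := by
  by_contra hbc
  exact h (isBranch_of_adj ha hb hc hab hac hbc)

namespace OrientedArc

/-- The `i`-th vertex of an arc. -/
def vertAt (A : OrientedArc K) (i : ℕ) : W := A.walk.getVert i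

/-- The number of edges of an arc. -/
def size (A : OrientedArc K) : ℕ := A.walk.length

variable (A B : OrientedArc K)

theorem vertAt_zero : A.vertAt 0 = A.fst := A.walk.getVert_zero

theorem vertAt_size : A.vertAt A.size = A.snd := A.walk.getVert_length

theorem size_pos : 0 < A.size := by
  rw [size, Nat.pos_iff_ne_zero, Ne, SimpleGraph.Walk.length_eq_zero_iff]
  exact A.not_nil

theorem adj {i : ℕ} (h : i < A.size) : K.Adj (A.vertAt i) (A.vertAt (i + 1)) :=
  A.walk.adj_getVert_succ h

theorem not_isBranch {i : ℕ} (h0 : 0 < i) (h : i < A.size) : ¬ IsBranch K (A.vertAt i) := by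
  apply A.interior
  have hlen := A.walk.length_support
  unfold size at h
  rw [List.mem_iff_getElem]
  refine ⟨i - 1, by simp; omega, ?_⟩
  rw [List.getElem_dropLast, List.getElem_tail, SimpleGraph.Walk.support_getElem_eq_getVert]
  have : i - 1 + 1 = i := by omega
  rw [this]
  rfl

theorem isBranch_zero : IsBranch K (A.vertAt 0) := by
  rw [vertAt_zero]
  exact A.branch_fst

theorem isBranch_size : IsBranch K (A.vertAt A.size) := by
  rw [vertAt_size]
  exact A.branch_snd

theorem edge_injective {i j : ℕ} (hi : i < A.size) (hj : j < A.size)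
    (h : s(A.vertAt i, A.vertAt (i + 1)) = s(A.vertAt j, A.vertAt (j + 1))) : i = j := by
  have hn := A.isTrail.edges_nodup
  have hlen := A.walk.length_edges
  unfold size at hi hj
  have key : ∀ k (hk : k < A.walk.edges.length),
      A.walk.edges[k] = s(A.vertAt k, A.vertAt (k + 1)) := by
    intro k hk
    rw [SimpleGraph.Walk.getElem_edges_eq_edge_getElem_darts,
      SimpleGraph.Walk.darts_getElem_eq_getVert]
    rfl
  refine (hn.getElem_inj_iff (hi := by omega) (hj := by omega)).1 ?_
  rw [key, key, h]

theorem vertAt_add_two {i : ℕ} (h : i + 2 ≤ A.size) : A.vertAt i ≠ A.vertAt (i + 2) := by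
  intro he
  have := A.edge_injective (i := i) (j := i + 1) (by omega) (by omega) (by
    rw [show i + 1 + 1 = i + 2 from rfl, ← he, Sym2.eq_swap])
  omega

@[simp] theorem size_reverse : A.reverse.size = A.size := A.walk.length_reverse

theorem vertAt_reverse (i : ℕ) : A.reverse.vertAt i = A.vertAt (A.size - i) :=
  A.walk.getVert_reverse i

@[simp] theorem fst_reverse : A.reverse.fst = A.snd := rfl

@[simp] theorem snd_reverse : A.reverse.snd = A.fst := rfl

@[simp] theorem reverse_reverse : A.reverse.reverse = A := by
  obtain ⟨u, v, w, _, _, _, _, _⟩ := A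
  simp [OrientedArc.reverse]

variable {A B}

theorem ext_vertAt (hs : A.size = B.size) (h : ∀ i ≤ A.size, A.vertAt i = B.vertAt i) : A = B := by
  have h1 : A.fst = B.fst := by rw [← vertAt_zero, ← vertAt_zero]; exact h 0 (Nat.zero_le _)
  have h2 : A.snd = B.snd := by rw [← vertAt_size, ← vertAt_size, ← hs]; exact h _ le_rfl
  obtain ⟨u, v, w, _, _, _, _, _⟩ := A
  obtain ⟨u', v', w', _, _, _, _, _⟩ := B
  obtain rfl : u = u' := h1
  obtain rfl : v = v' := h2
  obtain rfl : w = w' := SimpleGraph.Walk.ext_getVert_le_length hs h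
  rfl

theorem vertAt_eq_of_vertAt_one (h0 : A.fst = B.fst) (h1 : A.vertAt 1 = B.vertAt 1) :
    ∀ i, i ≤ A.size → i ≤ B.size → A.vertAt i = B.vertAt i ∧
      (i + 1 ≤ A.size → i + 1 ≤ B.size → A.vertAt (i + 1) = B.vertAt (i + 1)) := by
  intro i
  induction i with
  | zero => exact fun _ _ => ⟨by rw [vertAt_zero, vertAt_zero, h0], fun _ _ => h1⟩
  | succ i ih =>
    intro hA hB
    obtain ⟨e1, e2⟩ := ih (by omega) (by omega)
    have e2 := e2 hA hB
    refine ⟨e2, fun hA' hB' => ?_⟩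
    refine eq_of_not_isBranch (A.not_isBranch (Nat.succ_pos i) hA') (A.adj (i := i) hA).symm
      (A.adj hA') ?_ (A.vertAt_add_two hA') ?_
    · rw [e2]; exact B.adj hB'
    · rw [e1]; exact B.vertAt_add_two hB'

/-- An arc is determined by its first edge. -/
theorem eq_of_vertAt_one (h0 : A.fst = B.fst) (h1 : A.vertAt 1 = B.vertAt 1) : A = B := by
  have key := vertAt_eq_of_vertAt_one h0 h1
  have hs : A.size = B.size := by
    -- If one arc were shorter, its end, a branch vertex, would be an inner vertex of the other.
    rcases lt_trichotomy A.size B.size with h | h | h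
    · have := (key A.size le_rfl h.le).1
      exact absurd (this ▸ A.isBranch_size) (B.not_isBranch A.size_pos h)
    · exact h
    · have := (key B.size h.le le_rfl).1
      exact absurd (this ▸ B.isBranch_size) (A.not_isBranch B.size_pos h)
  exact ext_vertAt hs fun i hi => (key i hi (hs ▸ hi)).1

/-- An arc is determined by any of its oriented edges. -/
theorem eq_of_vertAt {i j : ℕ} (hi : i < A.size) (hj : j < B.size)
    (h : A.vertAt i = B.vertAt j) (h' : A.vertAt (i + 1) = B.vertAt (j + 1)) : A = B ∧ i = j := by
  induction i generalizing j with
  | zero =>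
    have hj0 : j = 0 := by
      by_contra h0
      exact B.not_isBranch (Nat.pos_of_ne_zero h0) hj (h ▸ A.isBranch_zero)
    subst hj0
    rw [vertAt_zero, vertAt_zero] at h
    exact ⟨eq_of_vertAt_one h h', rfl⟩
  | succ i ih =>
    have hb := A.not_isBranch (Nat.succ_pos i) hi
    cases j with
    | zero => exact absurd (h ▸ B.isBranch_zero) hb
    | succ j =>
      obtain ⟨h1, h2⟩ := ih (j := j) (by omega) (by omega) (by
        refine eq_of_not_isBranch hb (A.adj hi) (A.adj (Nat.lt_of_succ_lt hi)).symm ?_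
          (A.vertAt_add_two hi).symm ?_
        · rw [h]; exact (B.adj (Nat.lt_of_succ_lt hj)).symm
        · rw [h']; exact (B.vertAt_add_two hj).symm) h
      exact ⟨h1, by rw [h2]⟩

theorem eq_reverse_of_vertAt {i j : ℕ} (hi : i < A.size) (hj : j < B.size)
    (h : A.vertAt i = B.vertAt (j + 1)) (h' : A.vertAt (i + 1) = B.vertAt j) : A = B.reverse := by
  refine (eq_of_vertAt (B := B.reverse) (j := B.size - j - 1) hi ?_ ?_ ?_).1
  · rw [size_reverse]; omega
  · rw [vertAt_reverse, h]; congr 1; omega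
  · rw [vertAt_reverse, h']; congr 1; omega

theorem size_eq_one (h : IsBranch K (A.vertAt 1)) : A.size = 1 := by
  by_contra h1
  have := A.size_pos
  exact A.not_isBranch Nat.one_pos (by omega) h

theorem snd_eq_vertAt_one (h : IsBranch K (A.vertAt 1)) : A.snd = A.vertAt 1 := by
  rw [← vertAt_size, size_eq_one h]

theorem walkLength_eq_sum (len : W → W → ℝ) {u v : W} (p : K.Walk u v) :
    walkLength len p = ∑ i ∈ Finset.range p.length, len (p.getVert i) (p.getVert (i + 1)) := by
  induction p with
  | nil => simp [walkLength]
  | cons h p ih =>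
    rw [SimpleGraph.Walk.length_cons, Finset.sum_range_succ']
    simp only [SimpleGraph.Walk.getVert_cons_succ, SimpleGraph.Walk.getVert_zero]
    rw [← ih]
    simp [walkLength, add_comm]

end OrientedArc

end Arcs

/-! ### The core of the curve and its branch vertices. -/

namespace TropicalPolynomial

variable {f : TropicalPolynomial}

/-- The vertices of the curve that are left when leaves are removed. -/
abbrev CoreVertex (f : TropicalPolynomial) : Type := ↥(coreVertices f.boundedGraph)

/-- What is left of the curve when leaves are removed. -/
abbrev core (f : TropicalPolynomial) : SimpleGraph (CoreVertex f) :=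
  f.boundedGraph.induce (coreVertices f.boundedGraph)

/-- The corners of the triangle dual to a vertex. -/
noncomputable def tri (x : CoreVertex f) : Finset (ℤ × ℤ) := f.active x.1.1

theorem isVertex_core (x : CoreVertex f) : f.IsVertex x.1.1 := x.1.2

theorem coreVertex_ext {x y : CoreVertex f} (h : x.1.1 = y.1.1) : x = y :=
  Subtype.ext (Subtype.ext h)

theorem core_adj {x y : CoreVertex f} : f.core.Adj x y ↔ x ≠ y ∧ 2 ≤ (tri x ∩ tri y).card := by
  change (x.1 ≠ y.1 ∧ _) ↔ _
  rw [Ne, Ne, Subtype.ext_iff (a1 := x)]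
  rfl

theorem core_adj_of_mem {x y : CoreVertex f} (hne : x ≠ y) {p q : ℤ × ℤ} (hpq : p ≠ q)
    (hp : p ∈ tri x) (hq : q ∈ tri x) (hp' : p ∈ tri y) (hq' : q ∈ tri y) : f.core.Adj x y :=
  core_adj.2 ⟨hne, Finset.one_lt_card.2
    ⟨p, Finset.mem_inter.2 ⟨hp, hp'⟩, q, Finset.mem_inter.2 ⟨hq, hq'⟩, hpq⟩⟩

theorem IsSmooth.card_tri (hs : f.IsSmooth) (x : CoreVertex f) : (tri x).card = 3 := by
  obtain ⟨a, b, c, h⟩ := hs.exists_isTri (isVertex_core x)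
  rw [Finset.card_eq_three]
  refine ⟨a, b, c, h.ne₁₂, h.ne₁₃, h.ne₂₃, ?_⟩
  ext z
  rw [tri, h.mem]
  simp

theorem IsSmooth.eq_of_tri_subset (hs : f.IsSmooth) {x y : CoreVertex f} (h : tri x ⊆ tri y) :
    x = y := by
  obtain ⟨a, b, c, ht⟩ := hs.exists_isTri (isVertex_core x)
  exact coreVertex_ext (ht.eq_of_mem (h ht.mem₁) (h ht.mem₂) (h ht.mem₃))

theorem IsSmooth.card_inter (hs : f.IsSmooth) {x y : CoreVertex f} (h : f.core.Adj x y) :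
    (tri x ∩ tri y).card = 2 := by
  obtain ⟨hne, h2⟩ := core_adj.1 h
  refine le_antisymm ?_ h2
  by_contra h3
  apply hne
  apply hs.eq_of_tri_subset
  have := Finset.eq_of_subset_of_card_le (Finset.inter_subset_left (s₁ := tri x) (s₂ := tri y))
    (by rw [hs.card_tri]; omega)
  rw [← this]
  exact Finset.inter_subset_right

theorem IsSmooth.core_eq_of_edge (hs : f.IsSmooth) {x y z : CoreVertex f} {p q : ℤ × ℤ}
    (hpq : p ≠ q) (hp : p ∈ tri x) (hq : q ∈ tri x) (hp₁ : p ∈ tri y) (hq₁ : q ∈ tri y)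
    (hp₂ : p ∈ tri z) (hq₂ : q ∈ tri z) (h₁ : y ≠ x) (h₂ : z ≠ x) : y = z :=
  coreVertex_ext (hs.eq_of_edge hpq (isVertex_core x) (isVertex_core y) (isVertex_core z)
    hp hq hp₁ hq₁ hp₂ hq₂ (fun e => h₁ (coreVertex_ext e)) (fun e => h₂ (coreVertex_ext e)))

/-- The triangles at an interior lattice point belong to the core. -/
theorem IsSmooth.mem_coreVertices (hs : f.IsSmooth) {p : ℤ × ℤ} (hp : f.IsInt p)
    (w : {w // f.IsVertex w}) (hw : p ∈ f.active w.1) : w ∈ coreVertices f.boundedGraph := by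
  refine ⟨{w | p ∈ f.active w.1}, ?_, hw⟩
  intro v hv
  obtain ⟨a, b, h⟩ := hs.exists_isTri_of_mem v.2 hv
  obtain ⟨w₁, c₁, h₁, hne₁⟩ := hs.exists_neighbor h (hp.midpoint (active_subset h.mem₂))
  obtain ⟨w₂, c₂, h₂, hne₂⟩ := hs.exists_neighbor h.swap (hp.midpoint (active_subset h.mem₃))
  have hadj : ∀ (w' : ℝ × ℝ) (hw' : f.IsVertex w') (a : ℤ × ℤ), p ≠ a → a ∈ f.active v.1 →
      p ∈ f.active w' → a ∈ f.active w' → w' ≠ v.1 →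
      (⟨w', hw'⟩ : {w // f.IsVertex w}) ∈ f.boundedGraph.neighborSet v ∩ {w | p ∈ f.active w.1} := by
    intro w' hw' a hpa ha hp' ha' hne
    refine ⟨⟨fun e => hne (by rw [e]), ?_⟩, hp'⟩
    exact Finset.one_lt_card.2
      ⟨p, Finset.mem_inter.2 ⟨hv, hp'⟩, a, Finset.mem_inter.2 ⟨ha, ha'⟩, hpa⟩
  have hne : (⟨w₁, h₁.isVertex⟩ : {w // f.IsVertex w}) ≠ ⟨w₂, h₂.isVertex⟩ := by
    intro e
    rw [Subtype.mk.injEq] at e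
    subst e
    exact hne₁ (h.eq_of_mem h₁.mem₁ h₁.mem₂ h₂.mem₂).symm
  rw [← Set.encard_pair hne]
  apply Set.encard_le_encard
  rintro y (rfl | rfl)
  · exact hadj w₁ h₁.isVertex a h.ne₁₂ h.mem₂ h₁.mem₁ h₁.mem₂ hne₁
  · exact hadj w₂ h₂.isVertex b h.ne₁₃ h.mem₃ h₂.mem₁ h₂.mem₂ hne₂

theorem IsSmooth.exists_coreVertex (hs : f.IsSmooth) {p : ℤ × ℤ} (hp : f.IsInt p) {w : ℝ × ℝ}
    (hw : f.IsVertex w) (hpw : p ∈ f.active w) : ∃ x : CoreVertex f, x.1.1 = w :=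
  ⟨⟨⟨w, hw⟩, hs.mem_coreVertices hp _ hpw⟩, rfl⟩

/-- An edge at an interior lattice point has its midpoint in the interior, so there is a triangle on
its other side. That triangle has the corner `p` too and therefore survives the removal of leaves.
-/
theorem IsSmooth.exists_core_neighbor (hs : f.IsSmooth) {x : CoreVertex f} {p a : ℤ × ℤ}
    (hp : f.IsInt p) (hpx : p ∈ tri x) (hax : a ∈ tri x) (hpa : p ≠ a) :
    ∃ y : CoreVertex f, y ≠ x ∧ p ∈ tri y ∧ a ∈ tri y := by
  obtain ⟨c, h⟩ := hs.exists_isTri_of_mem_of_mem (isVertex_core x) hpx hax hpa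
  obtain ⟨w, c', h', hne⟩ := hs.exists_neighbor h (hp.midpoint (active_subset hax))
  obtain ⟨y, rfl⟩ := hs.exists_coreVertex hp h'.isVertex h'.mem₁
  exact ⟨y, fun e => hne (by rw [e]), h'.mem₁, h'.mem₂⟩

theorem isBranch_of_neighbors {x y₁ y₂ y₃ : CoreVertex f} {a b c : ℤ × ℤ}
    (h : IsTri f x.1.1 a b c) (h₁ : y₁ ≠ x) (h₂ : y₂ ≠ x) (h₃ : y₃ ≠ x)
    (hb₁ : b ∈ tri y₁) (hc₁ : c ∈ tri y₁) (ha₂ : a ∈ tri y₂) (hc₂ : c ∈ tri y₂)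
    (ha₃ : a ∈ tri y₃) (hb₃ : b ∈ tri y₃) : IsBranch f.core x := by
  have key : ∀ y : CoreVertex f, y ≠ x → a ∈ tri y → b ∈ tri y → c ∈ tri y → False :=
    fun y hy ha hb hc => hy (coreVertex_ext (h.eq_of_mem ha hb hc)).symm
  refine isBranch_of_adj (core_adj_of_mem h₁.symm h.ne₂₃ h.mem₂ h.mem₃ hb₁ hc₁)
    (core_adj_of_mem h₂.symm h.ne₁₃ h.mem₁ h.mem₃ ha₂ hc₂)
    (core_adj_of_mem h₃.symm h.ne₁₂ h.mem₁ h.mem₂ ha₃ hb₃) ?_ ?_ ?_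
  · rintro rfl; exact key _ h₁ ha₂ hb₁ hc₁
  · rintro rfl; exact key _ h₁ ha₃ hb₁ hc₁
  · rintro rfl; exact key _ h₂ ha₂ hb₃ hc₂

/-- Each of the three sides has an interior lattice point as an end, and hence a core neighbour
across it. -/
theorem IsSmooth.isBranch_of_isInt (hs : f.IsSmooth) {x : CoreVertex f} {p q : ℤ × ℤ}
    (hp : f.IsInt p) (hq : f.IsInt q) (hpx : p ∈ tri x) (hqx : q ∈ tri x) (hpq : p ≠ q) :
    IsBranch f.core x := by
  obtain ⟨c, h⟩ := hs.exists_isTri_of_mem_of_mem (isVertex_core x) hpx hqx hpq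
  obtain ⟨y₁, hy₁, hq₁, hc₁⟩ := hs.exists_core_neighbor hq hqx h.mem₃ h.ne₂₃
  obtain ⟨y₂, hy₂, hp₂, hc₂⟩ := hs.exists_core_neighbor hp hpx h.mem₃ h.ne₁₃
  obtain ⟨y₃, hy₃, hp₃, hq₃⟩ := hs.exists_core_neighbor hp hpx hqx hpq
  exact isBranch_of_neighbors h hy₁ hy₂ hy₃ hq₁ hc₁ hp₂ hc₂ hp₃ hq₃

/-- All neighbors of a two-valent vertex in the cycle around `p` lie in that cycle. -/
theorem IsSmooth.mem_tri_of_adj (hs : f.IsSmooth) {x y : CoreVertex f} {p : ℤ × ℤ}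
    (hp : f.IsInt p) (hpx : p ∈ tri x) (hx : ¬ IsBranch f.core x) (hxy : f.core.Adj x y) :
    p ∈ tri y := by
  by_contra hpy
  obtain ⟨a, b, h⟩ := hs.exists_isTri_of_mem (isVertex_core x) hpx
  obtain ⟨y₂, hy₂, hp₂, hc₂⟩ := hs.exists_core_neighbor hp hpx h.mem₃ h.ne₁₃
  obtain ⟨y₃, hy₃, hp₃, hq₃⟩ := hs.exists_core_neighbor hp hpx h.mem₂ h.ne₁₂
  -- A neighbour without the corner `p` lies across the side opposite to `p`. The two sides at `p`
  -- have neighbours as well, which makes three.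
  have hsub : tri x ∩ tri y ⊆ {a, b} := by
    intro z hz
    rw [Finset.mem_inter] at hz
    rcases (h.mem z).1 hz.1 with rfl | rfl | rfl
    · exact absurd hz.2 hpy
    · simp
    · simp
  have heq := Finset.eq_of_subset_of_card_le hsub
    (by rw [Finset.card_pair h.ne₂₃, hs.card_inter hxy])
  have ha : a ∈ tri x ∩ tri y := by rw [heq]; simp
  have hb : b ∈ tri x ∩ tri y := by rw [heq]; simp
  rw [Finset.mem_inter] at ha hb
  exact hx (isBranch_of_neighbors h hxy.ne.symm hy₂ hy₃ ha.2 hb.2 hp₂ hc₂ hp₃ hq₃)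

/-- If the cone at `p` over the opposite edge of a triangle contains another interior lattice point,
then so does the parallelogram spanned by the triangle. -/
theorem IsSmooth.exists_flip (hs : f.IsSmooth) {x : CoreVertex f} {p q q' a : ℤ × ℤ}
    (h : IsTri f x.1.1 p q q') (hp : f.IsInt p) (hq : ¬ f.IsInt q) (hq' : ¬ f.IsInt q')
    (ha : f.IsInt a) (hap : a ≠ p) {α β : ℤ} (hα : 0 ≤ α) (hβ : 0 ≤ β)
    (e1 : a.1 - p.1 = α * (q.1 - p.1) + β * (q'.1 - p.1))
    (e2 : a.2 - p.2 = α * (q.2 - p.2) + β * (q'.2 - p.2)) :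
    f.IsInt (q + q' - p) ∧ ∃ y : CoreVertex f, y ≠ x ∧ IsTri f y.1.1 q q' (q + q' - p) := by
  have hr := hs.isInt_of_cone h hp hq hq' ha hap hα hβ e1 e2
  have hm : (((q.1 : ℝ) + q'.1) / 2, ((q.2 : ℝ) + q'.2) / 2) ∈ interior f.newtonPolygon := by
    have := f.convex_newtonPolygon.interior hp hr (a := 1 / 2) (b := 1 / 2) (by norm_num)
      (by norm_num) (by norm_num)
    convert this using 1
    ext <;> simp [latticePoint] <;> ring
  obtain ⟨w, c, h', hne⟩ := hs.exists_neighbor h.rotate hm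
  have hc := hs.eq_of_flip h h' hne.symm hp hq hq'
  subst hc
  obtain ⟨y, rfl⟩ := hs.exists_coreVertex hr h'.isVertex h'.mem₃
  exact ⟨hr, y, fun e => hne (by rw [e]), h'⟩

/-- The link between geometry and valence: a triangle through which `p` sees another interior
lattice point has core neighbours across all three sides. -/
theorem IsSmooth.isBranch_of_cone (hs : f.IsSmooth) {x : CoreVertex f} {p q q' a : ℤ × ℤ}
    (h : IsTri f x.1.1 p q q') (hp : f.IsInt p)
    (ha : f.IsInt a) (hap : a ≠ p) {α β : ℤ} (hα : 0 ≤ α) (hβ : 0 ≤ β)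
    (e1 : a.1 - p.1 = α * (q.1 - p.1) + β * (q'.1 - p.1))
    (e2 : a.2 - p.2 = α * (q.2 - p.2) + β * (q'.2 - p.2)) : IsBranch f.core x := by
  by_cases hq : f.IsInt q
  · exact hs.isBranch_of_isInt hp hq h.mem₁ h.mem₂ h.ne₁₂
  by_cases hq' : f.IsInt q'
  · exact hs.isBranch_of_isInt hp hq' h.mem₁ h.mem₃ h.ne₁₃
  obtain ⟨hr, y, hy, h'⟩ := hs.exists_flip h hp hq hq' ha hap hα hβ e1 e2
  obtain ⟨y₂, hy₂, hp₂, hc₂⟩ := hs.exists_core_neighbor hp h.mem₁ h.mem₃ h.ne₁₃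
  obtain ⟨y₃, hy₃, hp₃, hq₃⟩ := hs.exists_core_neighbor hp h.mem₁ h.mem₂ h.ne₁₂
  exact isBranch_of_neighbors h hy hy₂ hy₃ h'.mem₁ h'.mem₂ hp₂ hc₂ hp₃ hq₃

/-- Every interior lattice point, unless it is the only one, is a corner of a branch triangle. -/
theorem IsSmooth.exists_isBranch (hs : f.IsSmooth) {p a : ℤ × ℤ} (hp : f.IsInt p) (ha : f.IsInt a)
    (hap : a ≠ p) : ∃ x : CoreVertex f, IsBranch f.core x ∧ p ∈ tri x := by
  obtain ⟨w, q, q', h, α, β, hα, hβ, e1, e2⟩ := hs.exists_cone hp (a - p)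
  obtain ⟨x, rfl⟩ := hs.exists_coreVertex hp h.isVertex h.mem₁
  exact ⟨x, hs.isBranch_of_cone h hp ha hap hα hβ e1 e2, h.mem₁⟩

end TropicalPolynomial

/-! ### The first edge of an arc -/

namespace OrientedArc

open TropicalPolynomial

variable {f : TropicalPolynomial}

/-- The common corners of the first two triangles of an arc. -/
noncomputable def ends (A : OrientedArc f.core) : Finset (ℤ × ℤ) := tri A.fst ∩ tri (A.vertAt 1)

theorem mem_ends {A : OrientedArc f.core} {p : ℤ × ℤ} :
    p ∈ A.ends ↔ p ∈ tri A.fst ∧ p ∈ tri (A.vertAt 1) := Finset.mem_inter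

theorem adj_fst (A : OrientedArc f.core) : f.core.Adj A.fst (A.vertAt 1) := by
  have := A.adj A.size_pos
  rwa [vertAt_zero] at this

theorem card_ends (hs : f.IsSmooth) (A : OrientedArc f.core) : A.ends.card = 2 :=
  hs.card_inter A.adj_fst

theorem eq_of_mem_ends (hs : f.IsSmooth) {A B : OrientedArc f.core} (h : A.fst = B.fst)
    {p q : ℤ × ℤ} (hpq : p ≠ q) (hp : p ∈ A.ends) (hq : q ∈ A.ends) (hp' : p ∈ B.ends)
    (hq' : q ∈ B.ends) : A = B := by
  rw [mem_ends] at hp hq hp' hq'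
  refine eq_of_vertAt_one h (hs.core_eq_of_edge hpq hp.1 hq.1 hp.2 hq.2 hp'.2 hq'.2
    A.adj_fst.ne.symm ?_)
  rw [h]
  exact B.adj_fst.ne.symm

theorem ends_injective (hs : f.IsSmooth) {A B : OrientedArc f.core} (h : A.fst = B.fst)
    (he : A.ends = B.ends) : A = B := by
  obtain ⟨p, q, hpq, hA⟩ := Finset.card_eq_two.1 (A.card_ends hs)
  have hp : p ∈ A.ends := by rw [hA]; simp
  have hq : q ∈ A.ends := by rw [hA]; simp
  exact eq_of_mem_ends hs h hpq hp hq (he ▸ hp) (he ▸ hq)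

/-- An interior lattice point at the first edge of an arc belongs to all triangles of the arc. -/
theorem mem_tri_vertAt (hs : f.IsSmooth) {A : OrientedArc f.core} {p : ℤ × ℤ} (hp : f.IsInt p)
    (hA : p ∈ A.ends) {i : ℕ} (hi : i ≤ A.size) : p ∈ tri (A.vertAt i) := by
  induction i with
  | zero => rw [vertAt_zero]; exact (mem_ends.1 hA).1
  | succ i ih =>
    cases i with
    | zero => exact (mem_ends.1 hA).2
    | succ i =>
      exact hs.mem_tri_of_adj hp (ih (by omega)) (A.not_isBranch (Nat.succ_pos i) (by omega))
        (A.adj (by omega))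

theorem mem_ends_reverse (hs : f.IsSmooth) {A : OrientedArc f.core} {p : ℤ × ℤ} (hp : f.IsInt p) :
    p ∈ A.reverse.ends ↔ p ∈ A.ends := by
  have key : ∀ A : OrientedArc f.core, p ∈ A.ends → p ∈ A.reverse.ends := by
    intro A hA
    rw [mem_ends, vertAt_reverse, fst_reverse, ← vertAt_size]
    exact ⟨mem_tri_vertAt hs hp hA le_rfl, mem_tri_vertAt hs hp hA (Nat.sub_le _ _)⟩
  exact ⟨fun h => by simpa using key _ h, key A⟩

/-- The first edges of three different arcs at a vertex are the sides of its triangle. -/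
theorem mem_two_of_three (hs : f.IsSmooth) {A B C : OrientedArc f.core} (hAB : A ≠ B) (hAC : A ≠ C)
    (hBC : B ≠ C) (h : A.fst = B.fst) (h' : A.fst = C.fst) {p : ℤ × ℤ} (hp : p ∈ tri A.fst) :
    (p ∈ A.ends ∧ p ∈ B.ends ∧ p ∉ C.ends) ∨ (p ∈ A.ends ∧ p ∉ B.ends ∧ p ∈ C.ends) ∨
      (p ∉ A.ends ∧ p ∈ B.ends ∧ p ∈ C.ends) := by
  obtain ⟨q, r, ht⟩ := hs.exists_isTri_of_mem (isVertex_core A.fst) hp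
  have hsub : ∀ D : OrientedArc f.core, A.fst = D.fst → D.ends = {p, q} ∨ D.ends = {p, r} ∨
      D.ends = {q, r} := by
    intro D hD
    have hc := D.card_ends hs
    have hm : ∀ z ∈ D.ends, z = p ∨ z = q ∨ z = r := by
      intro z hz
      rw [mem_ends, ← hD] at hz
      exact (ht.mem z).1 hz.1
    obtain ⟨x, y, hxy, hDe⟩ := Finset.card_eq_two.1 hc
    have hx := hm x (by rw [hDe]; simp)
    have hy := hm y (by rw [hDe]; simp)
    rw [hDe]
    rcases hx with rfl | rfl | rfl <;> rcases hy with rfl | rfl | rfl <;>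
      first
        | exact absurd rfl hxy
        | (simp only [true_or, or_true])
        | (rw [Finset.pair_comm]; simp only [true_or, or_true])
  have h1 := hsub A rfl
  have h2 := hsub B h
  have h3 := hsub C h'
  have n1 : A.ends ≠ B.ends := fun e => hAB (ends_injective hs h e)
  have n2 : A.ends ≠ C.ends := fun e => hAC (ends_injective hs h' e)
  have n3 : B.ends ≠ C.ends := fun e => hBC (ends_injective hs (h.symm.trans h') e)
  have hpq := ht.ne₁₂
  have hpr := ht.ne₁₃
  have m1 : p ∈ ({p, q} : Finset (ℤ × ℤ)) := by simp
  have m2 : p ∈ ({p, r} : Finset (ℤ × ℤ)) := by simp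
  have m3 : p ∉ ({q, r} : Finset (ℤ × ℤ)) := by simp [hpq, hpr]
  rcases h1 with h1 | h1 | h1 <;> rcases h2 with h2 | h2 | h2 <;> rcases h3 with h3 | h3 | h3 <;>
    rw [h1, h2] at n1 <;> rw [h1, h3] at n2 <;> rw [h2, h3] at n3 <;> rw [h1, h2, h3] <;>
    first
      | exact absurd rfl n1
      | exact absurd rfl n2
      | exact absurd rfl n3
      | exact Or.inl ⟨by assumption, by assumption, by assumption⟩
      | exact Or.inr (Or.inl ⟨by assumption, by assumption, by assumption⟩)
      | exact Or.inr (Or.inr ⟨by assumption, by assumption, by assumption⟩)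

/-- The set of edges of the skeleton along the cycle around an interior lattice point. -/
theorem isEven_mem_ends (hs : f.IsSmooth) {p : ℤ × ℤ} (hp : f.IsInt p) :
    Multigraph.IsEven f.skeleton.toMultigraph (fun A : OrientedArc f.core => p ∈ A.ends) where
  rev A := mem_ends_reverse hs hp
  even A B C hAB hAC hBC h h' := by
    have h : A.fst = B.fst := congrArg Subtype.val h
    have h' : A.fst = C.fst := congrArg Subtype.val h'
    simp only [Multigraph.EvenOfThree]
    by_cases hpA : p ∈ tri A.fst
    · have := mem_two_of_three hs hAB hAC hBC h h' hpA
      tauto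
    · have h1 : p ∉ OrientedArc.ends A := fun e => hpA (mem_ends.1 e).1
      have h2 : p ∉ OrientedArc.ends B := fun e => hpA (h ▸ (mem_ends.1 e).1)
      have h3 : p ∉ OrientedArc.ends C := fun e => hpA (h' ▸ (mem_ends.1 e).1)
      tauto

end OrientedArc

/-! ### Arcs that start across an edge without interior lattice points are bridges. -/

namespace TropicalPolynomial

variable {f : TropicalPolynomial}

/-- An exponent on the other side of an edge without interior lattice points is seen from the third
corner of the triangle through that edge. -/
theorem IsSmooth.exists_cone_of_opposite (hs : f.IsSmooth) {w w' : ℝ × ℝ} {q q' c c' a : ℤ × ℤ}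
    (h : IsTri f w q q' c) (h' : IsTri f w' q q' c') (hpos : 0 < cr (q' - q) (c - q))
    (hneg : cr (q' - q) (c' - q) < 0) (hq : ¬ f.IsInt q) (hq' : ¬ f.IsInt q') (ha : a ∈ f.support)
    (haneg : cr (q' - q) (a - q) < 0) : ∃ α β : ℤ, 0 ≤ α ∧ 0 ≤ β ∧
      a.1 - c.1 = α * (q.1 - c.1) + β * (q'.1 - c.1) ∧
      a.2 - c.2 = α * (q.2 - c.2) + β * (q'.2 - c.2) := by
  have hD : cr (q' - q) (c - q) = 1 := by have := h.cr; omega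
  have hD' : ((q'.1 : ℝ) - q.1) * (c.2 - q.2) - (q'.2 - q.2) * (c.1 - q.1) = 1 := by
    simp only [cr, Prod.fst_sub, Prod.snd_sub] at hD; exact_mod_cast hD
  -- The line through `q` and `q'` has height 0, `c` has height 1 and `a` has height `1 - N`; the
  -- segment from `c` to `a` meets the line at the parameter `1 / N`.
  set N : ℝ := 1 - (cr (q' - q) (a - q) : ℝ) with hN
  have hN' : N = 1 - (((q'.1 : ℝ) - q.1) * (a.2 - q.2) - (q'.2 - q.2) * (a.1 - q.1)) := by
    rw [hN]; simp [cr]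
  have hN1 : 1 < N := by
    have : (cr (q' - q) (a - q) : ℝ) < 0 := by exact_mod_cast haneg
    rw [hN]; linarith
  clear_value N
  have hN0 : N * N⁻¹ = 1 := mul_inv_cancel₀ (by linarith)
  have hi0 : 0 < N⁻¹ := by positivity
  have hi1 : N⁻¹ ≤ 1 := by nlinarith
  have hy : ((1 - N⁻¹) * c.1 + N⁻¹ * a.1, (1 - N⁻¹) * c.2 + N⁻¹ * a.2) ∈ f.newtonPolygon := by
    have := f.convex_newtonPolygon (mem_newtonPolygon (active_subset h.mem₃))
      (mem_newtonPolygon ha) (sub_nonneg.2 hi1) hi0.le (by ring)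
    convert this using 1
    ext <;> simp [latticePoint]
  obtain ⟨t, ht0, ht1, e1, e2⟩ := hs.exists_mem_segment (active_subset h.mem₁)
    (active_subset h.mem₂) hq hq' (active_subset h.mem₃) (active_subset h'.mem₃) hpos hneg hy (by
      simp only
      linear_combination (1 - N⁻¹) * hD' + N⁻¹ * hN' - hN0)
  simp only at e1 e2
  have f1 : (a.1 : ℝ) - c.1 = N * (q.1 - c.1 + t * (q'.1 - q.1)) := by
    linear_combination N * e1 - (a.1 - c.1) * hN0
  have f2 : (a.2 : ℝ) - c.2 = N * (q.2 - c.2 + t * (q'.2 - q.2)) := by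
    linear_combination N * e2 - (a.2 - c.2) * hN0
  have hcr := h.rotate.rotate.cr
  have hone : cr (q - c) (q' - c) = 1 := by
    rw [← hD]; simp only [cr, Prod.fst_sub, Prod.snd_sub]; ring
  obtain ⟨g1, g2⟩ := exists_combo (x := a - c) hcr
  rw [hone, one_mul, one_mul] at g1 g2
  refine ⟨_, _, ?_, ?_, g1, g2⟩
  · have : (cr (a - c) (q' - c) : ℝ) = N * (1 - t) := by
      simp only [cr, Prod.fst_sub, Prod.snd_sub]
      push_cast
      rw [f1, f2]
      linear_combination N * (1 - t) * hD'
    have h0 : (0 : ℝ) ≤ cr (a - c) (q' - c) := by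
      rw [this]; exact mul_nonneg (by linarith) (by linarith)
    exact_mod_cast h0
  · have : (cr (q - c) (a - c) : ℝ) = N * t := by
      simp only [cr, Prod.fst_sub, Prod.snd_sub]
      push_cast
      rw [f1, f2]
      linear_combination N * t * hD'
    have h0 : (0 : ℝ) ≤ cr (q - c) (a - c) := by
      rw [this]; exact mul_nonneg (by linarith) (by linarith)
    exact_mod_cast h0

end TropicalPolynomial

namespace OrientedArc

open TropicalPolynomial

variable {f : TropicalPolynomial}

/-- The first edge of the arc `A` is `q, q'`, without interior lattice points. -/
structure IsWall (A : OrientedArc f.core) (q q' c c' : ℤ × ℤ) : Prop where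
  fst : IsTri f A.fst.1.1 q q' c
  snd : IsTri f (A.vertAt 1).1.1 q q' c'
  pos : 0 < cr (q' - q) (c - q)
  neg : cr (q' - q) (c' - q) < 0
  not_int : ¬ f.IsInt q
  not_int' : ¬ f.IsInt q'

/-- The vertex `x` has a corner on the left of the line from `q` to `q'`. -/
def OnLeft (q q' : ℤ × ℤ) (x : CoreVertex f) : Prop := ∃ a ∈ tri x, 0 < cr (q' - q) (a - q)

theorem exists_isWall (hs : f.IsSmooth) {A : OrientedArc f.core} (hA : ∀ p ∈ A.ends, ¬ f.IsInt p) :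
    ∃ q q' c c', A.IsWall q q' c c' := by
  obtain ⟨q, q', hqq, he⟩ := Finset.card_eq_two.1 (A.card_ends hs)
  have hq : q ∈ A.ends := by rw [he]; simp
  have hq' : q' ∈ A.ends := by rw [he]; simp
  have hi := hA q hq
  have hi' := hA q' hq'
  rw [mem_ends] at hq hq'
  obtain ⟨c, h⟩ := hs.exists_isTri_of_mem_of_mem (isVertex_core _) hq.1 hq'.1 hqq
  obtain ⟨c', h'⟩ := hs.exists_isTri_of_mem_of_mem (isVertex_core _) hq.2 hq'.2 hqq
  have hopp := h.cr_eq_neg h' fun e => A.adj_fst.ne (coreVertex_ext e)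
  have hswap : ∀ z, cr (q - q') (z - q') = -cr (q' - q) (z - q) := by
    intro z
    simp only [cr, Prod.fst_sub, Prod.snd_sub]
    ring
  have hcr := h.cr
  by_cases h0 : 0 < cr (q' - q) (c - q)
  · exact ⟨q, q', c, c', h, h', h0, by omega, hi, hi'⟩
  · refine ⟨q', q, c, c', h.rotate.swap, h'.rotate.swap, ?_, ?_, hi', hi⟩
    · rw [hswap]; omega
    · rw [hswap]; omega

namespace IsWall

variable {A : OrientedArc f.core} {q q' c c' : ℤ × ℤ}

theorem onLeft_fst (h : A.IsWall q q' c c') : OnLeft q q' A.fst := ⟨c, h.fst.mem₃, h.pos⟩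

theorem not_onLeft_one (h : A.IsWall q q' c c') : ¬ OnLeft q q' (A.vertAt 1) := by
  rintro ⟨a, ha, hpos⟩
  rcases (h.snd.mem a).1 ha with rfl | rfl | rfl
  · simp [cr] at hpos
  · simp [cr, mul_comm] at hpos
  · exact absurd hpos h.neg.not_gt

theorem eq_of_adj (hs : f.IsSmooth) (h : A.IsWall q q' c c') {x y : CoreVertex f}
    (hxy : f.core.Adj x y) (hx : OnLeft q q' x) (hy : ¬ OnLeft q q' y) :
    x = A.fst ∧ y = A.vertAt 1 := by
  obtain ⟨h1, h2⟩ := hs.separates h.fst h.snd h.pos h.neg h.not_int h.not_int' (isVertex_core x)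
    (isVertex_core y) (core_adj.1 hxy).2 hx hy
  exact ⟨coreVertex_ext h1, coreVertex_ext h2⟩

/-- Somewhere along `B` the side changes. This happens only across the first edge of `A`, and an
oriented edge determines its arc. -/
theorem eq_of_onLeft (hs : f.IsSmooth) (h : A.IsWall q q' c c') {B : OrientedArc f.core}
    (hB : OnLeft q q' B.fst) (hB' : ¬ OnLeft q q' B.snd) : B = A := by
  obtain ⟨i, hi, h1, h2⟩ : ∃ i < B.size, OnLeft q q' (B.vertAt i) ∧
      ¬ OnLeft q q' (B.vertAt (i + 1)) := by
    by_contra hcon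
    push Not at hcon
    apply hB'
    rw [← vertAt_size]
    have : ∀ i ≤ B.size, OnLeft q q' (B.vertAt i) := by
      intro i
      induction i with
      | zero => intro _; rwa [vertAt_zero]
      | succ i ih => exact fun hi => hcon i hi (ih (by omega))
    exact this _ le_rfl
  obtain ⟨e1, e2⟩ := h.eq_of_adj hs (B.adj hi) h1 h2
  exact (eq_of_vertAt (j := 0) hi A.size_pos (by rw [e1, vertAt_zero]) e2).1

/-- To come back to the left, `A` would have to traverse its own first edge backwards and be its own
reverse. -/
theorem not_onLeft (hs : f.IsSmooth) (h : A.IsWall q q' c c') {i : ℕ} (h0 : 1 ≤ i)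
    (hi : i ≤ A.size) : ¬ OnLeft q q' (A.vertAt i) := by
  induction i, h0 using Nat.le_induction with
  | base => exact h.not_onLeft_one
  | succ i h0 ih =>
    intro hl
    obtain ⟨e1, e2⟩ := h.eq_of_adj hs (A.adj (i := i) hi).symm hl (ih (by omega))
    exact A.reverse_ne (eq_reverse_of_vertAt (A := A) (B := A) (i := i) (j := 0) hi A.size_pos e2
      (by rw [e1, vertAt_zero])).symm

theorem not_onLeft_snd (hs : f.IsSmooth) (h : A.IsWall q q' c c') : ¬ OnLeft q q' A.snd := by
  rw [← vertAt_size]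
  exact h.not_onLeft hs A.size_pos le_rfl

/-- The coloring by sides is thus of the kind to which `chain_not_bridge` applies. -/
theorem onLeft_iff (hs : f.IsSmooth) (h : A.IsWall q q' c c') {B : OrientedArc f.core}
    (hB : B ≠ A) (hB' : B ≠ A.reverse) : OnLeft q q' B.fst ↔ OnLeft q q' B.snd := by
  constructor
  · intro h1
    by_contra h2
    exact hB (h.eq_of_onLeft hs h1 h2)
  · intro h1
    by_contra h2
    apply hB'
    rw [← h.eq_of_onLeft hs (B := B.reverse) h1 h2, reverse_reverse]

end IsWall

end OrientedArc

/-! ### Interior lattice points along the edges of a chain. -/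

namespace TropicalPolynomial

open Multigraph

variable {f : TropicalPolynomial} {n : ℕ} {s : Fin n → Bool}

/-- The arc of the core at a dart of the chain. -/
def arc (ψ : Iso (chain n s) f.skeleton.toMultigraph) (d : (chain n s).Dart) :
    OrientedArc f.core := ψ.dart d

/-- The branch vertex at a vertex of the chain. -/
def branch (ψ : Iso (chain n s) f.skeleton.toMultigraph) (v : (chain n s).Vert) :
    CoreVertex f := (ψ.vert v).1

variable (ψ : Iso (chain n s) f.skeleton.toMultigraph)

theorem isBranch_branch (v : (chain n s).Vert) : IsBranch f.core (branch ψ v) := (ψ.vert v).2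

theorem branch_injective : Function.Injective (branch ψ) :=
  Subtype.val_injective.comp ψ.vert.injective

theorem exists_branch_eq {x : CoreVertex f} (hx : IsBranch f.core x) : ∃ v, branch ψ v = x :=
  ⟨ψ.vert.symm ⟨x, hx⟩, congrArg Subtype.val (ψ.vert.apply_symm_apply ⟨x, hx⟩)⟩

theorem arc_injective : Function.Injective (arc ψ) := ψ.dart.injective

theorem fst_arc (d : (chain n s).Dart) : (arc ψ d).fst = branch ψ ((chain n s).src d) :=
  congrArg Subtype.val (ψ.src_dart d)

theorem reverse_arc (d : (chain n s).Dart) : (arc ψ d).reverse = arc ψ ((chain n s).rev d) :=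
  ψ.rev_dart d

theorem snd_arc (d : (chain n s).Dart) :
    (arc ψ d).snd = branch ψ ((chain n s).src ((chain n s).rev d)) := by
  rw [← fst_arc, ← reverse_arc, OrientedArc.fst_reverse]

variable {ψ}

theorem IsSmooth.isEven_arc (hs : f.IsSmooth) {p : ℤ × ℤ} (hp : f.IsInt p) :
    IsEven (chain n s) (fun d => p ∈ (arc ψ d).ends) :=
  ψ.isEven (OrientedArc.isEven_mem_ends hs hp)

theorem IsSmooth.mem_left_iff (hs : f.IsSmooth) {p : ℤ × ℤ} (hp : f.IsInt p) (i : Fin n)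
    (b b' : Bool) : p ∈ (arc ψ (left s i b)).ends ↔ p ∈ (arc ψ (left s i b')).ends := by
  have := (hs.isEven_arc (ψ := ψ) hp).chain_left i
  cases b <;> cases b' <;> tauto

theorem IsSmooth.mem_right_iff (hs : f.IsSmooth) {p : ℤ × ℤ} (hp : f.IsInt p) (i : Fin n)
    (b b' : Bool) : p ∈ (arc ψ (right s i b)).ends ↔ p ∈ (arc ψ (right s i b')).ends := by
  have := (hs.isEven_arc (ψ := ψ) hp).chain_right i
  cases b <;> cases b' <;> tauto

/-- An arc that is not a bridge runs along an interior lattice point. -/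
theorem IsSmooth.exists_isInt_mem_ends (hs : f.IsSmooth) {T : (chain n s).Dart}
    (hT : ∀ i b, T = bar s i b → s i = false) : ∃ p, f.IsInt p ∧ p ∈ (arc ψ T).ends := by
  by_contra hcon
  push Not at hcon
  obtain ⟨q, q', c, c', h⟩ := OrientedArc.exists_isWall hs
    (A := arc ψ T) fun p hp hp' => hcon p hp' hp
  have := chain_not_bridge (σ := fun v => OrientedArc.OnLeft q q' (branch ψ v)) (T := T) (by
    intro d h1 h2
    rw [← fst_arc, ← snd_arc]
    apply h.onLeft_iff hs ((arc_injective ψ).ne h1)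
    rw [reverse_arc]
    exact (arc_injective ψ).ne h2) hT
  rw [← fst_arc, ← snd_arc] at this
  exact h.not_onLeft_snd hs (this.1 h.onLeft_fst)

/-- By parity, two such points would lie along both parallel arcs, whose first edges would then both
be dual to `p, p'`. If the new edge is shared, one arc would end at the other vertex of its own node
instead of the next node; if it is a bridge, the two arcs would coincide. -/
theorem IsSmooth.eq_of_mem_right (hs : f.IsSmooth) {i : Fin n} (hi : i.val + 1 < n) {p p' : ℤ × ℤ}
    (hp : f.IsInt p) (hp' : f.IsInt p') {b : Bool} (h : p ∈ (arc ψ (right s i b)).ends)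
    (h' : p' ∈ (arc ψ (right s i b)).ends) : p = p' := by
  by_contra hne
  have hf := (hs.mem_right_iff hp i b false).1 h
  have hf' := (hs.mem_right_iff hp' i b false).1 h'
  have ht := (hs.mem_right_iff hp i b true).1 h
  have ht' := (hs.mem_right_iff hp' i b true).1 h'
  cases hsi : s i
  · have e1 : (arc ψ (right s i false)).fst = branch ψ (node s i false) := by
      rw [fst_arc, src_right, hsi]; rfl
    have e2 : (arc ψ (right s i true)).fst = branch ψ (node s i true) := by
      rw [fst_arc, src_right, hsi]; rfl
    rw [OrientedArc.mem_ends] at hf hf' ht ht'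
    rw [e1] at hf hf'
    rw [e2] at ht ht'
    have e3 : (arc ψ (right s i false)).vertAt 1 = branch ψ (node s i true) := by
      refine hs.core_eq_of_edge hne hf.1 hf'.1 hf.2 hf'.2 ht.1 ht'.1 ?_ ?_
      · rw [← e1]; exact (OrientedArc.adj_fst _).ne.symm
      · exact (branch_injective ψ).ne (by simp)
    have e4 := OrientedArc.snd_eq_vertAt_one (A := arc ψ (right s i false))
      (by rw [e3]; exact isBranch_branch ψ _)
    rw [e3, snd_arc, rev_right hi, src_left] at e4
    have e5 := branch_injective ψ e4
    rw [node_inj] at e5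
    have := congrArg Fin.val e5.1
    simp at this
  · have := OrientedArc.eq_of_mem_ends hs (A := arc ψ (right s i false))
      (B := arc ψ (right s i true)) (by rw [fst_arc, fst_arc, src_right, src_right, hsi]; rfl)
      hne hf hf' ht ht'
    have := arc_injective ψ this
    simp at this

theorem IsSmooth.mem_left_succ (hs : f.IsSmooth) {i : ℕ} (hi : i + 1 < n) {p : ℤ × ℤ}
    (hp : f.IsInt p) (b : Bool) : p ∈ (arc ψ (left s ⟨i + 1, hi⟩ b)).ends ↔
      p ∈ (arc ψ (right s ⟨i, Nat.lt_of_succ_lt hi⟩ b)).ends := by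
  rw [← rev_right (i := ⟨i, Nat.lt_of_succ_lt hi⟩) hi, ← reverse_arc,
    OrientedArc.mem_ends_reverse hs hp]

theorem IsSmooth.eq_of_mem_left (hs : f.IsSmooth) {i : Fin n} (hi : 0 < i.val) {p p' : ℤ × ℤ}
    (hp : f.IsInt p) (hp' : f.IsInt p') {b : Bool} (h : p ∈ (arc ψ (left s i b)).ends)
    (h' : p' ∈ (arc ψ (left s i b)).ends) : p = p' := by
  obtain ⟨i, hin⟩ := i
  cases i with
  | zero => exact absurd hi (lt_irrefl _)
  | succ i =>
    rw [hs.mem_left_succ hin hp] at h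
    rw [hs.mem_left_succ hin hp'] at h'
    exact hs.eq_of_mem_right hin hp hp' h h'

end TropicalPolynomial

/-! ### The triangles at a node. -/

namespace TropicalPolynomial

open Multigraph

variable {f : TropicalPolynomial} {n : ℕ} {s : Fin n → Bool}
  {ψ : Iso (chain n s) f.skeleton.toMultigraph}

theorem fst_arc_bar (i : Fin n) (b : Bool) : (arc ψ (bar s i b)).fst = branch ψ (node s i b) := by
  rw [fst_arc, src_bar]

theorem fst_arc_left (i : Fin n) (b : Bool) :
    (arc ψ (left s i b)).fst = branch ψ (node s i (if s i then false else b)) := by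
  rw [fst_arc, src_left]

theorem fst_arc_right (i : Fin n) (b : Bool) :
    (arc ψ (right s i b)).fst = branch ψ (node s i (if s i then true else b)) := by
  rw [fst_arc, src_right]

/-- Two arcs around the interior lattice point `p` that start next to the interior lattice point `m`,
on the two sides of it, with first edges `p, q b`. Either they start at the two ends of the edge dual
to `p, m`, or at a common vertex whose dual triangle is half of a parallelogram with diagonal
`p, m`. -/
structure IsEnd (d : Bool → OrientedArc f.core) (p m : ℤ × ℤ) (q : Bool → ℤ × ℤ) : Prop where
  int : f.IsInt p
  int' : f.IsInt m
  not_int : ∀ b, ¬ f.IsInt (q b)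
  mem : ∀ b, p ∈ (d b).ends
  mem' : ∀ b, q b ∈ (d b).ends
  alt : ((∀ b, IsTri f (d b).fst.1.1 p m (q b)) ∧ (d false).fst ≠ (d true).fst) ∨
    ((∀ b, IsTri f (d b).fst.1.1 p (q b) (q !b)) ∧ (d false).fst = (d true).fst ∧
      m - p = (q false - p) + (q true - p))

/-- The case of a bridge. Each arc needs an interior lattice point at its first edge, and `p` is the
only one available; so the first edges are dual to the two sides at `p`. -/
theorem IsSmooth.exists_isEnd_of_eq (hs : f.IsSmooth) {d : Bool → OrientedArc f.core}
    {p m q q' : ℤ × ℤ} {x : CoreVertex f} (hx : ∀ b, (d b).fst = x) (hd : d false ≠ d true)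
    (h : IsTri f x.1.1 p q q') (hp : f.IsInt p) (hq : ¬ f.IsInt q) (hq' : ¬ f.IsInt q')
    (hm : f.IsInt m) (hmp : m = q + q' - p) (hdp : ∀ b, ∃ a, f.IsInt a ∧ a ∈ (d b).ends) :
    ∃ q, IsEnd d p m q := by
  have hpm : ∀ b, p ∈ (d b).ends := by
    intro b
    obtain ⟨a, ha, hab⟩ := hdp b
    have := (OrientedArc.mem_ends.1 hab).1
    rw [hx] at this
    rcases (h.mem a).1 this with rfl | rfl | rfl
    · exact hab
    · exact absurd ha hq
    · exact absurd ha hq'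
  have hex : ∀ b, ∃ r ∈ (d b).ends, r = q ∨ r = q' := by
    intro b
    obtain ⟨r, hr, hrp⟩ := Finset.exists_mem_ne (by rw [(d b).card_ends hs]; norm_num) p
    have := (OrientedArc.mem_ends.1 hr).1
    rw [hx] at this
    exact ⟨r, hr, ((h.mem r).1 this).resolve_left hrp⟩
  choose r hr hrq using hex
  have hne : r false ≠ r true := by
    intro e
    refine hd (OrientedArc.eq_of_mem_ends hs (by rw [hx, hx]) ?_ (hpm false) (hr false) (hpm true)
      (e ▸ hr true))
    rcases hrq false with e' | e' <;> rw [e']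
    · exact h.ne₁₂
    · exact h.ne₁₃
  refine ⟨r, hp, hm, ?_, hpm, hr, Or.inr ⟨?_, by rw [hx, hx], ?_⟩⟩
  · intro b
    rcases hrq b with e | e <;> rw [e] <;> assumption
  · intro b
    rw [hx]
    rcases hrq false with e | e <;> rcases hrq true with e' | e'
    · exact absurd (e.trans e'.symm) hne
    · cases b <;> simp only [Bool.not_false, Bool.not_true, e, e']
      · exact h
      · exact h.swap
    · cases b <;> simp only [Bool.not_false, Bool.not_true, e, e']
      · exact h.swap
      · exact h
    · exact absurd (e.trans e'.symm) hne
  · rw [hmp]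
    rcases hrq false with e | e <;> rcases hrq true with e' | e'
    · exact absurd (e.trans e'.symm) hne
    · rw [e, e']; abel
    · rw [e, e']; abel
    · exact absurd (e.trans e'.symm) hne

/-- The case of a shared new edge. The first edge of each arc has a second corner, which is not `m`.
-/
theorem IsSmooth.exists_isEnd_of_ne (hs : f.IsSmooth) {d : Bool → OrientedArc f.core}
    {p m : ℤ × ℤ} {q : Bool → ℤ × ℤ} (hd : (d false).fst ≠ (d true).fst)
    (h : ∀ b, IsTri f (d b).fst.1.1 p m (q b)) (hp : f.IsInt p) (hq : ∀ b, ¬ f.IsInt (q b))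
    (hm : f.IsInt m) (hpm : ∀ b, p ∈ (d b).ends) (hmm : ∀ b, m ∉ (d b).ends) :
    ∃ q, IsEnd d p m q := by
  refine ⟨q, hp, hm, hq, hpm, fun b => ?_, Or.inl ⟨h, hd⟩⟩
  obtain ⟨r, hr, hrp⟩ := Finset.exists_mem_ne (by rw [(d b).card_ends hs]; norm_num) p
  rcases ((h b).mem r).1 (OrientedArc.mem_ends.1 hr).1 with rfl | rfl | rfl
  · exact absurd rfl hrp
  · exact absurd hr (hmm b)
  · exact hr

/-- The triangles at a node whose new edge is a bridge. -/
theorem IsSmooth.exists_bridge (hs : f.IsSmooth) {i : Fin n} (hi : s i = true) :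
    ∃ l r q q' : ℤ × ℤ, f.IsInt l ∧ f.IsInt r ∧ ¬ f.IsInt q ∧ ¬ f.IsInt q' ∧
      IsTri f (branch ψ (node s i false)).1.1 l q q' ∧
      IsTri f (branch ψ (node s i true)).1.1 r q q' ∧ r = q + q' - l := by
  obtain ⟨q, q', c, c', h⟩ := OrientedArc.exists_isWall hs (A := arc ψ (bar s i false))
    fun p hp' hp => (hs.isEven_arc (ψ := ψ) hp).chain_bridge hi false hp'
  have hfst := fst_arc_bar (ψ := ψ) i false
  have hsnd : (arc ψ (bar s i false)).snd = branch ψ (node s i true) := by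
    rw [snd_arc, rev_bar, src_bar]; rfl
  have h1 := h.fst
  have h3 := h.not_onLeft_snd hs
  rw [hfst] at h1
  rw [hsnd] at h3
  -- The left arcs start in this triangle and run along an interior lattice point, which can only be
  -- its third corner.
  have hc : f.IsInt c := by
    obtain ⟨p, hp, hp'⟩ := hs.exists_isInt_mem_ends (ψ := ψ) (T := left s i false) (by simp)
    have := (OrientedArc.mem_ends.1 hp').1
    rw [fst_arc_left, hi, if_pos rfl] at this
    rcases (h1.mem p).1 this with rfl | rfl | rfl
    · exact absurd hp h.not_int
    · exact absurd hp h.not_int'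
    · exact hp
  obtain ⟨a, ha, hac⟩ : ∃ a, f.IsInt a ∧ a ∈ tri (branch ψ (node s i true)) := by
    obtain ⟨p, hp, hp'⟩ := hs.exists_isInt_mem_ends (ψ := ψ) (T := right s i false) (by simp)
    have := (OrientedArc.mem_ends.1 hp').1
    rw [fst_arc_right, hi, if_pos rfl] at this
    exact ⟨p, hp, this⟩
  -- The far end of the bridge is not on the left, and the only exponents on the line are `q` and
  -- `q'`.
  have hneg : cr (q' - q) (a - q) < 0 := by
    refine lt_of_le_of_ne (not_lt.1 fun hpos => h3 ⟨a, hac, hpos⟩) fun h0 => ?_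
    rcases hs.eq_of_mem_line h.fst h.snd h.pos h.neg h.not_int h.not_int' (active_subset hac) h0
      with rfl | rfl
    · exact h.not_int ha
    · exact h.not_int' ha
  obtain ⟨α, β, hα, hβ, e1, e2⟩ := hs.exists_cone_of_opposite h.fst h.snd h.pos h.neg h.not_int
    h.not_int' (active_subset hac) hneg
  have hne : a ≠ c := by
    rintro rfl
    exact absurd h.pos hneg.not_gt
  obtain ⟨hr, y, hy, h'⟩ := hs.exists_flip h1.rotate.rotate hc h.not_int h.not_int' ha hne hα hβ
    e1 e2
  -- The triangle on the other side of `q, q'` is already a branch triangle, so the bridge is a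
  -- single edge and ends there.
  have hy1 : (arc ψ (bar s i false)).vertAt 1 = y := by
    refine hs.core_eq_of_edge h1.ne₁₂ h1.mem₁ h1.mem₂ h.snd.mem₁ h.snd.mem₂ h'.mem₁ h'.mem₂ ?_ hy
    rw [← hfst]
    exact (OrientedArc.adj_fst _).ne.symm
  have hbr : IsBranch f.core y := by
    obtain ⟨y₁, g1, g2, g3⟩ := hs.exists_core_neighbor (x := y) hr h'.mem₃ h'.mem₂ h'.ne₂₃.symm
    obtain ⟨y₂, k1, k2, k3⟩ := hs.exists_core_neighbor (x := y) hr h'.mem₃ h'.mem₁ h'.ne₁₃.symm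
    exact isBranch_of_neighbors h' g1 k1 hy.symm g3 g2 k3 k2 h1.mem₁ h1.mem₂
  have hy2 := OrientedArc.snd_eq_vertAt_one (A := arc ψ (bar s i false)) (hy1.symm ▸ hbr)
  rw [hsnd, hy1] at hy2
  rw [← hy2] at h'
  exact ⟨c, _, q, q', hc, hr, h.not_int, h.not_int', h1.rotate.rotate, h'.rotate.rotate, rfl⟩

/-- The triangles at a node whose new edge is shared by the adjacent cycles. -/
theorem IsSmooth.exists_pair (hs : f.IsSmooth) {i : Fin n} (hi : s i = false) :
    ∃ (l r : ℤ × ℤ) (q : Bool → ℤ × ℤ), f.IsInt l ∧ f.IsInt r ∧ (∀ b, ¬ f.IsInt (q b)) ∧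
      ∀ b, IsTri f (branch ψ (node s i b)).1.1 l r (q b) := by
  have hL : ∀ b, (arc ψ (left s i b)).fst = branch ψ (node s i b) := by
    intro b; rw [fst_arc_left, hi]; rfl
  have hR : ∀ b, (arc ψ (right s i b)).fst = branch ψ (node s i b) := by
    intro b; rw [fst_arc_right, hi]; rfl
  have hH : ∀ b, (arc ψ (bar s i b)).fst = branch ψ (node s i b) := fst_arc_bar i
  have hinj := arc_injective ψ
  have two : ∀ b p, p ∈ tri (branch ψ (node s i b)) → _ := fun b p hp =>
    OrientedArc.mem_two_of_three hs (hinj.ne (show left s i b ≠ right s i b by simp))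
      (hinj.ne (show left s i b ≠ bar s i b by simp))
      (hinj.ne (show right s i b ≠ bar s i b by simp))
      ((hL b).trans (hR b).symm) ((hL b).trans (hH b).symm) ((hL b).symm ▸ hp)
  -- A point along one left (or right) arc is along the other, by parity. So the two vertices of the
  -- node have the same interior corners.
  have hshare : ∀ b b' p, f.IsInt p → p ∈ tri (branch ψ (node s i b)) →
      p ∈ tri (branch ψ (node s i b')) := by
    intro b b' p hp hpb
    have h1 := two b p hpb
    have h2 := hs.mem_left_iff (ψ := ψ) hp i b b'
    have h3 := hs.mem_right_iff (ψ := ψ) hp i b b'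
    have h4 : p ∈ (arc ψ (left s i b')).ends → p ∈ tri (branch ψ (node s i b')) := by
      intro h; rw [← hL]; exact (OrientedArc.mem_ends.1 h).1
    have h5 : p ∈ (arc ψ (right s i b')).ends → p ∈ tri (branch ψ (node s i b')) := by
      intro h; rw [← hR]; exact (OrientedArc.mem_ends.1 h).1
    rcases h1 with h | h | h
    · exact h4 (h2.1 h.1)
    · exact h4 (h2.1 h.1)
    · exact h5 (h3.1 h.2.1)
  -- With interior corners only, the two triangles would coincide.
  have hq : ∀ b, ∃ q ∈ tri (branch ψ (node s i b)), ¬ f.IsInt q := by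
    intro b
    by_contra hcon
    push Not at hcon
    have := hs.eq_of_tri_subset fun p hp => hshare b (!b) p (hcon p hp) hp
    have := branch_injective ψ this
    simp at this
  choose q hqm hqi using hq
  -- Each of the three arcs at the vertex runs along an interior lattice point, and a single point
  -- runs along only two of them.
  obtain ⟨l, r, hl, hr, hlr, hlm, hrm⟩ : ∃ l r, f.IsInt l ∧ f.IsInt r ∧ l ≠ r ∧
      l ∈ tri (branch ψ (node s i false)) ∧ r ∈ tri (branch ψ (node s i false)) := by
    obtain ⟨p₁, hp₁, hm₁⟩ := hs.exists_isInt_mem_ends (ψ := ψ) (T := left s i false) (by simp)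
    obtain ⟨p₂, hp₂, hm₂⟩ := hs.exists_isInt_mem_ends (ψ := ψ) (T := right s i false) (by simp)
    obtain ⟨p₃, hp₃, hm₃⟩ := hs.exists_isInt_mem_ends (ψ := ψ) (T := bar s i false) (by
      intro j b h
      rw [bar_inj] at h
      rw [← h.1, hi])
    have t₁ : p₁ ∈ tri (branch ψ (node s i false)) := by
      rw [← hL]; exact (OrientedArc.mem_ends.1 hm₁).1
    have t₂ : p₂ ∈ tri (branch ψ (node s i false)) := by
      rw [← hR]; exact (OrientedArc.mem_ends.1 hm₂).1
    have t₃ : p₃ ∈ tri (branch ψ (node s i false)) := by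
      rw [← hH]; exact (OrientedArc.mem_ends.1 hm₃).1
    by_cases h12 : p₁ = p₂
    · by_cases h13 : p₁ = p₃
      · subst h12 h13
        rcases two false _ t₁ with h | h | h
        · exact absurd hm₃ h.2.2
        · exact absurd hm₂ h.2.1
        · exact absurd hm₁ h.1
      · exact ⟨p₁, p₃, hp₁, hp₃, h13, t₁, t₃⟩
    · exact ⟨p₁, p₂, hp₁, hp₂, h12, t₁, t₂⟩
  refine ⟨l, r, q, hl, hr, hqi, fun b => hs.isTri_of_mem (isVertex_core _) (hshare _ b _ hl hlm)
    (hshare _ b _ hr hrm) (hqm b) hlr ?_ ?_⟩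
  · rintro rfl; exact hqi b hl
  · rintro rfl; exact hqi b hr

/-- Decides which of the two interior points at a node with a shared new edge is the left one. `A`,
`C`, `H` say that the first point is along the left arc, the right arc and the new edge; `B`, `D`,
`H'` say the same of the second point. `P` and `Q` say that there is a node on the left and on the
right, in which case the arcs there have only one point. -/
theorem exists_order {A B C D H H' P Q : Prop}
    (h : (A ∧ C ∧ ¬ H) ∨ (A ∧ ¬ C ∧ H) ∨ (¬ A ∧ C ∧ H))
    (h' : (B ∧ D ∧ ¬ H') ∨ (B ∧ ¬ D ∧ H') ∨ (¬ B ∧ D ∧ H')) (h₁ : A ∨ B) (h₂ : C ∨ D)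
    (h₃ : P → ¬ (A ∧ B)) (h₄ : Q → ¬ (C ∧ D)) :
    ((P → A ∧ ¬ B) ∧ (Q → D ∧ ¬ C)) ∨ ((P → B ∧ ¬ A) ∧ (Q → C ∧ ¬ D)) := by
  by_cases A <;> by_cases B <;> by_cases C <;> by_cases D <;> simp_all

/-- The arcs to the left of the node go around `l`, those to the right around `r`. Nothing is
claimed about outer half-edges of the end nodes, which form loops. -/
theorem IsSmooth.exists_node (hs : f.IsSmooth) (i : Fin n) : ∃ l r : ℤ × ℤ, f.IsInt l ∧ f.IsInt r ∧
    (∀ b a, f.IsInt a → a ∈ tri (branch ψ (node s i b)) → a = l ∨ a = r) ∧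
    (0 < i.val → ∃ q, IsEnd (fun b => arc ψ (left s i b)) l r q) ∧
    (i.val + 1 < n → ∃ q, IsEnd (fun b => arc ψ (right s i b)) r l q) := by
  have hinj := arc_injective ψ
  cases hi : s i
  · obtain ⟨l, r, q, hl, hr, hq, h⟩ := hs.exists_pair (ψ := ψ) hi
    have hL : ∀ b, (arc ψ (left s i b)).fst = branch ψ (node s i b) := by
      intro b; rw [fst_arc_left, hi]; rfl
    have hR : ∀ b, (arc ψ (right s i b)).fst = branch ψ (node s i b) := by
      intro b; rw [fst_arc_right, hi]; rfl
    have hne : branch ψ (node s i false) ≠ branch ψ (node s i true) :=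
      (branch_injective ψ).ne (by simp)
    have key : ∀ l r, f.IsInt l → f.IsInt r →
        (∀ b, IsTri f (branch ψ (node s i b)).1.1 l r (q b)) →
        (0 < i.val → l ∈ (arc ψ (left s i false)).ends ∧ r ∉ (arc ψ (left s i false)).ends) →
        (i.val + 1 < n → r ∈ (arc ψ (right s i false)).ends ∧
          l ∉ (arc ψ (right s i false)).ends) →
        ∃ l r : ℤ × ℤ, f.IsInt l ∧ f.IsInt r ∧
          (∀ b a, f.IsInt a → a ∈ tri (branch ψ (node s i b)) → a = l ∨ a = r) ∧
          (0 < i.val → ∃ q, IsEnd (fun b => arc ψ (left s i b)) l r q) ∧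
          (i.val + 1 < n → ∃ q, IsEnd (fun b => arc ψ (right s i b)) r l q) := by
      intro l r hl hr h h1 h2
      refine ⟨l, r, hl, hr, ?_, fun h0 => ?_, fun h0 => ?_⟩
      · intro b a ha hab
        rcases ((h b).mem a).1 hab with rfl | rfl | rfl
        · exact Or.inl rfl
        · exact Or.inr rfl
        · exact absurd ha (hq b)
      · refine hs.exists_isEnd_of_ne (q := q) (by simpa only [hL] using hne)
          (fun b => by simpa only [hL] using h b) hl hq hr (fun b => ?_) (fun b => ?_)
        · exact (hs.mem_left_iff hl i _ _).1 (h1 h0).1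
        · exact fun hb => (h1 h0).2 ((hs.mem_left_iff hr i _ _).1 hb)
      · refine hs.exists_isEnd_of_ne (q := q) (by simpa only [hR] using hne)
          (fun b => by simpa only [hR] using (h b).rotate.swap) hr hq hl
          (fun b => ?_) (fun b => ?_)
        · exact (hs.mem_right_iff hr i _ _).1 (h2 h0).1
        · exact fun hb => (h2 h0).2 ((hs.mem_right_iff hl i _ _).1 hb)
    have two : ∀ p, p ∈ tri (branch ψ (node s i false)) → _ := fun p hp =>
      OrientedArc.mem_two_of_three hs (hinj.ne (show left s i false ≠ right s i false by simp))
        (hinj.ne (show left s i false ≠ bar s i false by simp))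
        (hinj.ne (show right s i false ≠ bar s i false by simp))
        ((hL false).trans (hR false).symm) ((hL false).trans (fst_arc_bar i false).symm)
        ((hL false).symm ▸ hp)
    have hlt := two l (h false).mem₁
    have hrt := two r (h false).mem₂
    have hlr := (h false).ne₁₂
    have hor : ∀ p, f.IsInt p → p ∈ tri (branch ψ (node s i false)) → p = l ∨ p = r := by
      intro p hp hpt
      rcases ((h false).mem p).1 hpt with rfl | rfl | rfl
      · exact Or.inl rfl
      · exact Or.inr rfl
      · exact absurd hp (hq false)
    have hLne : l ∈ (arc ψ (left s i false)).ends ∨ r ∈ (arc ψ (left s i false)).ends := by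
      obtain ⟨p, hp, hm⟩ := hs.exists_isInt_mem_ends (ψ := ψ) (T := left s i false) (by simp)
      rcases hor p hp (by rw [← hL]; exact (OrientedArc.mem_ends.1 hm).1) with rfl | rfl
      · exact Or.inl hm
      · exact Or.inr hm
    have hRne : l ∈ (arc ψ (right s i false)).ends ∨ r ∈ (arc ψ (right s i false)).ends := by
      obtain ⟨p, hp, hm⟩ := hs.exists_isInt_mem_ends (ψ := ψ) (T := right s i false) (by simp)
      rcases hor p hp (by rw [← hR]; exact (OrientedArc.mem_ends.1 hm).1) with rfl | rfl
      · exact Or.inl hm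
      · exact Or.inr hm
    have hLu : 0 < i.val → ¬ (l ∈ (arc ψ (left s i false)).ends ∧
        r ∈ (arc ψ (left s i false)).ends) :=
      fun h0 hh => hlr (hs.eq_of_mem_left h0 hl hr hh.1 hh.2)
    have hRu : i.val + 1 < n → ¬ (l ∈ (arc ψ (right s i false)).ends ∧
        r ∈ (arc ψ (right s i false)).ends) :=
      fun h0 hh => hlr (hs.eq_of_mem_right h0 hl hr hh.1 hh.2)
    rcases exists_order hlt hrt hLne hRne hLu hRu with ⟨h1, h2⟩ | ⟨h1, h2⟩
    · exact key l r hl hr h h1 h2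
    · exact key r l hr hl (fun b => (h b).rotate.swap) h1 h2
  · obtain ⟨l, r, q, q', hl, hr, hq, hq', h, h', e⟩ := hs.exists_bridge (ψ := ψ) hi
    refine ⟨l, r, hl, hr, ?_, fun _ => ?_, fun _ => ?_⟩
    · intro b a ha hab
      cases b
      · rcases (h.mem a).1 hab with rfl | rfl | rfl
        · exact Or.inl rfl
        · exact absurd ha hq
        · exact absurd ha hq'
      · rcases (h'.mem a).1 hab with rfl | rfl | rfl
        · exact Or.inr rfl
        · exact absurd ha hq
        · exact absurd ha hq'
    · refine hs.exists_isEnd_of_eq (x := branch ψ (node s i false)) (fun b => ?_)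
        (hinj.ne (by simp)) h hl hq hq' hr e fun b => hs.exists_isInt_mem_ends (by simp)
      simp only [fst_arc_left, hi, if_true]
    · refine hs.exists_isEnd_of_eq (x := branch ψ (node s i true)) (fun b => ?_)
        (hinj.ne (by simp)) h' hr hq hq' hl (by rw [e]; abel)
        fun b => hs.exists_isInt_mem_ends (by simp)
      simp only [fst_arc_right, hi, if_true]

end TropicalPolynomial

/-! ### What is seen from an interior lattice point through the ends of two arcs around it. -/

namespace TropicalPolynomial

variable {f : TropicalPolynomial}

theorem IsTri.eq_or_eq {w : ℝ × ℝ} {p a b a' b' : ℤ × ℤ} (h : IsTri f w p a b)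
    (h' : IsTri f w p a' b') : (a' = a ∧ b' = b) ∨ (a' = b ∧ b' = a) := by
  rcases (h.mem a').1 h'.mem₂ with rfl | rfl | rfl
  · exact absurd rfl h'.ne₁₂
  · rcases (h.mem b').1 h'.mem₃ with rfl | rfl | rfl
    · exact absurd rfl h'.ne₁₃
    · exact absurd rfl h'.ne₂₃
    · exact Or.inl ⟨rfl, rfl⟩
  · rcases (h.mem b').1 h'.mem₃ with rfl | rfl | rfl
    · exact absurd rfl h'.ne₁₃
    · exact Or.inr ⟨rfl, rfl⟩
    · exact absurd rfl h'.ne₂₃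

/-- The vector `x` lies in the cone spanned by `u` and `v`. -/
def InCone (u v x : ℤ × ℤ) : Prop := ∃ α β : ℤ, 0 ≤ α ∧ 0 ≤ β ∧ x = α • u + β • v

theorem InCone.swap {u v x : ℤ × ℤ} (h : InCone u v x) : InCone v u x := by
  obtain ⟨α, β, hα, hβ, e⟩ := h
  exact ⟨β, α, hβ, hα, by rw [e, add_comm]⟩

theorem mem_active_of_inCone {w w' : ℝ × ℝ} {p z a b : ℤ × ℤ} (hp : p ∈ f.active w)
    (hz : z ∈ f.active w) (h : IsTri f w' p a b) (hc : InCone (a - p) (b - p) (z - p)) :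
    z ∈ f.active w' := by
  obtain ⟨α, β, hα, hβ, e⟩ := hc
  have e1 := congrArg Prod.fst e
  have e2 := congrArg Prod.snd e
  simp only [Prod.fst_sub, Prod.snd_sub, Prod.fst_add, Prod.snd_add, Prod.smul_fst,
    Prod.smul_snd, smul_eq_mul] at e1 e2
  have e1' : (z.1 : ℝ) - p.1 = α * (a.1 - p.1) + β * (b.1 - p.1) := by exact_mod_cast e1
  have e2' : (z.2 : ℝ) - p.2 = α * (a.2 - p.2) + β * (b.2 - p.2) := by exact_mod_cast e2
  exact mem_active_of_cone hp hz hz h.mem₁ h.mem₂ h.mem₃ one_pos le_rfl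
    (Int.cast_nonneg hα) (Int.cast_nonneg hβ) (by linarith) (by linarith)

theorem mem_active_of_add_inCone {w w' : ℝ × ℝ} {p x y a b : ℤ × ℤ} (h : IsTri f w p x y)
    (h' : IsTri f w' p a b) (hc : InCone (a - p) (b - p) ((x - p) + (y - p))) :
    x ∈ f.active w' := by
  obtain ⟨α, β, hα, hβ, e⟩ := hc
  have e1 := congrArg Prod.fst e
  have e2 := congrArg Prod.snd e
  simp only [Prod.fst_sub, Prod.snd_sub, Prod.fst_add, Prod.snd_add, Prod.smul_fst,
    Prod.smul_snd, smul_eq_mul] at e1 e2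
  have e1' : ((x.1 : ℝ) - p.1) + (y.1 - p.1) = α * (a.1 - p.1) + β * (b.1 - p.1) := by
    exact_mod_cast e1
  have e2' : ((x.2 : ℝ) - p.2) + (y.2 - p.2) = α * (a.2 - p.2) + β * (b.2 - p.2) := by
    exact_mod_cast e2
  exact mem_active_of_cone h.mem₁ h.mem₂ h.mem₃ h'.mem₁ h'.mem₂ h'.mem₃ one_pos zero_le_one
    (Int.cast_nonneg hα) (Int.cast_nonneg hβ) (by linarith) (by linarith)

namespace IsEnd

variable {d : Bool → OrientedArc f.core} {p m : ℤ × ℤ} {q : Bool → ℤ × ℤ}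

theorem ne (h : IsEnd d p m q) (b : Bool) : p ≠ q b := by
  intro e
  exact h.not_int b (e ▸ h.int)

theorem fst_eq {b : Bool} (e : (d false).fst = (d true).fst) : (d !b).fst = (d b).fst := by
  cases b
  · exact e.symm
  · exact e

theorem fst_ne {b : Bool} (e : (d false).fst ≠ (d true).fst) : (d !b).fst ≠ (d b).fst := by
  cases b
  · exact e.symm
  · exact e

theorem add_eq (e : m - p = (q false - p) + (q true - p)) (b : Bool) :
    m - p = (q b - p) + (q (!b) - p) := by
  cases b
  · exact e
  · rw [e, add_comm]; rfl

/-- The third corner of the triangle at the beginning of an arc. -/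
theorem exists_third (h : IsEnd d p m q) (b : Bool) : ∃ c, IsTri f (d b).fst.1.1 p (q b) c ∧
    cr (c - p) (q b - p) = cr (m - p) (q b - p) ∧ (c = m ∨ c = q !b) := by
  rcases h.alt with ⟨h1, _⟩ | ⟨h1, _, h3⟩
  · exact ⟨m, (h1 b).swap, rfl, Or.inl rfl⟩
  · refine ⟨q !b, h1 b, ?_, Or.inr rfl⟩
    rw [add_eq h3 b]
    simp only [cr, Prod.fst_add, Prod.snd_add]
    ring

theorem cr_eq (h : IsEnd d p m q) (b : Bool) :
    cr (m - p) (q b - p) = 1 ∨ cr (m - p) (q b - p) = -1 := by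
  obtain ⟨c, hc, e, -⟩ := h.exists_third b
  rw [← e, cr_swap]
  have := hc.cr
  omega

theorem cr_not (h : IsEnd d p m q) (b : Bool) :
    cr (m - p) (q (!b) - p) = -cr (m - p) (q b - p) := by
  rcases h.alt with ⟨h1, h2⟩ | ⟨h1, _, h3⟩
  · exact (h1 b).cr_eq_neg (h1 !b) fun e => fst_ne h2 (coreVertex_ext e).symm
  · rw [add_eq h3 b]
    simp only [cr, Prod.fst_add, Prod.snd_add]
    ring

theorem exists_cr_eq_one (h : IsEnd d p m q) :
    ∃ b, cr (m - p) (q b - p) = 1 ∧ cr (m - p) (q (!b) - p) = -1 := by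
  have h2 := h.cr_not false
  rcases h.cr_eq false with h1 | h1
  · exact ⟨false, h1, by rw [h2, h1]⟩
  · exact ⟨true, by rw [← Bool.not_false, h2, h1]; rfl, by simpa using h1⟩

theorem inCone (h : IsEnd d p m q) {b : Bool} {x : ℤ × ℤ} (hx : InCone (m - p) (q b - p) x) :
    ∃ a c, IsTri f (d b).fst.1.1 p a c ∧ InCone (a - p) (c - p) x := by
  rcases h.alt with ⟨h1, _⟩ | ⟨h1, _, h3⟩
  · exact ⟨m, q b, h1 b, hx⟩
  · obtain ⟨α, β, hα, hβ, e⟩ := hx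
    refine ⟨q b, q !b, h1 b, α + β, α, by omega, hα, ?_⟩
    rw [e, add_eq h3 b]
    module

theorem exists_inCone (h : IsEnd d p m q) {b : Bool} {a c x : ℤ × ℤ}
    (ht : IsTri f (d b).fst.1.1 p a c) (hx : InCone (a - p) (c - p) x) :
    ∃ b, InCone (m - p) (q b - p) x := by
  rcases h.alt with ⟨h1, _⟩ | ⟨h1, _, h3⟩
  · refine ⟨b, ?_⟩
    rcases ht.eq_or_eq (h1 b) with ⟨e, e'⟩ | ⟨e, e'⟩
    · rwa [e, e']
    · rw [e, e']; exact hx.swap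
  · have key : InCone (q b - p) (q (!b) - p) x := by
      rcases ht.eq_or_eq (h1 b) with ⟨e, e'⟩ | ⟨e, e'⟩
      · rwa [e, e']
      · rw [e, e']; exact hx.swap
    obtain ⟨α, β, hα, hβ, e⟩ := key
    -- In the parallelogram case the diagonal `m - p` divides the cone of the triangle into two.
    rcases le_total α β with hab | hab
    · refine ⟨!b, α, β - α, hα, by omega, ?_⟩
      rw [e, add_eq h3 b]
      module
    · refine ⟨b, β, α - β, hβ, by omega, ?_⟩
      rw [e, add_eq h3 b]
      module

/-- The direction of `m` is either an edge, which only the two first triangles share, or inside the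
cone of the common first triangle. -/
theorem eq_fst (hs : f.IsSmooth) (h : IsEnd d p m q) {y : CoreVertex f} {a c : ℤ × ℤ}
    (ht : IsTri f y.1.1 p a c) (hc : InCone (a - p) (c - p) (m - p)) : ∃ b, y = (d b).fst := by
  rcases h.alt with ⟨h1, h2⟩ | ⟨h1, _, h3⟩
  · have hm := mem_active_of_inCone (h1 false).mem₁ (h1 false).mem₂ ht hc
    by_cases hy : y = (d false).fst
    · exact ⟨false, hy⟩
    · exact ⟨true, hs.core_eq_of_edge (h1 false).ne₁₂ (h1 false).mem₁ (h1 false).mem₂ ht.mem₁ hm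
        (h1 true).mem₁ (h1 true).mem₂ hy h2.symm⟩
  · refine ⟨false, (coreVertex_ext ((h1 false).eq_of_mem ht.mem₁ ?_ ?_)).symm⟩
    · exact mem_active_of_add_inCone (h1 false) ht (add_eq h3 false ▸ hc)
    · exact mem_active_of_add_inCone (h1 false).swap ht (add_eq h3 true ▸ hc)

/-- As cells meet in faces, `z` is a corner of the first triangle of the arc, and these corners have
determinant 0 or ±1 with `m`. -/
theorem cr_le_one (h : IsEnd d p m q) {b : Bool} {w : ℝ × ℝ} {z : ℤ × ℤ} (hp : p ∈ f.active w)
    (hz : z ∈ f.active w) (hc : InCone (m - p) (q b - p) (z - p)) :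
    -1 ≤ cr (m - p) (z - p) ∧ cr (m - p) (z - p) ≤ 1 := by
  obtain ⟨a, c, ht, hc'⟩ := h.inCone hc
  have hmem := mem_active_of_inCone hp hz ht hc'
  obtain ⟨c', ht', -, hc''⟩ := h.exists_third b
  have h1 := h.cr_eq b
  have h2 := h.cr_eq !b
  rcases (ht'.mem z).1 hmem with rfl | rfl | rfl
  · simp [cr]
  · omega
  · rcases hc'' with rfl | rfl
    · simp [cr, mul_comm]
    · omega

/-- The vertices around `p` next to the first vertex of an arc. -/
theorem eq_of_adj (hs : f.IsSmooth) (h : IsEnd d p m q) {b : Bool} {y : CoreVertex f} {a : ℤ × ℤ}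
    (hap : a ≠ p) (hy : y ≠ (d b).fst) (hpy : p ∈ tri y) (hay : a ∈ tri y)
    (ha : a ∈ tri (d b).fst) : ∃ b', y = (d b').fst ∨ y = (d b').vertAt 1 := by
  have hp := (OrientedArc.mem_ends.1 (h.mem b)).1
  have key : ∀ b', (d b').fst = (d b).fst → a = q b' → y = (d b').vertAt 1 := by
    rintro b' e rfl
    have h1 := OrientedArc.mem_ends.1 (h.mem b')
    have h2 := OrientedArc.mem_ends.1 (h.mem' b')
    exact hs.core_eq_of_edge (h.ne b') hp ha hpy hay h1.2 h2.2 hy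
      (e ▸ (OrientedArc.adj_fst _).ne.symm)
  rcases h.alt with ⟨h1, h2⟩ | ⟨h1, h2, h3⟩
  · rcases ((h1 b).mem a).1 ha with rfl | rfl | rfl
    · exact absurd rfl hap
    · exact ⟨!b, Or.inl (hs.core_eq_of_edge (h1 b).ne₁₂ hp ha hpy hay (h1 !b).mem₁ (h1 !b).mem₂ hy
        (fst_ne h2))⟩
    · exact ⟨b, Or.inr (key b rfl rfl)⟩
  · rcases ((h1 b).mem a).1 ha with rfl | rfl | rfl
    · exact absurd rfl hap
    · exact ⟨b, Or.inr (key b rfl rfl)⟩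
    · exact ⟨!b, Or.inr (key (!b) (fst_eq h2) rfl)⟩

/-- Allows the slack of `m` to be compared along the two arcs as if they started at a common point.
-/
theorem slack_eq (h : IsEnd d p m q) (b : Bool) :
    f.slack m (d !b).fst.1.1 = f.slack m (d b).fst.1.1 := by
  rcases h.alt with ⟨h1, _⟩ | ⟨_, h2, _⟩
  · rw [(mem_active.1 (h1 b).mem₂).2, (mem_active.1 (h1 !b).mem₂).2]
  · rw [fst_eq h2]

end IsEnd

/-- Two arcs that form the cycle around `p`, apart from what lies next to `m` at their beginning and
next to `m'` at their end. -/
structure IsPair (e : Bool → OrientedArc f.core) (p m m' : ℤ × ℤ) (q q' : Bool → ℤ × ℤ) :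
    Prop where
  left : IsEnd e p m q
  right : IsEnd (fun b => (e b).reverse) p m' q'
  ne : ∀ b b', (e b).fst ≠ (e b').snd
  ne' : e false ≠ e true

namespace IsPair

variable {e : Bool → OrientedArc f.core} {p m m' : ℤ × ℤ} {q q' : Bool → ℤ × ℤ}

theorem symm (h : IsPair e p m m' q q') :
    IsPair (fun b => (e b).reverse) p m' m q' q where
  left := h.right
  right := by simpa only [OrientedArc.reverse_reverse] using h.left
  ne b b' := (h.ne b' b).symm
  ne' he := h.ne' (by
    rw [← OrientedArc.reverse_reverse (e false), he, OrientedArc.reverse_reverse])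

/-- Otherwise, by `eq_fst`, the triangle at the start of an arc would be one of the triangles at the
other ends. -/
theorem not_inCone (hs : f.IsSmooth) (h : IsPair e p m m' q q') (b : Bool) :
    ¬ InCone (m - p) (q b - p) (m' - p) := by
  intro hc
  obtain ⟨a, c, ht, hc'⟩ := h.left.inCone hc
  obtain ⟨b', hb⟩ := h.right.eq_fst hs ht hc'
  exact h.ne b b' hb

/-- The two arcs pass through the whole ring of triangles around `p`: at their ends adjacency is
controlled by `eq_of_adj`, and elsewhere their vertices are two-valent. -/
theorem exists_vertAt (hs : f.IsSmooth) (h : IsPair e p m m' q q') {w : ℝ × ℝ}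
    (hw : f.IsVertex w) (hp : p ∈ f.active w) :
    ∃ b, ∃ i ≤ (e b).size, ((e b).vertAt i).1.1 = w := by
  have hpe : ∀ b, ∀ i ≤ (e b).size, p ∈ tri ((e b).vertAt i) :=
    fun b i hi => OrientedArc.mem_tri_vertAt hs h.left.int (h.left.mem b) hi
  refine hs.star_induction h.left.int (Z := fun w => ∃ b, ∃ i ≤ (e b).size,
    ((e b).vertAt i).1.1 = w) ⟨_, isVertex_core ((e false).vertAt 0), hpe false 0 (Nat.zero_le _),
      false, 0, Nat.zero_le _, rfl⟩ ?_ hw hp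
  rintro w w' a hw hw' hp hp' hap ha ha' ⟨b, i, hi, rfl⟩
  obtain ⟨y, rfl⟩ := hs.exists_coreVertex h.left.int hw' hp'
  suffices ∃ b, ∃ i ≤ (e b).size, (e b).vertAt i = y by
    obtain ⟨b, i, hi, e⟩ := this
    exact ⟨b, i, hi, by rw [e]⟩
  by_cases hne : y = (e b).vertAt i
  · exact ⟨b, i, hi, hne.symm⟩
  rcases Nat.eq_zero_or_pos i with rfl | hi0
  · rw [OrientedArc.vertAt_zero] at hne ha
    obtain ⟨b', hb | hb⟩ := h.left.eq_of_adj hs hap hne hp' ha' ha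
    · exact ⟨b', 0, Nat.zero_le _, by rw [OrientedArc.vertAt_zero, hb]⟩
    · exact ⟨b', 1, (e b').size_pos, hb.symm⟩
  rcases hi.eq_or_lt with rfl | hi'
  · rw [OrientedArc.vertAt_size] at hne ha
    obtain ⟨b', hb | hb⟩ := h.right.eq_of_adj (b := b) hs hap hne hp' ha' ha
    · exact ⟨b', _, le_rfl, by rw [OrientedArc.vertAt_size, hb]; rfl⟩
    · exact ⟨b', (e b').size - 1, Nat.sub_le _ _, by rw [hb, OrientedArc.vertAt_reverse]⟩
  · have hadj : f.core.Adj ((e b).vertAt i) y :=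
      core_adj_of_mem (Ne.symm hne) hap.symm (hpe b i hi) ha hp' ha'
    by_cases hy : y = (e b).vertAt (i + 1)
    · exact ⟨b, i + 1, hi', hy.symm⟩
    · obtain ⟨j, rfl⟩ : ∃ j, i = j + 1 := ⟨i - 1, by omega⟩
      refine ⟨b, j, by omega, ?_⟩
      exact (eq_of_not_isBranch ((e b).not_isBranch hi0 hi') ((e b).adj hi')
        ((e b).adj (Nat.lt_of_succ_lt hi')).symm hadj
        ((e b).vertAt_add_two hi').symm (Ne.symm hy))

/-- All interior lattice points lie in the cones at the ends of the two arcs. -/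
theorem exists_inCone (hs : f.IsSmooth) (h : IsPair e p m m' q q') {a : ℤ × ℤ} (ha : f.IsInt a)
    (hap : a ≠ p) : (∃ b, InCone (m - p) (q b - p) (a - p)) ∨
      ∃ b, InCone (m' - p) (q' b - p) (a - p) := by
  obtain ⟨w, x, y, ht, α, β, hα, hβ, e1, e2⟩ := hs.exists_cone h.left.int (a - p)
  obtain ⟨b, i, hi, rfl⟩ := h.exists_vertAt hs ht.isVertex ht.mem₁
  have hc : InCone (x - p) (y - p) (a - p) := ⟨α, β, hα, hβ, by
    ext
    · simpa using e1
    · simpa using e2⟩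
  -- The triangle through which `a` is seen is a branch triangle, so it sits at an end of one of the
  -- arcs.
  have hbr := hs.isBranch_of_cone ht h.left.int ha hap hα hβ e1 e2
  rcases Nat.eq_zero_or_pos i with rfl | hi0
  · rw [OrientedArc.vertAt_zero] at ht
    exact Or.inl (h.left.exists_inCone ht hc)
  rcases hi.eq_or_lt with rfl | hi'
  · rw [OrientedArc.vertAt_size] at ht
    exact Or.inr (h.right.exists_inCone (b := b) ht hc)
  · exact absurd hbr ((e b).not_isBranch hi0 hi')

end IsPair

end TropicalPolynomial

/-! ### Neighbours `m` and `m'` of `p` that are not opposite. -/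

namespace TropicalPolynomial

variable {f : TropicalPolynomial}

/-- A lattice point in a triangle with two corners in the interior of the Newton polygon, and not the
third corner, is in the interior. -/
theorem isInt_of_combo {p a z x : ℤ × ℤ} (hp : f.IsInt p) (ha : f.IsInt a)
    (hz : latticePoint z ∈ f.newtonPolygon) {i j k : ℤ} (hi : 0 ≤ i) (hj : 0 ≤ j) (hk : 0 ≤ k)
    (hij : 0 < i + j)
    (h : (i + j + k) • (x - p) = j • (a - p) + k • (z - p)) : f.IsInt x := by
  have e1 := congrArg Prod.fst h
  have e2 := congrArg Prod.snd h
  simp only [Prod.fst_sub, Prod.snd_sub, Prod.fst_add, Prod.snd_add, Prod.smul_fst,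
    Prod.smul_snd, smul_eq_mul] at e1 e2
  have e1' : ((i : ℝ) + j + k) * (x.1 - p.1) = j * (a.1 - p.1) + k * (z.1 - p.1) := by
    exact_mod_cast e1
  have e2' : ((i : ℝ) + j + k) * (x.2 - p.2) = j * (a.2 - p.2) + k * (z.2 - p.2) := by
    exact_mod_cast e2
  have hi' : (0 : ℝ) ≤ i := by exact_mod_cast hi
  have hj' : (0 : ℝ) ≤ j := by exact_mod_cast hj
  have hk' : (0 : ℝ) ≤ k := by exact_mod_cast hk
  have hij' : (0 : ℝ) < i + j := by exact_mod_cast hij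
  have hN : (0 : ℝ) < i + j + k := by linarith
  -- First a point on the segment between the interior points `p` and `a`, and then a point between
  -- it and `z`.
  have hy := f.convex_newtonPolygon.interior hp ha (a := (i : ℝ) / (i + j)) (b := (j : ℝ) / (i + j))
    (by positivity) (by positivity) (by field_simp)
  have := f.convex_newtonPolygon.combo_interior_self_mem_interior hy hz
    (a := ((i : ℝ) + j) / (i + j + k)) (b := (k : ℝ) / (i + j + k)) (by positivity) (by positivity)
    (by field_simp)
  unfold IsInt
  convert this using 1
  have h1 : (x.1 : ℝ) = (i * p.1 + j * a.1 + k * z.1) / (i + j + k) := by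
    rw [eq_div_iff hN.ne']
    linear_combination e1'
  have h2 : (x.2 : ℝ) = (i * p.2 + j * a.2 + k * z.2) / (i + j + k) := by
    rw [eq_div_iff hN.ne']
    linear_combination e2'
  ext
  · simp only [latticePoint, Prod.fst_add, Prod.smul_fst, smul_eq_mul]
    rw [h1]
    field_simp
  · simp only [latticePoint, Prod.snd_add, Prod.smul_snd, smul_eq_mul]
    rw [h2]
    field_simp

theorem cr_add_left (u v w : ℤ × ℤ) : cr (u + v) w = cr u w + cr v w := by
  simp only [cr, Prod.fst_add, Prod.snd_add]
  ring

theorem cr_add_right (u v w : ℤ × ℤ) : cr w (u + v) = cr w u + cr w v := by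
  simp only [cr, Prod.fst_add, Prod.snd_add]
  ring

theorem cr_smul_left (k : ℤ) (u v : ℤ × ℤ) : cr (k • u) v = k * cr u v := by
  simp only [cr, Prod.smul_fst, Prod.smul_snd, smul_eq_mul]
  ring

theorem cr_smul_right (k : ℤ) (u v : ℤ × ℤ) : cr u (k • v) = k * cr u v := by
  simp only [cr, Prod.smul_fst, Prod.smul_snd, smul_eq_mul]
  ring

@[simp] theorem cr_self (u : ℤ × ℤ) : cr u u = 0 := by
  simp only [cr]
  ring

theorem eq_combo {u v x : ℤ × ℤ} (h : cr u v = 1) : x = cr x v • u + cr u x • v := by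
  obtain ⟨e1, e2⟩ := exists_combo (x := x) (Or.inl h)
  rw [h, one_mul, one_mul] at e1 e2
  ext
  · simpa using e1
  · simpa using e2

theorem eq_combo_neg {u v x : ℤ × ℤ} (h : cr u v = -1) : x = (-cr x v) • u + (-cr u x) • v := by
  obtain ⟨e1, e2⟩ := exists_combo (x := x) (Or.inr h)
  rw [h, neg_one_mul, neg_one_mul] at e1 e2
  ext
  · simpa using e1
  · simpa using e2

namespace IsPair

variable {e : Bool → OrientedArc f.core} {p m m' : ℤ × ℤ} {q q' : Bool → ℤ × ℤ}

/-- Here `q b` lies on the same side of `m` as `m'`. If it reached the direction of `m'`, then `m'`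
would be in the cone of `m` and `q b`, contrary to `not_inCone`. -/
theorem cr_neg_of_pos (hs : f.IsSmooth) (h : IsPair e p m m' q q') (hD : 0 < cr (m' - p) (m - p))
    {b : Bool} (hb : cr (m - p) (q b - p) = -1) : 0 < cr (m' - p) (q b - p) := by
  by_contra hcon
  refine h.not_inCone hs b ⟨_, _, ?_, ?_, eq_combo_neg hb⟩
  · omega
  · rw [cr_swap]; omega

theorem cr_neg_of_pos' (hs : f.IsSmooth) (h : IsPair e p m m' q q') (hD : 0 < cr (m' - p) (m - p))
    {b : Bool} (hb : cr (m' - p) (q' b - p) = 1) : 0 < cr (q' b - p) (m - p) := by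
  by_contra hcon
  refine h.symm.not_inCone hs b ⟨_, _, ?_, hD.le, eq_combo hb⟩
  rw [cr_swap]; omega

/-- An interior lattice point in the cone of `m'` and `m`, next to both. -/
theorem not_isInt (hs : f.IsSmooth) (h : IsPair e p m m' q q') (hD : 0 < cr (m' - p) (m - p))
    {r : ℤ × ℤ} (hr : f.IsInt r) (h1 : cr (m' - p) (r - p) = 1) (h2 : 0 < cr (r - p) (m - p))
    (h3 : cr (r - p) (m - p) ≤ cr (m' - p) (m - p)) : False := by
  have hrp : r ≠ p := by
    rintro rfl
    simp [cr] at h2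
  -- Seen through an end of the arcs, `r` is in the cone of `m, q b` or of `m', q' b`. The two
  -- height conditions then force it to be `q b` or `q' b`, which is not interior.
  rcases h.exists_inCone hs hr hrp with ⟨b, α, β, hα, hβ, e⟩ | ⟨b, α, β, hα, hβ, e⟩
  · rw [e, cr_add_left, cr_smul_left, cr_smul_left, cr_self, mul_zero, zero_add,
      cr_swap (m - p)] at h2
    rcases h.left.cr_eq b with hb | hb
    · rw [hb] at h2; omega
    · have hpos := h.cr_neg_of_pos hs hD hb
      rw [hb] at h2
      rw [e, cr_add_right, cr_smul_right, cr_smul_right] at h1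
      have hβ1 : 1 ≤ β := by omega
      have hα0 : α = 0 := by nlinarith
      subst hα0
      have hβ1 : β = 1 := by nlinarith
      subst hβ1
      rw [zero_smul, zero_add, one_smul, sub_left_inj] at e
      exact h.left.not_int b (e ▸ hr)
  · rw [e, cr_add_right, cr_smul_right, cr_smul_right, cr_self, mul_zero, zero_add] at h1
    rcases h.right.cr_eq b with hb | hb
    · have hpos := h.cr_neg_of_pos' hs hD hb
      rw [hb] at h1
      obtain rfl : β = 1 := by omega
      rw [e, cr_add_left, cr_smul_left, one_smul] at h3
      have hα0 : α = 0 := by nlinarith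
      subst hα0
      rw [zero_smul, zero_add, one_smul, sub_left_inj] at e
      exact h.right.not_int b (e ▸ hr)
    · rw [hb] at h1; omega

/-- If the determinant were larger than 1, the triangle `p, m', m` would contain a lattice point of
the kind excluded by `not_isInt`. -/
theorem cr_eq_one (hs : f.IsSmooth) (h : IsPair e p m m' q q') (hD : 0 < cr (m' - p) (m - p)) :
    cr (m' - p) (m - p) = 1 := by
  by_contra hne
  obtain ⟨b, hb, -⟩ := h.right.exists_cr_eq_one
  set D := cr (m' - p) (m - p) with hDdef
  set γ := cr (q' b - p) (m - p) with hγ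
  -- The point `q' b` has height 1 over `m' - p`; a shift along `m' - p` reduces its other
  -- determinant modulo `D`.
  set r : ℤ × ℤ := p + ((-(γ / D)) • (m' - p) + (q' b - p)) with hrdef
  have hrp : r - p = (-(γ / D)) • (m' - p) + (q' b - p) := by rw [hrdef]; abel
  have h1 : cr (m' - p) (r - p) = 1 := by
    rw [hrp, cr_add_right, cr_smul_right, cr_self, hb]; simp
  have h2 : cr (r - p) (m - p) = γ % D := by
    rw [hrp, cr_add_left, cr_smul_left, ← hDdef, ← hγ, Int.emod_def]; ring
  have hlt := Int.emod_lt_of_pos γ hD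
  have hnonneg := Int.emod_nonneg γ hD.ne'
  -- If `D` divided `γ`, it would divide the vector `m - p`, which is primitive by `cr_eq`.
  have hne0 : γ % D ≠ 0 := by
    intro h0
    have hdvd : D ∣ γ := Int.dvd_of_emod_eq_zero h0
    have e1 := eq_combo (x := m - p) hb
    rw [← hDdef, cr_swap, ← hγ] at e1
    have hc : ∀ x, D ∣ cr (m - p) x := by
      intro x
      rw [e1, cr_add_left, cr_smul_left, cr_smul_left]
      exact dvd_add ((dvd_neg.2 hdvd).mul_right _) (dvd_mul_right _ _)
    have := hc (q false - p)
    rcases h.left.cr_eq false with e2 | e2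
    · rw [e2] at this
      exact hne (Int.eq_one_of_dvd_one hD.le this)
    · rw [e2, dvd_neg] at this
      exact hne (Int.eq_one_of_dvd_one hD.le this)
  refine h.not_isInt hs hD (r := r) ?_ h1 (by omega) (by omega)
  refine isInt_of_combo (i := D - 1 - γ % D) (j := γ % D) (k := 1) h.left.int h.right.int'
    (interior_subset h.left.int') (by omega) hnonneg zero_le_one (by omega) ?_
  rw [show D - 1 - γ % D + γ % D + 1 = D by ring, one_smul, hrp]
  have e1 := eq_combo (x := m - p) hb
  rw [← hDdef, cr_swap, ← hγ] at e1
  rw [e1, Int.emod_def]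
  module

theorem not_isInt_add (hs : f.IsSmooth) (h : IsPair e p m m' q q') (hD : 0 < cr (m' - p) (m - p)) :
    ¬ f.IsInt (m' + m - p) := by
  intro hr
  have h1 := h.cr_eq_one hs hD
  have e1 : m' + m - p - p = (m' - p) + (m - p) := by abel
  refine h.not_isInt hs hD hr ?_ ?_ ?_
  · rw [e1, cr_add_right, cr_self, h1]; rfl
  · rw [e1, cr_add_left, cr_self, h1]; norm_num
  · rw [e1, cr_add_left, cr_self, add_zero]

/-- In the basis `m' - p`, `m - p` the corner is `(k, 1)` with `k ≥ 1`. If `k ≥ 2`, the point `(1,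
1)` lies between the interior point `m` and this corner, contrary to `not_isInt_add`. -/
theorem eq_right (hs : f.IsSmooth) (h : IsPair e p m m' q q') (hD : 0 < cr (m' - p) (m - p))
    {b : Bool} (hb : cr (m' - p) (q' b - p) = 1) : q' b = m' + m - p := by
  have h1 := h.cr_eq_one hs hD
  have hpos := h.cr_neg_of_pos' hs hD hb
  have e1 := eq_combo (x := q' b - p) h1
  rw [hb, one_smul] at e1
  set k := cr (q' b - p) (m - p)
  by_contra hne
  have hk : k ≠ 1 := by
    rintro hk
    rw [hk, one_smul] at e1
    apply hne
    rw [← sub_left_inj (a := p), e1]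
    abel
  obtain ⟨c, hc, -⟩ := h.right.exists_third b
  refine h.not_isInt_add hs hD (isInt_of_combo (i := 0) (j := k - 1) (k := 1) h.left.int
    h.left.int' (mem_newtonPolygon (active_subset hc.mem₂)) le_rfl (by omega) zero_le_one
    (by omega) ?_)
  rw [e1]
  module

theorem eq_left (hs : f.IsSmooth) (h : IsPair e p m m' q q') (hD : 0 < cr (m' - p) (m - p))
    {b : Bool} (hb : cr (m - p) (q b - p) = -1) : q b = m' + m - p := by
  have h1 := h.cr_eq_one hs hD
  have hpos := h.cr_neg_of_pos hs hD hb
  have e1 := eq_combo (x := q b - p) h1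
  rw [cr_swap (m - p), hb, neg_neg, one_smul] at e1
  set k := cr (m' - p) (q b - p)
  by_contra hne
  have hk : k ≠ 1 := by
    rintro hk
    rw [hk, one_smul] at e1
    apply hne
    rw [← sub_left_inj (a := p), e1]
    abel
  obtain ⟨c, hc, -⟩ := h.left.exists_third b
  refine h.not_isInt_add hs hD (isInt_of_combo (i := 0) (j := k - 1) (k := 1) h.left.int
    h.right.int' (mem_newtonPolygon (active_subset hc.mem₂)) le_rfl (by omega) zero_le_one
    (by omega) ?_)
  rw [e1]
  module

/-- The exponents next to `p` do not go below the first row under the line from `p` to `m'`. -/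
theorem neg_one_le_cr (hs : f.IsSmooth) (h : IsPair e p m m' q q')
    (hD : 0 < cr (m' - p) (m - p)) {w : ℝ × ℝ} {z : ℤ × ℤ} (hp : p ∈ f.active w)
    (hz : z ∈ f.active w) : -1 ≤ cr (m' - p) (z - p) := by
  have h1 := h.cr_eq_one hs hD
  have ez := eq_combo (x := z - p) h1
  by_contra hcon
  obtain ⟨k, hk⟩ : ∃ k, k = cr (m' - p) (z - p) := ⟨_, rfl⟩
  obtain ⟨α, hα⟩ : ∃ α, α = cr (z - p) (m - p) := ⟨_, rfl⟩
  obtain ⟨N, hN⟩ : ∃ N, N = -k := ⟨_, rfl⟩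
  rw [← hk, ← hα] at ez
  have hN2 : 2 ≤ N := by omega
  -- If `z` is in row `-N`, the triangle `p, m', z` has in row `-1` the lattice point `(t, -1)` with
  -- `t` equal to `α / N` rounded up. It is interior because it is not `z` itself.
  obtain ⟨t, ht0, ht1⟩ : ∃ t, 0 ≤ t * N - α ∧ t * N - α ≤ N - 1 := by
    refine ⟨-((-α) / N), ?_, ?_⟩
    · have := Int.emod_nonneg (-α) (show N ≠ 0 by omega)
      rw [Int.emod_def] at this
      linarith
    · have := Int.emod_lt_of_pos (-α) (show 0 < N by omega)
      rw [Int.emod_def] at this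
      linarith
  set a : ℤ × ℤ := p + (t • (m' - p) + (-1 : ℤ) • (m - p)) with ha
  have hap : a - p = t • (m' - p) + (-1 : ℤ) • (m - p) := by rw [ha]; abel
  have haint : f.IsInt a := by
    refine isInt_of_combo (i := N - 1 - (t * N - α)) (j := t * N - α) (k := 1) h.left.int
      h.right.int' (mem_newtonPolygon (active_subset hz)) (by omega) ht0 zero_le_one (by omega) ?_
    rw [hap, ez, show k = -N by omega]
    module
  have c1 : cr (m' - p) (a - p) = -1 := by
    rw [hap, cr_add_right, cr_smul_right, cr_smul_right,
      cr_self, h1]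
    ring
  have c2 : cr (a - p) (m - p) = t := by
    rw [hap, cr_add_left, cr_smul_left, cr_smul_left,
      cr_self, h1]
    ring
  have hane : a ≠ p := by
    intro e
    rw [e, sub_self] at c1
    simp [cr] at c1
  -- The point `a` is in the cone at one of the ends. In the cases compatible with its row, `z` is
  -- in the same cone, where `cr_le_one` contradicts `N ≥ 2`.
  rcases h.exists_inCone hs haint hane with ⟨b, α', β', hα', hβ', e⟩ | ⟨b, α', β', hα', hβ', e⟩
  · rw [e, cr_add_right, cr_smul_right, cr_smul_right, h1] at c1
    rw [e, cr_add_left, cr_smul_left, cr_smul_left, cr_self, cr_swap (m - p)] at c2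
    rcases h.left.cr_eq b with hb | hb
    · have ev := eq_combo (x := q b - p) h1
      rw [cr_swap (m - p), hb] at ev
      set l := cr (m' - p) (q b - p)
      have hβ1 : 1 ≤ β' := by
        by_contra h0
        have : β' = 0 := by omega
        subst this
        omega
      have hl : l ≤ -1 := by
        by_contra h0
        nlinarith
      rw [hb] at c2
      have htneg : t = -β' := by linarith
      have hαN : α ≤ -N := by nlinarith
      have := (h.left.cr_le_one (b := b) hp hz ⟨α * l - N, -α, by nlinarith, by omega, by
        rw [ez, ev, show k = -N by omega]
        module⟩).2
      rw [cr_swap (z - p), ← hα] at this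
      omega
    · have := h.cr_neg_of_pos hs hD hb
      nlinarith
  · rw [e, cr_add_right, cr_smul_right, cr_smul_right, cr_self] at c1
    rw [e, cr_add_left, cr_smul_left, cr_smul_left, h1] at c2
    rcases h.right.cr_eq b with hb | hb
    · rw [hb] at c1; omega
    · rw [hb] at c1
      obtain rfl : β' = 1 := by omega
      have ev := eq_combo (x := q' b - p) h1
      rw [hb] at ev
      set k' := cr (q' b - p) (m - p)
      have hα1 : 1 ≤ α' := by
        by_contra h0
        have : α' = 0 := by omega
        subst this
        rw [zero_smul, zero_add, one_smul, sub_left_inj] at e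
        exact h.right.not_int b (e ▸ haint)
      have hlt : 0 ≤ α - N * k' := by nlinarith
      have := (h.right.cr_le_one (b := b) hp hz ⟨α - N * k', N, hlt, by omega, by
        rw [ez, ev, show k = -N by omega]
        module⟩).1
      rw [← hk] at this
      omega

end IsPair

end TropicalPolynomial

/-! ### Lattice lengths measured by slacks. -/

namespace TropicalPolynomial

variable {f : TropicalPolynomial}

theorem coreEdge_pos {x y : CoreVertex f} (h : f.core.Adj x y) :
    0 < latticeLength (x.1.1 - y.1.1) := by
  obtain ⟨hne, hcard⟩ := core_adj.1 h
  obtain ⟨a, ha, b, hb, hab⟩ := Finset.one_lt_card.1 hcard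
  rw [Finset.mem_inter] at ha hb
  refine latticeLength_pos (sub_ne_zero.2 fun e => hne (coreVertex_ext e)) hab ?_
  have := slack_sub (f := f) a b y.1.1 x.1.1
  rw [(mem_active.1 ha.1).2, (mem_active.1 ha.2).2, (mem_active.1 hb.1).2,
    (mem_active.1 hb.2).2] at this
  simp only [Prod.fst_sub, Prod.snd_sub]
  linarith

/-- How the slack of `m` changes along the edge of the curve dual to `p, q`, in terms of its lattice
length. -/
theorem slack_step {v w : ℝ × ℝ} {p q c c' : ℤ × ℤ} (h : IsTri f v p q c) (h' : IsTri f w p q c')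
    (hne : v ≠ w) (m : ℤ × ℤ) : f.slack m w - f.slack m v =
      latticeLength (v - w) * (cr (c - p) (q - p) * cr (m - p) (q - p) : ℤ) := by
  have hq := slack_sub (f := f) q p v w
  have hc := slack_sub (f := f) c p v w
  have hm := slack_sub (f := f) m p v w
  rw [(mem_active.1 h.mem₁).2, (mem_active.1 h'.mem₁).2, (mem_active.1 h.mem₂).2,
    (mem_active.1 h'.mem₂).2] at hq
  rw [(mem_active.1 h.mem₁).2, (mem_active.1 h'.mem₁).2, (mem_active.1 h.mem₃).2] at hc
  rw [(mem_active.1 h.mem₁).2, (mem_active.1 h'.mem₁).2] at hm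
  have hcpos : 0 < f.slack c w :=
    slack_pos (active_subset h.mem₃) fun hcw => hne (h.eq_of_mem h'.mem₁ h'.mem₂ hcw)
  set D := cr (q - p) (c - p) with hD
  have hDc : cr (c - p) (q - p) = -D := cr_swap _ _
  have hDq : (D : ℝ) = (q.1 - p.1) * (c.2 - p.2) - (q.2 - p.2) * (c.1 - p.1) := by
    rw [hD]; simp [cr]
  have hsq : (D : ℝ) * D = 1 := h.cr_sq
  set t : ℝ := f.slack c w with ht
  have hx : w.1 - v.1 = -(D * t * (q.2 - p.2)) := by
    linear_combination (-(w.1 - v.1)) * hsq + D * (w.1 - v.1) * hDq + D * (q.2 - p.2) * hc -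
      D * (c.2 - p.2) * hq
  have hy : w.2 - v.2 = D * t * (q.1 - p.1) := by
    linear_combination (-(w.2 - v.2)) * hsq + D * (w.2 - v.2) * hDq - D * (q.1 - p.1) * hc +
      D * (c.1 - p.1) * hq
  -- The edge is orthogonal to `q - p`, which is primitive by unimodularity, so its lattice length
  -- is the slack that `c` acquires along it.
  have hlen : latticeLength (v - w) = t := by
    have hcop : IsCoprime (D * (q.2 - p.2)) (-(D * (q.1 - p.1))) := by
      refine ⟨-(c.1 - p.1), -(c.2 - p.2), ?_⟩
      have e : D = (q.1 - p.1) * (c.2 - p.2) - (q.2 - p.2) * (c.1 - p.1) := rfl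
      have hsq' : D * D = 1 := by exact_mod_cast hsq
      linear_combination hsq' - D * e
    have : v - w = t • latticePoint (D * (q.2 - p.2), -(D * (q.1 - p.1))) := by
      ext
      · simp only [latticePoint, Prod.fst_sub, Prod.smul_fst, smul_eq_mul]
        push_cast
        linear_combination -hx
      · simp only [latticePoint, Prod.snd_sub, Prod.smul_snd, smul_eq_mul]
        push_cast
        linear_combination -hy
    rw [this, latticeLength_smul hcpos.le hcop]
  rw [hlen, hDc]
  simp only [cr, Prod.fst_sub, Prod.snd_sub]
  push_cast
  rw [hx, hy] at hm
  linear_combination hm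

end TropicalPolynomial

namespace OrientedArc

open TropicalPolynomial

variable {f : TropicalPolynomial}

/-- The lattice length of an arc. -/
noncomputable def len (A : OrientedArc f.core) : ℝ :=
  walkLength (fun v w : CoreVertex f => latticeLength (v.1.1 - w.1.1)) A.walk

/-- The lattice length of the `i`-th edge of an arc. -/
noncomputable def edgeLen (A : OrientedArc f.core) (i : ℕ) : ℝ :=
  latticeLength ((A.vertAt i).1.1 - (A.vertAt (i + 1)).1.1)

theorem len_eq_sum (A : OrientedArc f.core) : A.len = ∑ i ∈ Finset.range A.size, A.edgeLen i :=
  walkLength_eq_sum _ _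

theorem len_reverse (A : OrientedArc f.core) : A.reverse.len = A.len :=
  f.skeleton.length_rev A

theorem edgeLen_pos (A : OrientedArc f.core) {i : ℕ} (hi : i < A.size) : 0 < A.edgeLen i :=
  coreEdge_pos (A.adj hi)

/-- The triangles along an arc around `p` turn in a constant direction. -/
theorem exists_turn (hs : f.IsSmooth) {A : OrientedArc f.core} {p q c : ℤ × ℤ} (hp : f.IsInt p)
    (hpA : p ∈ A.ends) (hqA : q ∈ A.ends) (h : IsTri f A.fst.1.1 p q c)
    (hcr : cr (c - p) (q - p) = -1) {i : ℕ} (hi : i < A.size) : ∃ q c c',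
      IsTri f (A.vertAt i).1.1 p q c ∧ IsTri f (A.vertAt (i + 1)).1.1 p q c' ∧
      cr (c - p) (q - p) = -1 := by
  induction i with
  | zero =>
    rw [mem_ends] at hpA hqA
    obtain ⟨c', hc'⟩ := hs.exists_isTri_of_mem_of_mem (isVertex_core _) hpA.2 hqA.2 h.ne₁₂
    exact ⟨q, c, c', by rwa [vertAt_zero], hc', hcr⟩
  | succ i ih =>
    obtain ⟨q, c, c', h1, h2, h3⟩ := ih (Nat.lt_of_succ_lt hi)
    have hadj := A.adj (Nat.lt_of_succ_lt hi)
    have hadj' := A.adj hi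
    have hopp := h1.cr_eq_neg h2 fun e => hadj.ne (coreVertex_ext e)
    have hpi := mem_tri_vertAt hs hp hpA (i := i + 1 + 1) hi
    -- The next triangle is reached across a side at `p` other than the one just crossed, that is,
    -- across `p, c'`.
    have hc'm : c' ∈ tri (A.vertAt (i + 1 + 1)) := by
      have hcard := hs.card_inter hadj'
      obtain ⟨r, hr, hrp⟩ := Finset.exists_mem_ne (by rw [hcard]; norm_num) p
      rw [Finset.mem_inter] at hr
      rcases (h2.mem r).1 hr.1 with rfl | rfl | rfl
      · exact absurd rfl hrp
      · exact absurd (hs.core_eq_of_edge h2.ne₁₂ h2.mem₁ h2.mem₂ h1.mem₁ h1.mem₂ hpi hr.2 hadj.ne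
          hadj'.ne.symm) (A.vertAt_add_two hi)
      · exact hr.2
    obtain ⟨c'', h4⟩ := hs.exists_isTri_of_mem_of_mem (isVertex_core _) hpi hc'm h2.ne₁₃
    refine ⟨c', q, c'', h2.swap, h4, ?_⟩
    rw [hopp, ← cr_swap, h3]

end OrientedArc

namespace TropicalPolynomial

variable {f : TropicalPolynomial}

namespace IsPair

variable {e : Bool → OrientedArc f.core} {p m m' : ℤ × ℤ} {q q' : Bool → ℤ × ℤ}

/-- If `m` and `m'` are not opposite, one of the two arcs is a single edge. -/
theorem single_edge (hs : f.IsSmooth) (h : IsPair e p m m' q q') {b b' : Bool}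
    (hq : q' b = q b') : b = b' ∧ (e b).size = 1 := by
  have h1 := OrientedArc.mem_ends.1 (h.right.mem b)
  have h2 := OrientedArc.mem_ends.1 (h.right.mem' b)
  have h3 := OrientedArc.mem_ends.1 (h.left.mem b')
  have h4 := OrientedArc.mem_ends.1 (h.left.mem' b')
  rw [← hq] at h4
  have hpq := h.right.ne b
  -- The edge `p, q' b` belongs to at most two triangles, so the last edge of `e b` and the first
  -- edge of `e b'` are the same edge of the curve.
  have e1 : (e b).reverse.vertAt 1 = (e b').fst :=
    hs.core_eq_of_edge hpq h1.1 h2.1 h1.2 h2.2 h3.1 h4.1 (OrientedArc.adj_fst _).ne.symm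
      (h.ne b' b)
  have e2 : (e b').vertAt 1 = (e b).snd :=
    hs.core_eq_of_edge hpq h3.1 h4.1 h3.2 h4.2 h1.1 h2.1 (OrientedArc.adj_fst _).ne.symm
      (h.ne b' b).symm
  have hbr : IsBranch f.core ((e b).reverse.vertAt 1) := e1 ▸ (e b').branch_fst
  have hsize := OrientedArc.size_eq_one hbr
  rw [OrientedArc.size_reverse] at hsize
  have e3 := OrientedArc.snd_eq_vertAt_one hbr
  rw [OrientedArc.snd_reverse, e1] at e3
  have e4 : e b = e b' := OrientedArc.eq_of_vertAt_one e3 (by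
    rw [e2, ← OrientedArc.vertAt_size, hsize])
  refine ⟨?_, hsize⟩
  have hne := h.ne'
  cases b <;> cases b'
  · rfl
  · exact absurd e4 hne
  · exact absurd e4.symm hne
  · rfl

/-- The slack of `m'` starts with equal values at the `m'`-ends of both arcs. It rises by exactly
the length along the arc inside the angle and by at most the length along the other; one of the two
situations at the `m`-end makes the comparison strict. -/
theorem len_ne_of_pos (hs : f.IsSmooth) (h : IsPair e p m m' q q')
    (hD : 0 < cr (m' - p) (m - p)) : (e false).len ≠ (e true).len := by
  obtain ⟨b, hb, hb'⟩ := h.right.exists_cr_eq_one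
  obtain ⟨a, ha⟩ : ∃ a, cr (m - p) (q a - p) = -1 := by
    obtain ⟨a, -, ha⟩ := h.left.exists_cr_eq_one
    exact ⟨_, ha⟩
  have h1 := h.cr_eq_one hs hD
  have hqb' := h.eq_right hs hD hb
  obtain ⟨hab, hsize⟩ := h.single_edge hs (hqb'.trans (h.eq_left hs hD ha).symm)
  subst hab
  have hqb := h.eq_left hs hD ha
  have equ : q b - p = (m' - p) + (m - p) := by rw [hqb]; abel
  suffices (e b).len < (e !b).len by
    cases b
    · exact this.ne
    · exact this.ne'
  -- the short arc
  have hlb : (e b).len = latticeLength ((e b).snd.1.1 - (e b).fst.1.1) := by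
    rw [← OrientedArc.len_reverse, OrientedArc.len_eq_sum, OrientedArc.size_reverse, hsize,
      Finset.sum_range_one, OrientedArc.edgeLen, OrientedArc.vertAt_reverse,
      OrientedArc.vertAt_reverse, hsize]
    simp only [Nat.sub_zero, zero_add, Nat.sub_self, OrientedArc.vertAt_zero]
    rw [← hsize, OrientedArc.vertAt_size]
  have hne : (e b).snd.1.1 ≠ (e b).fst.1.1 := fun e => h.ne b b (coreVertex_ext e).symm
  have s1 : f.slack m' (e b).fst.1.1 - f.slack m' (e b).snd.1.1 = (e b).len := by
    obtain ⟨c, hc, hcr, -⟩ := h.right.exists_third b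
    obtain ⟨c', hc', -⟩ := h.left.exists_third b
    rw [hqb, ← hqb'] at hc'
    rw [OrientedArc.fst_reverse] at hc
    rw [slack_step hc hc' hne m', hcr, hb, hlb]
    simp
  have s2 : f.slack m' (e !b).snd.1.1 = f.slack m' (e b).snd.1.1 := h.right.slack_eq b
  -- the long arc
  set A := (e !b).reverse with hA
  have hAlen : A.len = (e !b).len := OrientedArc.len_reverse _
  obtain ⟨c, hc, hcr, -⟩ := h.right.exists_third !b
  rw [hb'] at hcr
  -- The arc is reversed so that it starts at `m'`; the sign of `hcr` fixes its sense of rotation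
  -- around `p`.
  have turn := fun i (hi : i < A.size) => OrientedArc.exists_turn hs h.left.int (h.right.mem !b)
    (h.right.mem' !b) hc hcr hi
  have hstep : ∀ i, i < A.size → ∃ q, q ≠ p ∧ q ∈ tri (A.vertAt i) ∧ q ∈ tri (A.vertAt (i + 1)) ∧
      f.slack m' (A.vertAt (i + 1)).1.1 - f.slack m' (A.vertAt i).1.1 =
        A.edgeLen i * (-cr (m' - p) (q - p) : ℤ) ∧ -1 ≤ cr (m' - p) (q - p) := by
    intro i hi
    obtain ⟨r, c, c', t1, t2, t3⟩ := turn i hi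
    refine ⟨r, t1.ne₁₂.symm, t1.mem₂, t2.mem₂, ?_, h.neg_one_le_cr hs hD t1.mem₁ t1.mem₂⟩
    rw [slack_step t1 t2 (fun e => (A.adj hi).ne (coreVertex_ext e)) m', t3, neg_one_mul]
    rfl
  have hle : ∀ i, i < A.size →
      f.slack m' (A.vertAt (i + 1)).1.1 - f.slack m' (A.vertAt i).1.1 ≤ A.edgeLen i := by
    intro i hi
    obtain ⟨r, -, -, -, e1, e2⟩ := hstep i hi
    rw [e1]
    have : ((-cr (m' - p) (r - p) : ℤ) : ℝ) ≤ 1 := by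
      have : -cr (m' - p) (r - p) ≤ 1 := by omega
      exact_mod_cast this
    nlinarith [A.edgeLen_pos hi]
  have htel := Finset.sum_range_sub (fun i => f.slack m' (A.vertAt i).1.1) A.size
  rw [OrientedArc.vertAt_size, OrientedArc.vertAt_zero] at htel
  have hsnd : A.snd = (e !b).fst := rfl
  have hfst : A.fst = (e !b).snd := rfl
  rw [hsnd, hfst, s2] at htel
  rw [← hAlen, A.len_eq_sum]
  -- With a shared new edge at the `m`-end, the long arc ends strictly higher, by the length of that
  -- edge. At a bridge both arcs end at the same vertex, but the last edge of the long arc is dual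
  -- to `p, q !b` with `q !b - p = -(m' - p)`, and the slack of `m'` is constant along it.
  rcases h.left.alt with ⟨h2, h3⟩ | ⟨h2, h3, h4⟩
  · have hne' : (e b).fst.1.1 ≠ (e !b).fst.1.1 :=
      fun e => IsEnd.fst_ne h3 (coreVertex_ext e).symm
    have s3 := slack_step (h2 b) (h2 !b) hne' m'
    rw [equ, cr_add_left, cr_self, h1] at s3
    simp only [add_zero, mul_one, Int.cast_one] at s3
    have hadj : f.core.Adj (e b).fst (e !b).fst := core_adj_of_mem
      (fun e => hne' (by rw [e])) (h2 b).ne₁₂ (h2 b).mem₁ (h2 b).mem₂ (h2 !b).mem₁ (h2 !b).mem₂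
    have hpos := coreEdge_pos hadj
    have hsum := Finset.sum_le_sum fun i (hi : i ∈ Finset.range A.size) =>
      hle i (Finset.mem_range.1 hi)
    rw [htel] at hsum
    linarith
  · have hlast : A.size - 1 < A.size := Nat.sub_lt A.size_pos one_pos
    have hlast' : A.size - 1 + 1 = A.size := Nat.sub_add_cancel A.size_pos
    have hstrict : f.slack m' (A.vertAt (A.size - 1 + 1)).1.1 -
        f.slack m' (A.vertAt (A.size - 1)).1.1 < A.edgeLen (A.size - 1) := by
      obtain ⟨r, e1, e2, e3, e4, -⟩ := hstep _ hlast
      have e5 : A.vertAt (A.size - 1) = (e !b).vertAt 1 := by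
        rw [hA, OrientedArc.vertAt_reverse, OrientedArc.size_reverse]
        congr 1
        have := (e !b).size_pos
        omega
      have e6 : A.vertAt (A.size - 1 + 1) = (e !b).fst := by
        rw [hlast', OrientedArc.vertAt_size]; rfl
      have e7 : r = q !b := by
        by_contra hne
        have hr : r ∈ (e !b).ends := OrientedArc.mem_ends.2 ⟨e6 ▸ e3, e5 ▸ e2⟩
        have hcard := (e !b).card_ends hs
        have hsub : ({p, q !b, r} : Finset (ℤ × ℤ)) ⊆ (e !b).ends := by
          intro z hz
          simp only [Finset.mem_insert, Finset.mem_singleton] at hz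
          rcases hz with rfl | rfl | rfl
          · exact h.left.mem _
          · exact h.left.mem' _
          · exact hr
        have := Finset.card_le_card hsub
        rw [hcard, Finset.card_eq_three.2 ⟨p, q !b, r, h.left.ne _, e1.symm, Ne.symm hne, rfl⟩]
          at this
        omega
      have e8 : cr (m' - p) (r - p) = 0 := by
        have e9 := IsEnd.add_eq h4 b
        rw [equ] at e9
        have e10 : q (!b) - p = (-1 : ℤ) • (m' - p) := by
          rw [neg_one_smul, eq_neg_iff_add_eq_zero]
          have := congrArg (fun z => z - (m - p)) e9
          simp only [sub_self] at this
          rw [this]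
          abel
        rw [e7, e10, cr_smul_right, cr_self, mul_zero]
      rw [e4, e8]
      simpa using A.edgeLen_pos hlast
    have hsum := Finset.sum_lt_sum (fun i (hi : i ∈ Finset.range A.size) =>
      hle i (Finset.mem_range.1 hi)) ⟨_, Finset.mem_range.2 hlast, hstrict⟩
    rw [htel, IsEnd.fst_eq h3] at hsum
    linarith

/-- If the two arcs have the same length, then `m` and `m'` are opposite. -/
theorem eq_of_len_eq (hs : f.IsSmooth) (h : IsPair e p m m' q q')
    (hlen : (e false).len = (e true).len) : m' - p = -(m - p) := by
  rcases lt_trichotomy (cr (m' - p) (m - p)) 0 with hD | hD | hD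
  -- Reversing the arcs exchanges `m` and `m'` and the sign of the determinant.
  · refine absurd ?_ (h.symm.len_ne_of_pos hs (by rw [cr_swap]; omega))
    rw [OrientedArc.len_reverse, OrientedArc.len_reverse, hlen]
  -- Both vectors are primitive, so if parallel they are equal or opposite; equality is excluded by
  -- `not_inCone`.
  · obtain ⟨b, hb, -⟩ := h.right.exists_cr_eq_one
    have e1 := eq_combo (x := m - p) hb
    rw [hD, zero_smul, add_zero] at e1
    set t := cr (m - p) (q' b - p)
    have ht : t = 1 ∨ t = -1 := by
      have h2 := h.left.cr_eq b
      rw [e1, cr_smul_left] at h2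
      rcases h2 with h2 | h2
      · exact Int.isUnit_iff.1 (IsUnit.of_mul_eq_one _ h2)
      · exact Int.isUnit_iff.1 (IsUnit.of_mul_eq_one (-cr (m' - p) (q b - p)) (by
          rw [mul_neg, h2, neg_neg]))
    rcases ht with ht | ht
    · refine absurd ⟨1, 0, zero_le_one, le_rfl, ?_⟩ (h.not_inCone hs b)
      rw [e1, ht]
      module
    · rw [e1, ht]
      module
  · exact absurd hlen (h.len_ne_of_pos hs hD)

end IsPair

end TropicalPolynomial

/-! ### Collinearity of the interior lattice points, and the conclusion. -/

namespace TropicalPolynomial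

open Multigraph

variable {f : TropicalPolynomial} {n : ℕ} {s : Fin n → Bool}
  {ψ : Iso (chain n s) f.skeleton.toMultigraph}

/-- The interior lattice points of a nonhyperelliptic polygon are not on a line. -/
theorem exists_cr_ne_zero (hP : IsNonhyperelliptic f.newtonPolygon) (p : ℤ × ℤ) {v : ℤ × ℤ}
    (hv : v ≠ 0) : ∃ a, f.IsInt a ∧ cr v (a - p) ≠ 0 := by
  by_contra hcon
  push Not at hcon
  let φ : ℝ × ℝ →ₗ[ℝ] ℝ :=
    (v.1 : ℝ) • LinearMap.snd ℝ ℝ ℝ - (v.2 : ℝ) • LinearMap.fst ℝ ℝ ℝ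
  have hφ : ∀ x, φ x = v.1 * x.2 - v.2 * x.1 := fun x => by simp [φ]
  let Q : AffineSubspace ℝ (ℝ × ℝ) := AffineSubspace.mk' (latticePoint p) (LinearMap.ker φ)
  have hQ : ∀ x, x ∈ Q ↔ (v.1 : ℝ) * (x.2 - p.2) - v.2 * (x.1 - p.1) = 0 := by
    intro x
    rw [AffineSubspace.mem_mk', LinearMap.mem_ker, vsub_eq_sub, hφ]
    rfl
  have htop : (⊤ : AffineSubspace ℝ (ℝ × ℝ)) ≤ Q := by
    rw [← hP, interiorPolygon, affineSpan_convexHull, affineSpan_le]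
    rintro _ ⟨hx, a, rfl⟩
    have := hcon a hx
    simp only [cr, Prod.fst_sub, Prod.snd_sub] at this
    rw [SetLike.mem_coe, hQ]
    simp only [latticePoint]
    exact_mod_cast this
  -- The translate of `p` by `v` turned through a right angle is off the line.
  have hmem := (hQ _).1 (htop (AffineSubspace.mem_top ℝ _ ((p.1 : ℝ) - v.2, (p.2 : ℝ) + v.1)))
  simp only [add_sub_cancel_left, sub_sub_cancel_left] at hmem
  have hmem' : v.1 * v.1 + v.2 * v.2 = 0 := by
    have : (v.1 : ℝ) * v.1 + v.2 * v.2 = 0 := by linarith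
    exact_mod_cast this
  apply hv
  ext
  · exact mul_self_eq_zero.1 (by nlinarith [mul_self_nonneg v.1, mul_self_nonneg v.2])
  · exact mul_self_eq_zero.1 (by nlinarith [mul_self_nonneg v.1, mul_self_nonneg v.2])

/-- The two edges between consecutive nodes form a pair. -/
theorem IsSmooth.isPair (hs : f.IsSmooth) {j : ℕ} (hj : j + 1 < n) {l r l' r' : ℤ × ℤ}
    {q q' : Bool → ℤ × ℤ}
    (hL : IsEnd (fun b => arc ψ (right s ⟨j, Nat.lt_of_succ_lt hj⟩ b)) r l q)
    (hR : IsEnd (fun b => arc ψ (left s ⟨j + 1, hj⟩ b)) l' r' q') :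
    l' = r ∧ IsPair (fun b => arc ψ (right s ⟨j, Nat.lt_of_succ_lt hj⟩ b)) r l r' q q' := by
  have h : l' = r := by
    have h1 := hR.mem false
    rw [hs.mem_left_succ hj hR.int] at h1
    exact hs.eq_of_mem_right (i := ⟨j, Nat.lt_of_succ_lt hj⟩) hj hR.int hL.int h1 (hL.mem false)
  subst h
  refine ⟨rfl, hL, ?_, ?_, ?_⟩
  · simpa only [reverse_arc, rev_right (i := ⟨j, Nat.lt_of_succ_lt hj⟩) hj] using hR
  · intro b b'
    rw [fst_arc, snd_arc, rev_right (i := ⟨j, Nat.lt_of_succ_lt hj⟩) hj, src_right, src_left]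
    refine (branch_injective ψ).ne fun e => ?_
    rw [node_inj] at e
    have := congrArg Fin.val e.1
    simp at this
  · exact (arc_injective ψ).ne (by simp)

/-- With equal lengths throughout, the interior lattice points at the nodes are equally spaced on a
line, and each interior lattice point is at some node because it is a corner of a branch triangle.
For `n = 1`, where no consecutive nodes exist, the same contradiction shows that the case does not
occur. -/
theorem IsSmooth.exists_len_ne (hs : f.IsSmooth) (hP : IsNonhyperelliptic f.newtonPolygon)
    (hn : 1 ≤ n) (ψ : Iso (chain n s) f.skeleton.toMultigraph) :
    ∃ j : Fin n, j.val + 1 < n ∧ (arc ψ (right s j false)).len ≠ (arc ψ (right s j true)).len := by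
  by_contra hcon
  push Not at hcon
  choose l r hl hr hcov hleft hright using hs.exists_node (ψ := ψ)
  set o := l ⟨0, hn⟩
  set v := r ⟨0, hn⟩ - o with hv
  have key : ∀ (i : ℕ) (hi : i < n), l ⟨i, hi⟩ - o = (i : ℤ) • v ∧
      r ⟨i, hi⟩ - o = ((i : ℤ) + 1) • v := by
    intro i
    induction i with
    | zero =>
      intro hi
      refine ⟨by simp [o], ?_⟩
      rw [Nat.cast_zero, zero_add, one_smul]
    | succ i ih =>
      intro hi
      obtain ⟨e1, e2⟩ := ih (Nat.lt_of_succ_lt hi)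
      obtain ⟨q, hq⟩ := hright ⟨i, Nat.lt_of_succ_lt hi⟩ hi
      obtain ⟨q', hq'⟩ := hleft ⟨i + 1, hi⟩ (Nat.succ_pos i)
      obtain ⟨e3, hpair⟩ := hs.isPair hi hq hq'
      have e4 := hpair.eq_of_len_eq hs (hcon ⟨i, Nat.lt_of_succ_lt hi⟩ hi)
      refine ⟨by rw [e3, e2]; push_cast; rfl, ?_⟩
      -- Consecutive points are opposite about the middle one: the row continues with the same step.
      have e5 : r ⟨i + 1, hi⟩ - o = 2 • (r ⟨i, Nat.lt_of_succ_lt hi⟩ - o) -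
          (l ⟨i, Nat.lt_of_succ_lt hi⟩ - o) := by
        rw [← sub_add_sub_cancel _ (r ⟨i, Nat.lt_of_succ_lt hi⟩), e4]
        module
      rw [e5, e1, e2]
      push_cast
      module
  have hone : ∃ a, f.IsInt a ∧ a ≠ o := by
    obtain ⟨a, ha, hne⟩ := exists_cr_ne_zero hP o (v := (1, 0)) (by simp)
    refine ⟨a, ha, ?_⟩
    rintro rfl
    simp [cr] at hne
  have hline : ∀ p, f.IsInt p → ∃ k : ℤ, p - o = k • v := by
    intro p hp
    obtain ⟨a, ha, hap⟩ : ∃ a, f.IsInt a ∧ a ≠ p := by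
      by_cases hpo : p = o
      · rw [hpo]; exact hone
      · exact ⟨o, hl _, Ne.symm hpo⟩
    obtain ⟨x, hx, hpx⟩ := hs.exists_isBranch hp ha hap
    obtain ⟨u, rfl⟩ := exists_branch_eq ψ hx
    obtain ⟨⟨i, hi⟩, b, rfl⟩ := chain_vert_cases u
    rcases hcov ⟨i, hi⟩ b p hp hpx with rfl | rfl
    · exact ⟨_, (key i hi).1⟩
    · exact ⟨_, (key i hi).2⟩
  have hv0 : v ≠ 0 := by
    intro hv0
    obtain ⟨a, ha, hne⟩ := hone
    obtain ⟨k, hk⟩ := hline a ha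
    rw [hv0, smul_zero, sub_eq_zero] at hk
    exact hne hk
  obtain ⟨a, ha, hne⟩ := exists_cr_ne_zero hP o hv0
  obtain ⟨k, hk⟩ := hline a ha
  rw [hk, cr_smul_right, cr_self, mul_zero] at hne
  exact hne rfl

end TropicalPolynomial

/-- If the skeleton of a smooth tropical plane curve with nonhyperelliptic Newton polygon is
combinatorially a chain, then its metric is not hyperelliptic, and it has a two-cut whose two edges
have different lengths. -/
theorem mainTheorem3 (f : TropicalPolynomial) (hsmooth : f.IsSmooth)
    (hP : IsNonhyperelliptic f.newtonPolygon) (hchain : f.skeleton.toMultigraph.IsChain) :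
    ¬ f.skeleton.IsHyperelliptic ∧
      ∃ d e : f.skeleton.Dart, f.skeleton.toMultigraph.IsTwoCut d e ∧
        f.skeleton.length d ≠ f.skeleton.length e := by
  obtain ⟨n, hn, s, ⟨φ⟩⟩ := hchain
  obtain ⟨j, hj, hne⟩ := hsmooth.exists_len_ne hP hn φ.symm
  exact ⟨fun hG => hne (hG.length_eq φ.symm hj),
    _, _, φ.symm.isTwoCut (Multigraph.chain_isTwoCut hj), hne⟩
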